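/- Fix $g\ge 1$ and an ordered collection $\mathbf C=(\mathbf c_1,\dots,\mathbf c_g)$ of distinct real numbers. Let $\ell^2=\ell^2(\mathbb Z)$ with standard basis $\{e_n\}$ and scalar product $\langle\cdot,\cdot\rangle$ linear in the first argument, $\ell^2_+$ the closed span of $\{e_n\}_{n\ge0}$, $\ell^2_-=\ell^2\ominus\ell^2_+$, $P_\pm$ the orthogonal projections onto $\ell^2_\pm$, and $Se_n=e_{n+1}$. A (bounded two-sided) *Jacobi matrix* is a bounded operator $J$ on $\ell^2$ with $Je_n=a(n)e_{n-1}+b(n)e_n+a(n+1)e_{n+1}$, where $a(n)>0$, $b(n)\in\mathbb R$ for all $n\in\mathbb Z$. A bounded operator $A$ on $\ell^2$ is *of class $\mathbb A$ with ordered collection $\mathbf C$* and generating coefficients $\vec p_j=(p^{(j)}_0,\dots,p^{(j)}_g)^{\top}$, $\vec q_j=(q^{(j)}_0,\dots,q^{(j)}_g)^{\top}\in\mathbb R^{g+1}$, $p_g^{(j)}>0$ $(j\in\mathbb Z)$, if it is the $(g+1)$-block Jacobi matrix whose $j$-th block row (indices $j(g+1),\dots,j(g+1)+g$) consists of $A(\vec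 p_j)^*,\ B(\vec p_j,\vec q_j),\ A(\vec p_{j+1})$ in the block columns $j-1,j,j+1$, where $$A(\vec p)=\delta_g\vec p^{\,*},\qquad B(\vec p,\vec q)=(\vec q\,\vec p^{\,*})^-+(\vec p\,\vec q^{\,*})^++\mathrm{diag}(\mathbf c_1,\dots,\mathbf c_g,0),$$ $\delta_0,\dots,\delta_g$ is the standard basis of $\mathbb C^{g+1}$, $T^-$ is the strictly upper triangular part of a matrix $T$ and $T^+=T-T^-$. It is a *GMP matrix*, $A\in\mathrm{GMP}(\mathbf C)$, if moreover for every $k=1,\dots,g$ the operator $\mathbf c_k-A$ is boundedly invertible and $S^{-k}(\mathbf c_k-A)^{-1}S^k$ is of class $\mathbb A$ with some ordered collection of $g$ distinct real points. For $A\in\mathrm{GMP}(\mathbf C)$ put $A_\pm=P_\pm A|_{\ell^2_\pm}$, $\tilde e_{-1}=e_{-1}$, $\tilde e_0=\|\vec p_0\|^{-1}P_+Ae_{-1}$; let $\{\tilde e_n\}_{n\ge0}$ and $\{\tilde e_{-1-n}\}_{n\ge0}$ be the Gram–Schmidt orthonormalizations of $\{A_+^n\tilde e_0\}_{n\ge0}$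 and $\{A_-^n e_{-1}\}_{n\ge0}$, and let $Fe_n=\tilde e_n$, $n\in\mathbb Z$. For a Jacobi matrix $J$ put $J_\pm=P_\pm J|_{\ell^2_\pm}$, and write $J=\mathcal FA$ if $a(0)=\|\vec p_0\|$ and, for all $z\in\mathbb C\setminus\mathbb R$, $$\langle(J_+-z)^{-1}e_0,e_0\rangle=\langle(A_+-z)^{-1}\tilde e_0,\tilde e_0\rangle,\qquad \langle(J_--z)^{-1}e_{-1},e_{-1}\rangle=\langle(A_--z)^{-1}e_{-1},e_{-1}\rangle .$$ **Proposition.** (i) Let $J$ be a Jacobi matrix with $\mathbf c_k\notin\sigma(J)$ for $k=1,\dots,g$. Then there is $A\in\mathrm{GMP}(\mathbf C)$ with $J=\mathcal FA$; the map $F$ is unitary on $\ell^2$ and $J=F^*AF$. It is unique up to the identification $(p^{(j)}_m,q^{(j)}_m)\simeq(-p^{(j)}_m,-q^{(j)}_m)$: a matrix $A'\in\mathrm{GMP}(\mathbf C)$ satisfies $J=\mathcal FA'$ if and only if there are signs $\varepsilon_0,\dots,\varepsilon_g\in\{1,-1\}$ such that the generating coefficients of $A'$ are $(\varepsilon_mp^{(j)}_m,\varepsilon_mq^{(j)}_m)$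 for all $j\in\mathbb Z$, $0\le m\le g$ (necessarily $\varepsilon_g=1$). (ii) For every $A\in\mathrm{GMP}(\mathbf C)$ there is exactly one Jacobi matrix $J$ with $J=\mathcal FA$. For this $J$ the map $F$ is unitary, $J=F^*AF$, and $\mathbf c_k\notin\sigma(J)$ for $k=1,\dots,g$. Thus the image of $\mathcal F$ on $\mathrm{GMP}(\mathbf C)$ is exactly the set of Jacobi matrices whose spectrum contains none of the points $\mathbf c_k$. -/

import Mathlib

noncomputable section

namespace GMP

/-- The Hilbert space `ℓ²` of two-sided square-summable complex sequences. -/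
abbrev L2 : Type := lp (fun _ : ℤ => ℂ) 2

/-- The standard basis `e_n` of `ℓ²`. -/
def e (n : ℤ) : L2 := lp.single 2 n 1

/-- Entry `(i, l)` of the matrix of `T` in the standard basis. -/
def entry (T : L2 →L[ℂ] L2) (i l : ℤ) : ℂ := inner ℂ (e i) (T (e l))

/-- The closed linear span of the `e_n` with `n ∈ s`. -/
abbrev l2On (s : Set ℤ) : Submodule ℂ L2 :=
  (Submodule.span ℂ (e '' s)).topologicalClosure

/-- `ℓ²₊`, spanned by `e_n`, `n ≥ 0`. -/
abbrev l2Pos : Submodule ℂ L2 := l2On (Set.Ici 0)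

/-- `ℓ²₋ = ℓ² ⊖ ℓ²₊`, spanned by `e_n`, `n < 0`. -/
abbrev l2Neg : Submodule ℂ L2 := l2On (Set.Iio 0)

theorem e_mem_l2On {s : Set ℤ} {n : ℤ} (hn : n ∈ s) : e n ∈ l2On s :=
  Submodule.le_topologicalClosure _ (Submodule.subset_span ⟨n, hn, rfl⟩)

/-- `e_0` as an element of `ℓ²₊`. -/
def ePos : l2Pos := ⟨e 0, e_mem_l2On (by simp)⟩

/-- `e_{-1}` as an element of `ℓ²₋`. -/
def eNeg : l2Neg := ⟨e (-1), e_mem_l2On (by simp)⟩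

theorem memlp_shift (f : L2) (k : ℤ) : Memℓp (fun n : ℤ => (f (n + k) : ℂ)) 2 := by
  have h := (memℓp_gen_iff (p := 2) (by norm_num)).1 (lp.memℓp f)
  exact memℓp_gen ((Equiv.addRight k).summable_iff.2 h)

/-- The shift operator, `S e_n = e_{n+1}`. -/
def S : L2 ≃ₗᵢ[ℂ] L2 where
  toFun f := ⟨fun n => f (n + (-1)), memlp_shift f (-1)⟩
  invFun f := ⟨fun n => f (n + 1), memlp_shift f 1⟩
  map_add' _ _ := rfl
  map_smul' _ _ := rfl
  left_inv f := by
    ext n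
    change f (n + 1 + (-1)) = f n
    simp
  right_inv f := by
    ext n
    change f (n + (-1) + 1) = f n
    simp
  norm_map' f := by
    rw [lp.norm_eq_tsum_rpow (by norm_num), lp.norm_eq_tsum_rpow (by norm_num)]
    congr 1
    exact (Equiv.addRight (-1 : ℤ)).tsum_eq (fun n => ‖f n‖ ^ (2 : ENNReal).toReal)

theorem S_e (n : ℤ) : S (e n) = e (n + 1) := by
  ext m
  change (e n) (m + (-1)) = (e (n + 1)) m
  by_cases h : m = n + 1
  · subst h
    simp [e]
  · have h' : m + (-1) ≠ n := fun hh => h (by omega)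
    simp [e, h, h']

/-- `S^{-k} T S^k`. -/
def shiftConj (k : ℕ) (T : L2 →L[ℂ] L2) : L2 →L[ℂ] L2 :=
  ((S ^ k)⁻¹ : L2 ≃ₗᵢ[ℂ] L2).toContinuousLinearEquiv.toContinuousLinearMap ∘L T ∘L
    (S ^ k : L2 ≃ₗᵢ[ℂ] L2).toContinuousLinearEquiv.toContinuousLinearMap

/-- A bounded two-sided Jacobi matrix:
`J e_n = a(n) e_{n-1} + b(n) e_n + a(n+1) e_{n+1}`, `a(n) > 0`. -/
structure JacobiMatrix where
  op : L2 →L[ℂ] L2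
  a : ℤ → ℝ
  b : ℤ → ℝ
  a_pos : ∀ n, 0 < a n
  op_e : ∀ n, op (e n) =
    (a n : ℂ) • e (n - 1) + (b n : ℂ) • e n + (a (n + 1) : ℂ) • e (n + 1)

section Blocks

variable {g : ℕ}

/-- `T⁻`: the part of a matrix strictly above the main diagonal. -/
def upperPart (T : Matrix (Fin (g + 1)) (Fin (g + 1)) ℝ) :
    Matrix (Fin (g + 1)) (Fin (g + 1)) ℝ :=
  Matrix.of fun i j => if i < j then T i j else 0

/-- `T⁺ = T - T⁻`: the lower triangular part, main diagonal included. -/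
def lowerPart (T : Matrix (Fin (g + 1)) (Fin (g + 1)) ℝ) :
    Matrix (Fin (g + 1)) (Fin (g + 1)) ℝ :=
  T - upperPart T

/-- The diagonal matrix with diagonal `c_1, …, c_g, 0`. -/
def tildeC (c : Fin g → ℝ) : Matrix (Fin (g + 1)) (Fin (g + 1)) ℝ :=
  Matrix.diagonal (Fin.snoc (α := fun _ => ℝ) c 0)

/-- `A(p) = δ_g p*`. -/
def blockA (p : Fin (g + 1) → ℝ) : Matrix (Fin (g + 1)) (Fin (g + 1)) ℝ :=
  Matrix.vecMulVec (Pi.single (Fin.last g) 1) p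

/-- `B(p, q) = (q p*)⁻ + (p q*)⁺ + C̃`. -/
def blockB (c : Fin g → ℝ) (p q : Fin (g + 1) → ℝ) :
    Matrix (Fin (g + 1)) (Fin (g + 1)) ℝ :=
  upperPart (Matrix.vecMulVec q p) + lowerPart (Matrix.vecMulVec p q) + tildeC c

/-- The block in block row `j` and block column `k` of the block Jacobi matrix whose `j`-th
block row is `A*(p_j), B(p_j, q_j), A(p_{j+1})`. -/
def block (c : Fin g → ℝ) (p q : ℤ → Fin (g + 1) → ℝ) (j k : ℤ) :
    Matrix (Fin (g + 1)) (Fin (g + 1)) ℝ :=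
  if k = j then blockB c (p j) (q j)
  else if k = j + 1 then blockA (p k)
  else if k = j - 1 then (blockA (p j)).transpose
  else 0

/-- `T` is of the class `𝔸` with ordered collection `c` and generating coefficient sequences
`p, q`; block `j` occupies the indices `j (g+1), …, j (g+1) + g`. -/
def IsClassA (c : Fin g → ℝ) (p q : ℤ → Fin (g + 1) → ℝ) (T : L2 →L[ℂ] L2) : Prop :=
  (∀ j, 0 < p j (Fin.last g)) ∧
  ∀ (j k : ℤ) (m l : Fin (g + 1)),
    entry T (j * ((g : ℤ) + 1) + ((m : ℕ) : ℤ)) (k * ((g : ℤ) + 1) + ((l : ℕ) : ℤ)) =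
      ((block c p q j k m l : ℝ) : ℂ)

/-- GMP matrices: `A` is of the class `𝔸` for `c`, every `c_k - A` is invertible, and
`S^{-k} (c_k - A)⁻¹ S^k` is again of the class `𝔸` (for some ordered collection of distinct
points). The index `k : Fin g` stands for the one-based index `k + 1`. -/
structure GMPMatrix (c : Fin g → ℝ) where
  op : L2 →L[ℂ] L2
  p : ℤ → Fin (g + 1) → ℝ
  q : ℤ → Fin (g + 1) → ℝ
  isClassA : IsClassA c p q op
  isUnit : ∀ k : Fin g, IsUnit (algebraMap ℂ (L2 →L[ℂ] L2) (c k : ℂ) - op)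
  inv_isClassA : ∀ k : Fin g, ∃ (c' : Fin g → ℝ) (p' q' : ℤ → Fin (g + 1) → ℝ),
    Function.Injective c' ∧
    IsClassA c' p' q'
      (shiftConj ((k : ℕ) + 1) (Ring.inverse (algebraMap ℂ (L2 →L[ℂ] L2) (c k : ℂ) - op)))

end Blocks

/-- The compression `P_K T |_K`, e.g. `J_±` and `A_±`. -/
def compress (K : Submodule ℂ L2) [K.HasOrthogonalProjection] (T : L2 →L[ℂ] L2) : K →L[ℂ] K :=
  K.orthogonalProjectionOnto ∘L T ∘L K.subtypeL

/-- `⟨(T_K - z)⁻¹ x, x⟩` for the compression `T_K` of `T` to `K` (the scalar product of the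
mathematics is linear in its first argument, Mathlib's in its second). -/
def weyl (K : Submodule ℂ L2) [K.HasOrthogonalProjection] (T : L2 →L[ℂ] L2) (x : K) (z : ℂ) : ℂ :=
  inner ℂ x (Ring.inverse (compress K T - algebraMap ℂ (K →L[ℂ] K) z) x)

/-- Orthonormalization of `x, T_K x, T_K² x, …`, where `T_K` is the compression of `T` to `K`. -/
def krylov (K : Submodule ℂ L2) [K.HasOrthogonalProjection] (T : L2 →L[ℂ] L2) (x : K) (n : ℕ) :
    L2 :=
  (InnerProductSpace.gramSchmidtNormed ℂ (fun i : ℕ => (compress K T ^ i) x) n : K)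

section Transform

variable {g : ℕ} {c : Fin g → ℝ}

/-- The Euclidean norm `‖p_0‖`. -/
def GMPMatrix.normP (A : GMPMatrix c) : ℝ := Real.sqrt (∑ m, A.p 0 m ^ 2)

/-- `ẽ_0 = ‖p_0‖⁻¹ P_+ A e_{-1}`. -/
def GMPMatrix.tildeZero (A : GMPMatrix c) : l2Pos :=
  ((A.normP⁻¹ : ℝ) : ℂ) • l2Pos.orthogonalProjectionOnto (A.op (e (-1)))

/-- The orthonormal system `ẽ_n`, `n ∈ ℤ`: for `n ≥ 0` the orthonormalization of
`ẽ_0, A_+ ẽ_0, A_+² ẽ_0, …`, and for `n = -1, -2, …` that of `e_{-1}, A_- e_{-1}, A_-² e_{-1}, …`.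
It is the system in which `A` becomes a Jacobi matrix with positive off-diagonal entries. -/
def GMPMatrix.tildeE (A : GMPMatrix c) : ℤ → L2
  | Int.ofNat n => krylov l2Pos A.op A.tildeZero n
  | Int.negSucc n => krylov l2Neg A.op eNeg n

/-- `J = ℱ A`: the one-sided resolvent functions `r_±` of `J` and of `A` coincide, and
`a(0) = ‖p_0‖`. -/
def IsTransform (A : GMPMatrix c) (J : JacobiMatrix) : Prop :=
  (∀ z : ℂ, z.im ≠ 0 →
    weyl l2Pos J.op ePos z = weyl l2Pos A.op A.tildeZero z ∧
    weyl l2Neg J.op eNeg z = weyl l2Neg A.op eNeg z) ∧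
  J.a 0 = A.normP

/-- The map `F`, `F e_n = ẽ_n`, is a unitary operator of `ℓ²` and `J = F* A F`. -/
def IsUnitaryConjugate (A : GMPMatrix c) (J : JacobiMatrix) : Prop :=
  ∃ F : L2 ≃ₗᵢ[ℂ] L2, (∀ n, F (e n) = A.tildeE n) ∧ ∀ x, J.op x = F.symm (A.op (F x))

/-- The identification `(p_m^{(j)}, q_m^{(j)}) ≃ (-p_m^{(j)}, -q_m^{(j)})`: for each position `m`
in the blocks, all the pairs `(p_m^{(j)}, q_m^{(j)})`, `j ∈ ℤ`, may be multiplied by `-1`.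
(As `p_g^{(j)} > 0`, this can occur only for `m < g`.) -/
def SignEquiv (A A' : GMPMatrix c) : Prop :=
  ∃ ε : Fin (g + 1) → ℝ, (∀ m, ε m = 1 ∨ ε m = -1) ∧
    ∀ j m, A'.p j m = ε m * A.p j m ∧ A'.q j m = ε m * A.q j m

end Transform

end GMP

end

/-! Let `o_n` be the sequence of period `g+1` that runs through `c_1, …, c_g, ∞` with `o_{-1} = ∞`,
and let `R_n(T)` be `(o_n - T)⁻¹`, or `T` itself when `o_n = ∞`. Let `H_n` be the closed span of the
`e_i`, `i < n`. The shape of a GMP matrix `A` and of its shifted resolvents gives `R_n(A) H_n ⊆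
H_{n+1}` and `H_{n+1} = H_n + R_n(A) H_n`; a Jacobi matrix satisfies the same with `J` in place of
every `R_n`. Thus `J` and `A` should be one operator written in bases adapted to two flags that
share the member `ℓ²₋` and the vector `e_{-1}`. This is `IsIntertwiner`: a unitary `U` with `U J = A
U` that fixes `e_{-1}` and preserves `ℓ²₋`. Such a `U` transports the resolvent functions and the
norm of `p_0`, and must be the Gram–Schmidt map `F`, so the theorem reduces to producing
intertwiners.

Existence. The second flag is `E_n = v_n⁻¹ H_n`, where `v_n` is a product of factors `o_k - J` (from
`J` to `A`) or of their inverses (from `A` to `J`), with factor `1` at infinity. Invertibility makes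
this meaningful for negative `n` too. Consecutive members differ by one dimension
(`exists_complement`), and the flag is exhausting and separated, so real unit vectors in the
successive complements form a basis, whose signs are free and can be normalized
(`exists_adapted_unitary`). In that basis `A` is tridiagonal (`exists_jacobi`). Conversely, partial
fractions (`res_sub_moebius`) show how `R_n(J)` acts on `E`, and `exists_isClassAt` reads the class
`𝔸` off this action (`exists_gmpMatrix`).

Uniqueness. The resolvent functions determine all moments, hence the two half-line Jacobi matrices
(`eq_of_weyl_eq`). If `A` and `A'` have the same transform, their intertwiner preserves both `ℓ²₋`
and the rule generating the flag from it. It is therefore diagonal, with coefficients of period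
`g+1` because the outermost entries are positive, and this is a sign change of the generating
coefficients (`signEquiv`). -/

namespace GMP

open scoped ComplexConjugate

/-! ### The standard basis and the coordinate flags -/

theorem e_apply (n i : ℤ) : e n i = if i = n then 1 else 0 := by
  by_cases h : i = n
  · subst h; simp [e]
  · simp [e, h]

theorem inner_e (i : ℤ) (x : L2) : inner ℂ (e i) x = x i := by
  rw [e, lp.inner_single_left]; simp

theorem inner_e_right (i : ℤ) (x : L2) : inner ℂ x (e i) = conj (x i) := by
  rw [← inner_conj_symm, inner_e]

theorem entry_eq (T : L2 →L[ℂ] L2) (i l : ℤ) : entry T i l = T (e l) i := inner_e _ _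

theorem orthonormal_e : Orthonormal ℂ e := by
  rw [orthonormal_iff_ite]
  intro i j
  rw [inner_e, e_apply]

theorem hasSum_e (x : L2) : HasSum (fun i => x i • e i) x := by
  convert lp.hasSum_single (p := 2) (by norm_num) x using 2 with i
  rw [e, ← lp.single_smul]; simp

theorem continuous_coord (i : ℤ) : Continuous fun x : L2 => x i := by
  simp_rw [← inner_e]; fun_prop

theorem mem_l2On {s : Set ℤ} {x : L2} : x ∈ l2On s ↔ ∀ i ∉ s, x i = 0 := by
  constructor
  · intro hx i hi
    refine closure_minimal (s := (Submodule.span ℂ (e '' s) : Set L2))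
      (t := {y : L2 | y i = 0}) ?_ (isClosed_eq (continuous_coord i) continuous_const) hx
    intro y hy
    induction hy using Submodule.span_induction with
    | mem y hy =>
      obtain ⟨n, hn, rfl⟩ := hy
      have : i ≠ n := fun h => hi (h ▸ hn)
      simp [e_apply, this]
    | zero => rfl
    | add y z _ _ hy hz => simp_all
    | smul a y _ hy => simp_all
  · intro hx
    refine (Submodule.isClosed_topologicalClosure _).mem_of_tendsto (hasSum_e x)
      (Filter.Eventually.of_forall fun t => Submodule.sum_mem _ fun i _ => ?_)
    by_cases hi : i ∈ s
    · exact Submodule.smul_mem _ _ (e_mem_l2On hi)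
    · simp [hx i hi]

/-- The closed span of the `e_i` with `i < n`. -/
noncomputable abbrev below (n : ℤ) : Submodule ℂ L2 := l2On (Set.Iio n)

/-- The closed span of the `e_i` with `n ≤ i`. -/
noncomputable abbrev above (n : ℤ) : Submodule ℂ L2 := l2On (Set.Ici n)

theorem mem_below {n : ℤ} {x : L2} : x ∈ below n ↔ ∀ i, n ≤ i → x i = 0 := by
  simp [mem_l2On]

theorem mem_above {n : ℤ} {x : L2} : x ∈ above n ↔ ∀ i < n, x i = 0 := by
  simp [mem_l2On]

theorem e_mem_below {i n : ℤ} (h : i < n) : e i ∈ below n := e_mem_l2On h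

theorem e_mem_above {i n : ℤ} (h : n ≤ i) : e i ∈ above n := e_mem_l2On h

theorem below_mono {m n : ℤ} (h : m ≤ n) : below m ≤ below n := fun _ hx =>
  mem_below.2 fun i hi => mem_below.1 hx i (h.trans hi)

theorem above_anti {m n : ℤ} (h : m ≤ n) : above n ≤ above m := fun _ hx =>
  mem_above.2 fun i hi => mem_above.1 hx i (hi.trans_le h)

theorem isClosed_below (n : ℤ) : IsClosed (below n : Set L2) :=
  Submodule.isClosed_topologicalClosure _

theorem sub_smul_e_apply (x : L2) (a : ℂ) (n i : ℤ) :
    (x - a • e n) i = x i - a * if i = n then 1 else 0 := by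
  rw [← e_apply]; rfl

theorem sub_mem_below {n : ℤ} {x : L2} (hx : x ∈ below (n + 1)) : x - x n • e n ∈ below n := by
  rw [mem_below] at *
  intro i hi
  rcases eq_or_lt_of_le hi with rfl | hi
  · rw [sub_smul_e_apply]; simp
  · rw [sub_smul_e_apply]; simp [hi.ne', hx i hi]

theorem sub_mem_above {n : ℤ} {x : L2} (hx : x ∈ above n) : x - x n • e n ∈ above (n + 1) := by
  rw [mem_above] at *
  intro i hi
  rcases eq_or_lt_of_le (Int.lt_add_one_iff.1 hi) with rfl | hi
  · rw [sub_smul_e_apply]; simp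
  · rw [sub_smul_e_apply]; simp [hi.ne, hx i hi]

theorem inner_eq_zero_of_below_above {n : ℤ} {x y : L2} (hx : x ∈ below n) (hy : y ∈ above n) :
    inner ℂ x y = 0 := by
  rw [lp.inner_eq_tsum]
  refine (tsum_congr fun i => ?_).trans tsum_zero
  rcases lt_or_ge i n with h | h
  · simp [mem_above.1 hy i h]
  · simp [mem_below.1 hx i h]

theorem mem_above_of_orthogonal {n : ℤ} {x : L2} (h : ∀ y ∈ below n, inner ℂ y x = 0) :
    x ∈ above n :=
  mem_above.2 fun i hi => by rw [← inner_e]; exact h _ (e_mem_below hi)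

theorem mem_below_of_orthogonal {n : ℤ} {x : L2} (h : ∀ y ∈ above n, inner ℂ y x = 0) :
    x ∈ below n :=
  mem_below.2 fun i hi => by rw [← inner_e]; exact h _ (e_mem_above hi)

theorem eq_smul_e {n : ℤ} {x : L2} (h : x ∈ below (n + 1)) (h' : x ∈ above n) :
    x = x n • e n := by
  ext i
  rcases lt_trichotomy i n with hi | rfl | hi
  · simp [e_apply, hi.ne, mem_above.1 h' i hi]
  · simp [e_apply]
  · simp [e_apply, hi.ne', mem_below.1 h i hi]

theorem clm_ext_e {T T' : L2 →L[ℂ] L2} (h : ∀ n, T (e n) = T' (e n)) : T = T' := by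
  ext1 x
  refine ((hasSum_e x).mapL T).unique ?_
  simpa [h] using (hasSum_e x).mapL T'

theorem clm_ext_entry {T T' : L2 →L[ℂ] L2} (h : ∀ i l, entry T i l = entry T' i l) : T = T' :=
  clm_ext_e fun n => by
    ext i
    rw [← entry_eq, ← entry_eq, h]

/-- A submodule that is closed and contains the `e_i`, `i < n`, contains `below n`. -/
theorem below_le {n : ℤ} {K : Submodule ℂ L2} (hK : IsClosed (K : Set L2))
    (h : ∀ i < n, e i ∈ K) : below n ≤ K :=
  Submodule.topologicalClosure_minimal _
    (Submodule.span_le.2 (by rintro _ ⟨i, hi, rfl⟩; exact h i hi)) hK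

/-! ### Complex conjugation and real symmetric operators -/

theorem star_e (n : ℤ) : star (e n) = e n := by
  ext i
  rw [lp.star_apply, e_apply]; split_ifs <;> simp

theorem inner_star_star (x y : L2) : inner ℂ (star x) (star y) = conj (inner ℂ x y) := by
  rw [lp.inner_eq_tsum, lp.inner_eq_tsum, Complex.conj_tsum]
  refine tsum_congr fun i => ?_
  simp

theorem star_mem_below {n : ℤ} {x : L2} (hx : x ∈ below n) : star x ∈ below n :=
  mem_below.2 fun i hi => by simp [mem_below.1 hx i hi]

/-- Symmetric operators with real matrix entries. -/
structure IsRealSymm (T : L2 →L[ℂ] L2) : Prop where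
  symm : ∀ x y, inner ℂ (T x) y = inner ℂ x (T y)
  map_star : ∀ x, T (star x) = star (T x)

theorem IsRealSymm.entry_symm {T : L2 →L[ℂ] L2} (h : IsRealSymm T) (i l : ℤ) :
    entry T i l = entry T l i := by
  have h1 : entry T i l = conj (entry T i l) := by
    rw [entry, ← inner_star_star, ← h.map_star, star_e, star_e]
  rw [h1, entry, inner_conj_symm, h.symm, entry]

theorem IsRealSymm.entry_real {T : L2 →L[ℂ] L2} (h : IsRealSymm T) (i l : ℤ) :
    ((entry T i l).re : ℂ) = entry T i l := by
  have h1 : conj (entry T i l) = entry T i l := by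
    rw [entry, ← inner_star_star, ← h.map_star, star_e, star_e]
  exact Complex.conj_eq_iff_re.1 h1

theorem isRealSymm_of_entry {T : L2 →L[ℂ] L2} (hs : ∀ i l, entry T i l = entry T l i)
    (hr : ∀ i l, conj (entry T i l) = entry T i l) : IsRealSymm T := by
  have hadj : ContinuousLinearMap.adjoint T = T := by
    refine clm_ext_entry fun i l => ?_
    rw [entry, ContinuousLinearMap.adjoint_inner_right, ← inner_conj_symm]
    change conj (entry T l i) = _
    rw [hr, hs]
  refine ⟨fun x y => ?_, fun x => ?_⟩
  · nth_rewrite 2 [← hadj]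
    rw [ContinuousLinearMap.adjoint_inner_right]
  · have h1 := ((hasSum_e (star x)).mapL T)
    have h2 := ((hasSum_e x).mapL T).star
    refine h1.unique ?_
    convert h2 using 2 with i
    have : star (T (e i)) = T (e i) := by
      ext l
      rw [lp.star_apply, ← entry_eq]; exact hr _ _
    simp only [map_smul, star_smul, lp.star_apply, this]

theorem isRealSymm_one : IsRealSymm 1 := ⟨fun _ _ => rfl, fun _ => rfl⟩

theorem algebraMap_sub_apply (z : ℂ) (T : L2 →L[ℂ] L2) (x : L2) :
    (algebraMap ℂ (L2 →L[ℂ] L2) z - T) x = z • x - T x := rfl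

theorem IsRealSymm.algebraMap_sub {T : L2 →L[ℂ] L2} (h : IsRealSymm T) (t : ℝ) :
    IsRealSymm (algebraMap ℂ (L2 →L[ℂ] L2) (t : ℂ) - T) := by
  refine ⟨fun x y => ?_, fun x => ?_⟩
  · simp only [algebraMap_sub_apply]
    rw [inner_sub_left, inner_sub_right, inner_smul_left, inner_smul_right, h.symm,
      Complex.conj_ofReal]
  · simp only [algebraMap_sub_apply]
    rw [h.map_star, star_sub, star_smul, Complex.star_def, Complex.conj_ofReal]

theorem inverse_apply_self {T : L2 →L[ℂ] L2} (hu : IsUnit T) (x : L2) :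
    Ring.inverse T (T x) = x := by
  rw [← mul_apply_eq_comp, Ring.inverse_mul_cancel _ hu]; rfl

theorem self_apply_inverse {T : L2 →L[ℂ] L2} (hu : IsUnit T) (x : L2) :
    T (Ring.inverse T x) = x := by
  rw [← mul_apply_eq_comp, Ring.mul_inverse_cancel _ hu]; rfl

theorem injective_of_isUnit {T : L2 →L[ℂ] L2} (hu : IsUnit T) : Function.Injective T :=
  Function.LeftInverse.injective (inverse_apply_self hu)

theorem IsRealSymm.inverse {T : L2 →L[ℂ] L2} (h : IsRealSymm T) (hu : IsUnit T) :
    IsRealSymm (Ring.inverse T) := by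
  refine ⟨fun x y => ?_, fun x => ?_⟩
  · nth_rewrite 1 [← self_apply_inverse hu y]
    rw [← h.symm, self_apply_inverse hu]
  · apply injective_of_isUnit hu
    rw [self_apply_inverse hu, h.map_star, self_apply_inverse hu]

end GMP

namespace GMP

open scoped ComplexConjugate

/-! ### Recursion over the integers -/

theorem exists_int_recursion {G : Type*} [Group G] (t : ℤ → G) :
    ∃ r : ℤ → G, r 0 = 1 ∧ ∀ j, r (j + 1) = t j * r j := by
  let p : ℕ → G := fun n => Nat.rec 1 (fun k x => t k * x) n
  let m : ℕ → G := fun n => Nat.rec 1 (fun k x => (t (Int.negSucc k))⁻¹ * x) n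
  refine ⟨fun z => match z with
    | Int.ofNat n => p n
    | Int.negSucc n => m (n + 1), rfl, fun j => ?_⟩
  match j with
  | Int.ofNat n => rfl
  | Int.negSucc 0 => exact (mul_inv_cancel_left _ _).symm
  | Int.negSucc (n + 1) => exact (mul_inv_cancel_left _ _).symm

/-- The condition links `n` only to `n + d`, so each residue class modulo `d` carries an independent
two-sided recursion in the group of signs, started at `1`. -/
theorem exists_signs (s : ℤ → ℝ) (hs : ∀ n, s n ≠ 0) {d : ℤ} (hd : 0 < d) :
    ∃ σ : ℤ → ℝ, (∀ n, σ n = 1 ∨ σ n = -1) ∧ σ (-1) = 1 ∧ ∀ n, 0 < σ n * σ (n + d) * s n := by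
  let t : ℤ → ℤˣ := fun n => if 0 < s n then 1 else -1
  choose r hr0 hr using fun m : ℤ => exists_int_recursion fun j => t (d * j + m - 1)
  -- The shift by one makes `-1` a starting point of its residue class, so its sign is `1`.
  let σ : ℤ → ℤˣ := fun n => r ((n + 1) % d) ((n + 1) / d)
  have hσ : ∀ n, σ (n + d) = t n * σ n := by
    intro n
    have h1 : (n + d + 1) % d = (n + 1) % d := by
      rw [add_right_comm]; exact Int.add_emod_right _ _
    have h2 : (n + d + 1) / d = (n + 1) / d + 1 := by
      rw [add_right_comm, Int.add_ediv_of_dvd_right dvd_rfl, Int.ediv_self hd.ne']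
    simp only [σ, h1, h2, hr, Int.mul_ediv_add_emod, add_sub_cancel_right]
  have hone : ∀ n, ((σ n : ℤ) : ℝ) = 1 ∨ ((σ n : ℤ) : ℝ) = -1 := fun n => by
    rcases Int.units_eq_one_or (σ n) with h | h <;> simp [h]
  refine ⟨fun n => ((σ n : ℤ) : ℝ), hone, by simp [σ, hr0], fun n => ?_⟩
  have hsq : ((σ n : ℤ) : ℝ) * ((σ n : ℤ) : ℝ) = 1 := by
    rcases hone n with h | h <;> simp [h]
  have : ((σ n : ℤ) : ℝ) * ((σ (n + d) : ℤ) : ℝ) * s n = ((t n : ℤ) : ℝ) * s n := by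
    rw [hσ]; push_cast
    linear_combination ((t n : ℤ) : ℝ) * s n * hsq
  rw [this]
  simp only [t]
  split_ifs with h
  · simpa using h
  · have := lt_of_le_of_ne (not_lt.1 h) (hs n)
    simpa using this

/-! ### Codimension of the image of a coordinate flag -/

theorem inner_above_below {n : ℤ} {u v : L2} (hu : u ∈ above n) (hv : v ∈ below (n + 1)) :
    inner ℂ u v = conj (u n) * v n := by
  have h1 : v = (v - v n • e n) + v n • e n := by simp
  have h2 : inner ℂ u (v - v n • e n) = 0 := by
    rw [← inner_conj_symm, inner_eq_zero_of_below_above (sub_mem_below hv) hu, map_zero]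
  rw [h1, inner_add_right, h2, zero_add, inner_smul_right, inner_e_right, ← h1, mul_comm]

/-- The orthogonal complement of `Y (below n)` in `below (n + 1)` consists of the `z` with `Y z ∈
above n`. Such a `z` is determined by the pair `(z_n, (Y z)_n)`, and symmetry of `Y` gives a
Wronskian identity between any two pairs, so the complement has dimension at most one. It is not
zero because `Y` is invertible. -/
theorem exists_complement {Y : L2 →L[ℂ] L2} {n : ℤ} (hu : IsUnit Y) (hY : IsRealSymm Y)
    (hN : ∀ x ∈ below n, Y x ∈ below (n + 1)) :
    ∃ z ∈ below (n + 1), (∀ x ∈ below n, Y x ≠ z) ∧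
      ∀ y ∈ below (n + 1), ∃ x ∈ below n, ∃ a : ℂ, y = Y x + a • z := by
  let M : Submodule ℂ L2 := (below n).comap (Ring.inverse Y).toLinearMap
  have hMc : IsClosed (M : Set L2) := (isClosed_below n).preimage (Ring.inverse Y).continuous
  have : CompleteSpace M := hMc.completeSpace_coe
  have hM : ∀ x, x ∈ M ↔ ∃ u ∈ below n, Y u = x := fun x =>
    ⟨fun h => ⟨_, h, self_apply_inverse hu x⟩, by
      rintro ⟨u, h, rfl⟩
      change Ring.inverse Y (Y u) ∈ below n
      rwa [inverse_apply_self hu]⟩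
  have hMle : M ≤ below (n + 1) := fun x hx => by
    obtain ⟨u, h, rfl⟩ := (hM x).1 hx; exact hN u h
  obtain ⟨y₀, hy₀, hy₀M⟩ : ∃ y ∈ below (n + 1), y ∉ M := by
    -- If the image were all of `below (n + 1)`, then `Y⁻¹ e_n` would lie in `below n` and, by
    -- symmetry, be orthogonal to it.
    by_contra! hcon
    have h1 : Ring.inverse Y (e n) ∈ below n := hcon _ (e_mem_below (by omega))
    have h2 : Ring.inverse Y (e n) ∈ above n := mem_above_of_orthogonal fun y hy => by
      obtain ⟨u, h, rfl⟩ := (hM y).1 (hcon y (below_mono (by omega) hy))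
      rw [hY.symm, self_apply_inverse hu, inner_e_right, mem_below.1 h n le_rfl, map_zero]
    have h3 : Ring.inverse Y (e n) = 0 := by
      rw [eq_smul_e (below_mono (by omega) h1) h2, mem_below.1 h1 n le_rfl, zero_smul]
    have h4 := self_apply_inverse hu (e n)
    rw [h3, map_zero] at h4
    simpa [e_apply] using congrArg (fun x : L2 => x n) h4
  have hO : ∀ y ∈ below (n + 1), y - M.starProjection y ∈ below (n + 1) ∧
      Y (y - M.starProjection y) ∈ above n := fun y hy =>
    ⟨sub_mem hy (hMle (Submodule.starProjection_apply_mem _ _)),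
      mem_above_of_orthogonal fun x hx => by
        rw [← hY.symm]
        exact (Submodule.mem_orthogonal _ _).1 (M.sub_starProjection_mem_orthogonal y) _
          ((hM _).2 ⟨x, hx, rfl⟩)⟩
  have hzero : ∀ z ∈ below (n + 1), Y z ∈ above n → z n = 0 → Y z n = 0 → z = 0 := by
    intro z h1 h2 h3 h4
    have h5 : z ∈ below n := by simpa [h3] using sub_mem_below h1
    have h6 := eq_smul_e (hN z h5) h2
    rw [h4, zero_smul] at h6
    exact injective_of_isUnit hu (by rw [h6, map_zero])
  -- The Wronskian identity: both sides of `⟨Y z, z'⟩ = ⟨z, Y z'⟩` reduce to the coordinate `n`, the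
  -- only one shared by `above n` and `below (n + 1)`.
  have hrel : ∀ z ∈ below (n + 1), ∀ z' ∈ below (n + 1), Y z ∈ above n → Y z' ∈ above n →
      conj (Y z n) * z' n = conj (z n) * Y z' n := by
    intro z h1 z' h2 h3 h4
    rw [← inner_above_below h3 h2, hY.symm, ← inner_conj_symm, inner_above_below h4 h1]
    simp [mul_comm]
  set z := y₀ - M.starProjection y₀ with hz
  obtain ⟨hz1, hz2⟩ := hO y₀ hy₀
  rw [← hz] at hz1 hz2
  have hzM : z ∉ M := fun h => hy₀M (by
    have := add_mem h (M.starProjection_apply_mem y₀)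
    rwa [hz, sub_add_cancel] at this)
  have hz0 : z ≠ 0 := fun h => hzM (h ▸ zero_mem M)
  refine ⟨z, hz1, fun x hx h => hzM ((hM z).2 ⟨x, hx, h⟩), fun y hy => ?_⟩
  obtain ⟨hy1, hy2⟩ := hO y hy
  set z' := y - M.starProjection y with hz'
  suffices h : ∃ a : ℂ, z' = a • z by
    obtain ⟨a, ha⟩ := h
    obtain ⟨u, hu1, hu2⟩ := (hM _).1 (M.starProjection_apply_mem y)
    exact ⟨u, hu1, a, by rw [hu2, ← ha, hz']; abel⟩
  -- The pairs lie on one line; the proportionality factor is read from whichever coordinate of the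
  -- pair of `z` is nonzero.
  by_cases h0 : z n = 0
  · have h1 : Y z n ≠ 0 := fun h => hz0 (hzero z hz1 hz2 h0 h)
    have h2 : z' n = 0 := by
      have := hrel z hz1 z' hy1 hz2 hy2
      rw [h0, map_zero, zero_mul] at this
      exact (mul_eq_zero.1 this).resolve_left (by simpa using h1)
    refine ⟨Y z' n / Y z n, sub_eq_zero.1 (hzero _ ?_ ?_ ?_ ?_)⟩
    · exact sub_mem hy1 (Submodule.smul_mem _ _ hz1)
    · rw [map_sub, map_smul]; exact sub_mem hy2 (Submodule.smul_mem _ _ hz2)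
    · change z' n - _ * z n = 0
      rw [h2, h0]; simp
    · rw [map_sub, map_smul]
      change Y z' n - _ * Y z n = 0
      field_simp; simp
  · have h1 : z' - (z' n / z n) • z ∈ below (n + 1) := sub_mem hy1 (Submodule.smul_mem _ _ hz1)
    have h2 : Y (z' - (z' n / z n) • z) ∈ above n := by
      rw [map_sub, map_smul]; exact sub_mem hy2 (Submodule.smul_mem _ _ hz2)
    have h3 : (z' - (z' n / z n) • z) n = 0 := by
      change z' n - _ * z n = 0
      field_simp; simp
    refine ⟨z' n / z n, sub_eq_zero.1 (hzero _ h1 h2 h3 ?_)⟩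
    have := hrel _ h1 z hz1 h2 hz2
    rw [h3, map_zero, zero_mul] at this
    simpa [h0] using this

/-! ### Bases adapted to a flag -/

/-- The preimages of the coordinate flag under the operators `v n`. -/
noncomputable def flag (v : ℤ → L2 →L[ℂ] L2) (n : ℤ) : Submodule ℂ L2 :=
  (below n).comap (v n).toLinearMap

theorem mem_flag {v : ℤ → L2 →L[ℂ] L2} {n : ℤ} {x : L2} : x ∈ flag v n ↔ v n x ∈ below n :=
  Iff.rfl

/-- `v` is a product of invertible real symmetric factors `Y n`, each of which raises the
coordinate flag by at most one step. -/
structure IsFlagProduct (Y v : ℤ → L2 →L[ℂ] L2) : Prop where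
  zero : v 0 = 1
  succ : ∀ n, v (n + 1) = Y n * v n
  isUnit : ∀ n, IsUnit (v n)
  map_star : ∀ n x, v n (star x) = star (v n x)
  factor_isUnit : ∀ n, IsUnit (Y n)
  factor_symm : ∀ n, IsRealSymm (Y n)
  factor_below : ∀ n, ∀ x ∈ below n, Y n x ∈ below (n + 1)
  factor_neg_one : Y (-1) = 1

/-- `f` is a real unit vector spanning the orthogonal complement of `flag v n` in
`flag v (n + 1)`. -/
structure IsStep (v : ℤ → L2 →L[ℂ] L2) (n : ℤ) (f : L2) : Prop where
  mem : f ∈ flag v (n + 1)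
  orth : ∀ x ∈ flag v n, inner ℂ x f = 0
  norm : ‖f‖ = 1
  star_eq : star f = f
  span : ∀ x ∈ flag v (n + 1), ∃ a : ℂ, x - a • f ∈ flag v n

theorem isClosed_flag (v : ℤ → L2 →L[ℂ] L2) (n : ℤ) : IsClosed (flag v n : Set L2) :=
  (isClosed_below n).preimage (v n).continuous

namespace IsFlagProduct

variable {Y v : ℤ → L2 →L[ℂ] L2}

theorem le_succ (h : IsFlagProduct Y v) (n : ℤ) : flag v n ≤ flag v (n + 1) := fun x hx => by
  rw [mem_flag, h.succ]
  exact h.factor_below n _ hx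

theorem mono (h : IsFlagProduct Y v) : Monotone (flag v) :=
  monotone_int_of_le_succ h.le_succ

theorem star_mem (h : IsFlagProduct Y v) {n : ℤ} {x : L2} (hx : x ∈ flag v n) :
    star x ∈ flag v n := by
  rw [mem_flag, h.map_star]; exact star_mem_below hx

theorem flag_zero (h : IsFlagProduct Y v) : flag v 0 = below 0 := by
  ext x; rw [mem_flag, h.zero]; rfl

theorem neg_one (h : IsFlagProduct Y v) : v (-1) = 1 := by
  have := h.succ (-1)
  rw [h.factor_neg_one, one_mul] at this
  rw [← this]; exact h.zero

theorem isStep_neg_one (h : IsFlagProduct Y v) : IsStep v (-1) (e (-1)) where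
  mem := by
    change e (-1) ∈ flag v 0
    rw [h.flag_zero]; exact e_mem_below (by norm_num)
  orth x hx := by
    rw [mem_flag, h.neg_one] at hx
    exact inner_eq_zero_of_below_above hx (e_mem_above le_rfl)
  norm := orthonormal_e.1 _
  star_eq := star_e _
  span x hx := by
    change x ∈ flag v 0 at hx
    rw [h.flag_zero] at hx
    refine ⟨x (-1), ?_⟩
    rw [mem_flag, h.neg_one]
    exact sub_mem_below hx

/-- The vector of `exists_complement` is pulled back by `v (n + 1)` and its projection to `flag v n`
removed. The flag is stable under conjugation, so the resulting line contains a real vector: twice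
the real part or, if that vanishes, `i` times the vector. -/
theorem exists_isStep (h : IsFlagProduct Y v) (n : ℤ) : ∃ f, IsStep v n f := by
  have : CompleteSpace (flag v n) := (isClosed_flag v n).completeSpace_coe
  obtain ⟨z, hz1, hz2, hz3⟩ := exists_complement (h.factor_isUnit n) (h.factor_symm n)
    (h.factor_below n)
  have hv := h.isUnit (n + 1)
  set z₀ := Ring.inverse (v (n + 1)) z with hz₀
  have hz₀1 : v (n + 1) z₀ = z := self_apply_inverse hv z
  have hz₀2 : z₀ ∈ flag v (n + 1) := by rw [mem_flag, hz₀1]; exact hz1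
  have hz₀3 : z₀ ∉ flag v n := fun hm => hz2 _ hm (by
    rw [← hz₀1, h.succ]; rfl)
  have hspan : ∀ x ∈ flag v (n + 1), ∃ a : ℂ, x - a • z₀ ∈ flag v n := by
    intro x hx
    obtain ⟨u, hu, a, ha⟩ := hz3 _ hx
    refine ⟨a, ?_⟩
    have : v n (x - a • z₀) = u := by
      apply injective_of_isUnit (h.factor_isUnit n)
      have h1 : Y n (v n (x - a • z₀)) = v (n + 1) (x - a • z₀) := by rw [h.succ]; rfl
      change v (n + 1) x = _ at ha
      rw [h1, map_sub, map_smul, hz₀1, ha, add_sub_cancel_right]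
    rw [mem_flag, this]; exact hu
  set p := (flag v n).starProjection z₀
  have hp : p ∈ flag v n := Submodule.starProjection_apply_mem _ _
  have horth : ∀ x ∈ flag v n, inner ℂ x (z₀ - p) = 0 :=
    (Submodule.mem_orthogonal _ _).1 (Submodule.sub_starProjection_mem_orthogonal z₀)
  have hne : z₀ - p ≠ 0 := fun h0 => hz₀3 (by rw [sub_eq_zero.1 h0]; exact hp)
  have hmem : z₀ - p ∈ flag v (n + 1) := sub_mem hz₀2 (h.le_succ n hp)
  have hspan' : ∀ x ∈ flag v (n + 1), ∃ a : ℂ, x - a • (z₀ - p) ∈ flag v n := by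
    intro x hx
    obtain ⟨a, ha⟩ := hspan x hx
    refine ⟨a, ?_⟩
    have : x - a • (z₀ - p) = (x - a • z₀) + a • p := by rw [smul_sub]; abel
    rw [this]; exact add_mem ha (Submodule.smul_mem _ _ hp)
  -- a real vector in the orthogonal complement
  obtain ⟨r, hr0, hr1, hr2, hr3⟩ : ∃ r : L2, r ≠ 0 ∧ star r = r ∧ r ∈ flag v (n + 1) ∧
      ∀ x ∈ flag v n, inner ℂ x r = 0 := by
    have hs : ∀ x ∈ flag v n, inner ℂ x (star (z₀ - p)) = 0 := fun x hx => by
      have := horth _ (h.star_mem hx)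
      rw [← star_star x, inner_star_star, this, map_zero]
    by_cases h0 : (z₀ - p) + star (z₀ - p) = 0
    · refine ⟨Complex.I • (z₀ - p), smul_ne_zero Complex.I_ne_zero hne, ?_,
        Submodule.smul_mem _ _ hmem, fun x hx => by rw [inner_smul_right, horth x hx, mul_zero]⟩
      rw [star_smul, eq_neg_of_add_eq_zero_right h0]
      simp [← smul_neg]
    · refine ⟨_, h0, by rw [star_add, star_star, add_comm], add_mem hmem (h.star_mem hmem),
        fun x hx => by rw [inner_add_right, horth x hx, hs x hx, add_zero]⟩
  have hrn : ‖r‖ ≠ 0 := norm_ne_zero_iff.2 hr0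
  have hrc : ((‖r‖ : ℝ) : ℂ) ≠ 0 := by exact_mod_cast hrn
  refine ⟨((‖r‖⁻¹ : ℝ) : ℂ) • r, Submodule.smul_mem _ _ hr2,
    fun x hx => by rw [inner_smul_right, hr3 x hx, mul_zero], ?_, ?_, fun x hx => ?_⟩
  · rw [norm_smul]; simp [hrn]
  · rw [star_smul, hr1]; simp
  · obtain ⟨a, ha⟩ := hspan' x hx
    obtain ⟨b, hb⟩ := hspan' r hr2
    -- The difference lies in `flag v n` and is orthogonal to it.
    have hb' : r = b • (z₀ - p) := by
      refine sub_eq_zero.1 ?_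
      have h1 := hr3 _ hb
      have h2 := horth _ hb
      have h3 : inner ℂ (r - b • (z₀ - p)) (r - b • (z₀ - p)) = 0 := by
        rw [inner_sub_right, inner_smul_right, h1, h2, mul_zero, sub_zero]
      exact inner_self_eq_zero.1 h3
    have hb0 : b ≠ 0 := fun h0 => hr0 (by rw [hb', h0, zero_smul])
    refine ⟨a / b * ‖r‖, ?_⟩
    have : (a / b * (‖r‖ : ℂ)) • ((‖r‖⁻¹ : ℝ) : ℂ) • r = a • (z₀ - p) := by
      rw [smul_smul, hb', smul_smul]
      congr 1
      rw [← hb']; push_cast; field_simp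
    rw [this]; exact ha

end IsFlagProduct

end GMP

/-! ### Unitary operators attached to a flag -/

namespace GMP

open scoped ComplexConjugate

theorem IsStep.smul_sign {v : ℤ → L2 →L[ℂ] L2} {n : ℤ} {f : L2} (h : IsStep v n f) {σ : ℝ}
    (hσ : σ = 1 ∨ σ = -1) : IsStep v n ((σ : ℂ) • f) where
  mem := Submodule.smul_mem _ _ h.mem
  orth x hx := by rw [inner_smul_right, h.orth x hx, mul_zero]
  norm := by rw [norm_smul, h.norm]; rcases hσ with rfl | rfl <;> simp
  star_eq := by rw [star_smul, h.star_eq]; simp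
  span x hx := by
    obtain ⟨a, ha⟩ := h.span x hx
    refine ⟨a * σ, ?_⟩
    rw [smul_smul, mul_assoc]
    rcases hσ with rfl | rfl <;> simpa using ha

namespace IsFlagProduct

variable {Y v : ℤ → L2 →L[ℂ] L2}

theorem orthonormal (h : IsFlagProduct Y v) {f : ℤ → L2} (hf : ∀ n, IsStep v n (f n)) :
    Orthonormal ℂ f := by
  have hlt : ∀ i j, i < j → inner ℂ (f i) (f j) = 0 := fun i j hij =>
    (hf j).orth _ (h.mono (show i + 1 ≤ j by omega) (hf i).mem)
  refine ⟨fun n => (hf n).norm, fun i j hij => ?_⟩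
  rcases lt_or_gt_of_ne hij with h1 | h1
  · exact hlt i j h1
  · rw [← inner_conj_symm, hlt j i h1, map_zero]

/-- Orthogonality to `f n` makes the projections of `x` to `flag v n` and `flag v (n + 1)` equal.
The common projection lies in every member of the flag, hence is zero by separation; then `x` is
orthogonal to every member, hence zero by exhaustion. -/
theorem eq_zero_of_orthogonal (h : IsFlagProduct Y v)
    (hd : ∀ x, (∀ n, ∀ y ∈ flag v n, inner ℂ y x = 0) → x = 0)
    (hi : ∀ x, (∀ n, x ∈ flag v n) → x = 0) {f : ℤ → L2} (hf : ∀ n, IsStep v n (f n))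
    {x : L2} (hx : ∀ n, inner ℂ (f n) x = 0) : x = 0 := by
  have hc : ∀ n, CompleteSpace (flag v n) := fun n => (isClosed_flag v n).completeSpace_coe
  have hstep : ∀ n, (flag v (n + 1)).starProjection x = (flag v n).starProjection x := by
    intro n
    set p := (flag v (n + 1)).starProjection x
    have hp : p ∈ flag v (n + 1) := Submodule.starProjection_apply_mem _ _
    have ho : ∀ y ∈ flag v (n + 1), inner ℂ y (x - p) = 0 :=
      (Submodule.mem_orthogonal _ _).1 (Submodule.sub_starProjection_mem_orthogonal x)
    obtain ⟨a, ha⟩ := (hf n).span p hp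
    have ha0 : a = 0 := by
      have h1 : inner ℂ (f n) p = 0 := by
        have := ho _ (hf n).mem
        rwa [inner_sub_right, hx, zero_sub, neg_eq_zero] at this
      have h2 : inner ℂ (f n) (p - a • f n) = 0 := by
        rw [← inner_conj_symm, (hf n).orth _ ha, map_zero]
      rw [inner_sub_right, h1, inner_smul_right, inner_self_eq_norm_sq_to_K, (hf n).norm] at h2
      simpa using h2
    rw [ha0, zero_smul, sub_zero] at ha
    exact (Submodule.eq_starProjection_of_mem_orthogonal ha
      ((Submodule.mem_orthogonal _ _).2 fun y hy => ho y (h.le_succ n hy))).symm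
  have hconst : ∀ n, (flag v n).starProjection x = (flag v 0).starProjection x := by
    intro n
    induction n using Int.induction_on with
    | zero => rfl
    | succ i hi => rw [hstep, hi]
    | pred i hi => rw [← hi, ← hstep]; congr 2; ring_nf
  have h0 : (flag v 0).starProjection x = 0 := hi _ fun n => by
    rw [← hconst n]; exact Submodule.starProjection_apply_mem _ _
  refine hd x fun n y hy => ?_
  have := (Submodule.mem_orthogonal _ _).1
    ((flag v n).sub_starProjection_mem_orthogonal x) y hy
  rwa [hconst, h0, sub_zero] at this

theorem exists_unitary (h : IsFlagProduct Y v)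
    (hd : ∀ x, (∀ n, ∀ y ∈ flag v n, inner ℂ y x = 0) → x = 0)
    (hi : ∀ x, (∀ n, x ∈ flag v n) → x = 0) {f : ℤ → L2} (hf : ∀ n, IsStep v n (f n)) :
    ∃ U : L2 ≃ₗᵢ[ℂ] L2, (∀ n, U (e n) = f n) ∧ (∀ n x, U x ∈ flag v n ↔ x ∈ below n) ∧
      ∀ x, U (star x) = star (U x) := by
  have hbot : (Submodule.span ℂ (Set.range f))ᗮ = ⊥ := by
    rw [Submodule.eq_bot_iff]
    intro x hx
    exact h.eq_zero_of_orthogonal hd hi hf fun n =>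
      (Submodule.mem_orthogonal _ _).1 hx _ (Submodule.subset_span ⟨n, rfl⟩)
  let b := HilbertBasis.mkOfOrthogonalEqBot (h.orthonormal hf) hbot
  have hb : ∀ n, b.repr.symm (e n) = f n := fun n => by
    have h1 := b.repr_symm_single n
    have h2 : b n = f n := by
      rw [HilbertBasis.coe_mkOfOrthogonalEqBot]
    rw [← h2, ← h1]; congr 1
  refine ⟨b.repr.symm, hb, fun n x => ⟨fun hx => ?_, fun hx => ?_⟩, fun x => ?_⟩
  · refine mem_below.2 fun i hi => ?_
    rw [← inner_e, ← b.repr.symm.inner_map_map, hb, ← inner_conj_symm,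
      (hf i).orth _ (h.mono hi hx), map_zero]
  · have : below n ≤ (flag v n).comap b.repr.symm.toLinearEquiv.toLinearMap :=
      below_le ((isClosed_flag v n).preimage b.repr.symm.continuous) fun i hi => by
        change b.repr.symm (e i) ∈ flag v n
        rw [hb]; exact h.mono (show i + 1 ≤ n by omega) (hf i).mem
    exact this hx
  · have h1 := (hasSum_e (star x)).mapL b.repr.symm.toContinuousLinearEquiv.toContinuousLinearMap
    have h2 := ((hasSum_e x).mapL
      b.repr.symm.toContinuousLinearEquiv.toContinuousLinearMap).star
    refine h1.unique ?_
    have h3 : ∀ i, b.repr.symm (star x i • e i) = star (b.repr.symm (x i • e i)) := fun i => by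
      rw [map_smul, map_smul, star_smul, hb, (hf i).star_eq, lp.star_apply]
    exact (funext h3 : (fun i => b.repr.symm (star x i • e i)) = _) ▸ h2

/-- A flag product whose flag is exhausting and separated is the image of the coordinate flag
under a real unitary operator, and the signs of the basis vectors can be adapted to given
operators that raise the flag by exactly `d` steps. -/
theorem exists_adapted_unitary (h : IsFlagProduct Y v)
    (hd : ∀ x, (∀ n, ∀ y ∈ flag v n, inner ℂ y x = 0) → x = 0)
    (hi : ∀ x, (∀ n, x ∈ flag v n) → x = 0) {X : ℤ → L2 →L[ℂ] L2} {d : ℤ} (hd0 : 0 < d)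
    (hX : ∀ n, IsRealSymm (X n)) (hX₁ : ∀ n, ∀ x ∈ flag v n, X n x ∈ flag v (n + d))
    (hX₂ : ∀ n, ∀ x ∈ flag v (n + 1), X n x ∈ flag v (n + d + 1))
    (hX₃ : ∀ n, ∃ x ∈ flag v (n + 1), X n x ∉ flag v (n + d)) :
    ∃ U : L2 ≃ₗᵢ[ℂ] L2, U (e (-1)) = e (-1) ∧ (∀ n x, U x ∈ flag v n ↔ x ∈ below n) ∧
      (∀ x, U (star x) = star (U x)) ∧
      ∀ n, 0 < (inner ℂ (U (e (n + d))) (X n (U (e n)))).re := by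
  have hex : ∀ n, ∃ f, IsStep v n f ∧ (n = -1 → f = e (-1)) := fun n => by
    by_cases hn : n = -1
    · subst hn; exact ⟨_, h.isStep_neg_one, fun _ => rfl⟩
    · obtain ⟨f, hf⟩ := h.exists_isStep n
      exact ⟨f, hf, fun h => absurd h hn⟩
  choose f hf hf1 using hex
  have hreal : ∀ n, ((inner ℂ (f (n + d)) (X n (f n))).re : ℂ) =
      inner ℂ (f (n + d)) (X n (f n)) := fun n => by
    rw [← Complex.conj_eq_iff_re, ← inner_star_star, ← (hX n).map_star, (hf _).star_eq, (hf _).star_eq]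
  -- Otherwise `X n (f n)` would already lie in `flag v (n + d)`, and with it the image of all of
  -- `flag v (n + 1)`, against `hX₃`.
  have hne : ∀ n, (inner ℂ (f (n + d)) (X n (f n))).re ≠ 0 := by
    intro n h0
    have h1 : inner ℂ (f (n + d)) (X n (f n)) = 0 := by rw [← hreal, h0]; simp
    have h2 : X n (f n) ∈ flag v (n + d) := by
      obtain ⟨a, ha⟩ := (hf (n + d)).span _ (hX₂ n _ (hf n).mem)
      have h3 : inner ℂ (f (n + d)) (X n (f n) - a • f (n + d)) = 0 := by
        rw [← inner_conj_symm, (hf _).orth _ ha, map_zero]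
      rw [inner_sub_right, h1, inner_smul_right, inner_self_eq_norm_sq_to_K, (hf _).norm] at h3
      have h4 : a = 0 := by simpa using h3
      simpa [h4] using ha
    obtain ⟨x, hx1, hx2⟩ := hX₃ n
    obtain ⟨a, ha⟩ := (hf n).span x hx1
    apply hx2
    have h3 : X n x = X n (x - a • f n) + a • X n (f n) := by rw [map_sub, map_smul]; abel
    rw [h3]
    exact add_mem (hX₁ n _ ha) (Submodule.smul_mem _ _ h2)
  obtain ⟨σ, hσ, hσ1, hσ2⟩ := exists_signs _ hne hd0
  obtain ⟨U, hU1, hU2, hU3⟩ := h.exists_unitary hd hi fun n => (hf n).smul_sign (hσ n)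
  refine ⟨U, by rw [hU1, hσ1, hf1 _ rfl]; simp, hU2, hU3, fun n => ?_⟩
  rw [hU1, hU1, map_smul, inner_smul_left, inner_smul_right, Complex.conj_ofReal, ← hreal]
  have := hσ2 n
  rw [← Complex.ofReal_mul, ← Complex.ofReal_mul, Complex.ofReal_re]
  linarith [mul_comm (σ n) (σ (n + d)), mul_assoc (σ (n + d)) (σ n)
    (inner ℂ (f (n + d)) (X n (f n))).re]

end IsFlagProduct

end GMP

namespace GMP

open scoped ComplexConjugate

variable {g : ℕ}

/-! ### The class `𝔸` relative to a shifted block decomposition -/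

theorem S_pow_e (k : ℕ) (n : ℤ) : (S ^ k) (e n) = e (k + n) := by
  induction k with
  | zero => simp
  | succ k ih =>
    rw [pow_succ']
    change S ((S ^ k) (e n)) = _
    rw [ih, S_e]; congr 1; push_cast; ring

theorem entry_shiftConj (k : ℕ) (T : L2 →L[ℂ] L2) (i l : ℤ) :
    entry (shiftConj k T) i l = entry T (k + i) (k + l) := by
  have : shiftConj k T (e l) = (S ^ k).symm (T ((S ^ k) (e l))) := rfl
  rw [entry, this, S_pow_e, entry, ← S_pow_e k i, LinearIsometryEquiv.inner_map_eq_flip]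

/-- The class `𝔸` for a block decomposition that starts at the index `k` instead of `0`. -/
def IsClassAt (k : ℤ) (c : Fin g → ℝ) (p q : ℤ → Fin (g + 1) → ℝ) (T : L2 →L[ℂ] L2) : Prop :=
  (∀ j, 0 < p j (Fin.last g)) ∧
  ∀ (j l : ℤ) (m n : Fin (g + 1)),
    entry T (k + (j * ((g : ℤ) + 1) + ((m : ℕ) : ℤ))) (k + (l * ((g : ℤ) + 1) + ((n : ℕ) : ℤ))) =
      ((block c p q j l m n : ℝ) : ℂ)

theorem isClassA_iff {c : Fin g → ℝ} {p q : ℤ → Fin (g + 1) → ℝ} {T : L2 →L[ℂ] L2} :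
    IsClassA c p q T ↔ IsClassAt 0 c p q T := by
  simp only [IsClassA, IsClassAt, zero_add]

theorem isClassA_shiftConj_iff {c : Fin g → ℝ} {p q : ℤ → Fin (g + 1) → ℝ} {T : L2 →L[ℂ] L2}
    {k : ℕ} : IsClassA c p q (shiftConj k T) ↔ IsClassAt k c p q T := by
  simp only [IsClassA, IsClassAt, entry_shiftConj]

theorem exists_block_index (k n : ℤ) :
    ∃ (j : ℤ) (m : Fin (g + 1)), n = k + (j * ((g : ℤ) + 1) + ((m : ℕ) : ℤ)) := by
  have hpos : (0 : ℤ) < (g : ℤ) + 1 := by positivity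
  have h0 := Int.emod_nonneg (n - k) hpos.ne'
  have h1 := Int.emod_lt_of_pos (n - k) hpos
  refine ⟨(n - k) / ((g : ℤ) + 1), ⟨((n - k) % ((g : ℤ) + 1)).toNat, by omega⟩, ?_⟩
  simp only [Int.toNat_of_nonneg h0]
  have := Int.mul_ediv_add_emod (n - k) ((g : ℤ) + 1)
  linarith [mul_comm ((g : ℤ) + 1) ((n - k) / ((g : ℤ) + 1))]

theorem blockA_apply (p : Fin (g + 1) → ℝ) (m n : Fin (g + 1)) :
    blockA p m n = if m = Fin.last g then p n else 0 := by
  rw [blockA, Matrix.vecMulVec_apply, Pi.single_apply]; split_ifs <;> simp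

theorem blockB_apply (c : Fin g → ℝ) (p q : Fin (g + 1) → ℝ) (m n : Fin (g + 1)) :
    blockB c p q m n = (if m < n then q m * p n else p m * q n) +
      if m = n then Fin.snoc (α := fun _ => ℝ) c 0 m else 0 := by
  simp only [blockB, lowerPart, upperPart, tildeC, Matrix.add_apply, Matrix.sub_apply,
    Matrix.of_apply, Matrix.vecMulVec_apply, Matrix.diagonal_apply]
  split_ifs <;> simp

theorem block_self (c : Fin g → ℝ) (p q : ℤ → Fin (g + 1) → ℝ) (j : ℤ) (m n : Fin (g + 1)) :
    block c p q j j m n = blockB c (p j) (q j) m n := by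
  simp [block]

theorem block_succ_left (c : Fin g → ℝ) (p q : ℤ → Fin (g + 1) → ℝ) (j : ℤ)
    (m n : Fin (g + 1)) : block c p q (j + 1) j m n = blockA (p (j + 1)) n m := by
  simp [block, show j ≠ j + 1 + 1 by omega]

theorem block_succ_right (c : Fin g → ℝ) (p q : ℤ → Fin (g + 1) → ℝ) (j : ℤ)
    (m n : Fin (g + 1)) : block c p q j (j + 1) m n = blockA (p (j + 1)) m n := by
  simp [block]

theorem block_of_far (c : Fin g → ℝ) (p q : ℤ → Fin (g + 1) → ℝ) {j l : ℤ}
    (h : j + 2 ≤ l ∨ l + 2 ≤ j) (m n : Fin (g + 1)) : block c p q j l m n = 0 := by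
  simp [block, show l ≠ j by omega, show l ≠ j + 1 by omega, show l ≠ j - 1 by omega]

theorem block_symm (c : Fin g → ℝ) (p q : ℤ → Fin (g + 1) → ℝ) (j l : ℤ)
    (m n : Fin (g + 1)) : block c p q j l m n = block c p q l j n m := by
  obtain h | h | h | h | h : l = j ∨ l = j + 1 ∨ j = l + 1 ∨ j + 2 ≤ l ∨ l + 2 ≤ j := by omega
  · subst h
    rw [block_self, block_self, blockB_apply, blockB_apply]
    rcases lt_trichotomy m n with h | rfl | h
    · simp [h, h.ne, h.ne', h.not_gt, mul_comm]
    · rfl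
    · simp [h, h.ne, h.ne', h.not_gt, mul_comm]
  · subst h; rw [block_succ_right, block_succ_left]
  · subst h; rw [block_succ_right, block_succ_left]
  · rw [block_of_far _ _ _ (.inl h), block_of_far _ _ _ (.inr h)]
  · rw [block_of_far _ _ _ (.inr h), block_of_far _ _ _ (.inl h)]

namespace IsClassAt

variable {k : ℤ} {c : Fin g → ℝ} {p q : ℤ → Fin (g + 1) → ℝ} {T : L2 →L[ℂ] L2}

theorem isRealSymm (h : IsClassAt k c p q T) : IsRealSymm T := by
  refine isRealSymm_of_entry (fun i l => ?_) fun i l => ?_ <;>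
  · obtain ⟨j, m, rfl⟩ := exists_block_index (g := g) k i
    obtain ⟨j', m', rfl⟩ := exists_block_index (g := g) k l
    simp only [h.2, Complex.conj_ofReal]
    try rw [block_symm]

/-- The only entries that cross the boundary between two blocks are in one column. -/
theorem entry_eq_zero (h : IsClassAt k c p q T) (j : ℤ) {i l : ℤ}
    (hl : l < k + j * ((g : ℤ) + 1) - 1) (hi : k + j * ((g : ℤ) + 1) ≤ i) : entry T i l = 0 := by
  obtain ⟨ji, m, rfl⟩ := exists_block_index (g := g) k i
  obtain ⟨jl, n, rfl⟩ := exists_block_index (g := g) k l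
  have hm := m.2
  have hn := n.2
  have h1 : j ≤ ji := by
    by_contra! hc
    nlinarith
  have h2 : jl < j := by
    by_contra! hc
    nlinarith
  rw [h.2]
  obtain h3 | h3 : jl + 2 ≤ ji ∨ ji = jl + 1 := by omega
  · rw [block_of_far _ _ _ (.inr h3), Complex.ofReal_zero]
  · subst h3
    have h4 : j = jl + 1 := by omega
    have h5 : n ≠ Fin.last g := by
      rintro rfl
      subst h4
      simp only [Fin.val_last] at hl
      linarith
    rw [block_succ_left, blockA_apply, if_neg h5, Complex.ofReal_zero]

theorem entry_column (h : IsClassAt k c p q T) (j : ℤ) (m : Fin (g + 1)) :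
    entry T (k + (j * ((g : ℤ) + 1) + ((m : ℕ) : ℤ))) (k + j * ((g : ℤ) + 1) - 1) = p j m := by
  have h1 := h.2 j (j - 1) m (Fin.last g)
  have h2 := block_succ_left c p q (j - 1) m (Fin.last g)
  rw [sub_add_cancel] at h2
  rw [h2, blockA_apply, if_pos rfl] at h1
  rw [← h1, Fin.val_last]
  congr 1; ring

theorem entry_column_eq_zero (h : IsClassAt k c p q T) (j : ℤ) {i : ℤ}
    (hi : k + (j + 1) * ((g : ℤ) + 1) ≤ i) : entry T i (k + j * ((g : ℤ) + 1) - 1) = 0 := by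
  rcases eq_or_ne g 0 with rfl | hg
  · obtain ⟨ji, m, rfl⟩ := exists_block_index (g := 0) k i
    have h1 : k + j * (((0 : ℕ) : ℤ) + 1) - 1 = k + ((j - 1) * (((0 : ℕ) : ℤ) + 1)
      + (((0 : Fin 1) : ℕ) : ℤ)) := by simp; ring
    rw [h1, h.2, block_of_far, Complex.ofReal_zero]
    right
    have := m.2
    push_cast at hi
    omega
  · refine h.entry_eq_zero (j + 1) ?_ hi
    have : 0 < g := Nat.pos_of_ne_zero hg
    nlinarith

end IsClassAt

/-- Membership in the class `𝔸` from the action on the coordinate flag. -/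
theorem exists_isClassAt {T : L2 →L[ℂ] L2} (hT : IsRealSymm T) (k : ℤ) (c : Fin g → ℝ)
    (h₁ : ∀ j : ℤ, ∀ x ∈ below (k + j * ((g : ℤ) + 1) - 1), T x ∈ below (k + j * ((g : ℤ) + 1)))
    (h₂ : ∀ (j : ℤ) (m : Fin g),
      ∀ x ∈ below (k + j * ((g : ℤ) + 1) + ((m : ℕ) : ℤ) + 1),
        ∃ y ∈ below (k + j * ((g : ℤ) + 1) + ((m : ℕ) : ℤ)),
        ∃ y' ∈ below (k + j * ((g : ℤ) + 1) + ((m : ℕ) : ℤ)), T x - (c m : ℂ) • x = y + T y')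
    (h₃ : ∀ j : ℤ, 0 < (entry T (k + j * ((g : ℤ) + 1) + g) (k + j * ((g : ℤ) + 1) - 1)).re) :
    ∃ p q : ℤ → Fin (g + 1) → ℝ, IsClassAt k c p q T := by
  set N : ℤ → ℤ := fun j => k + j * ((g : ℤ) + 1) with hN
  have hNs : ∀ j, N (j + 1) = N j + g + 1 := fun j => by simp only [hN]; ring
  have hidx : ∀ (j : ℤ) (m : Fin (g + 1)),
      k + (j * ((g : ℤ) + 1) + ((m : ℕ) : ℤ)) = N j + ((m : ℕ) : ℤ) := fun j m => by
    simp only [hN]; ring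
  -- The vector `p_j` is the part in block `j` of the column just before that block. The last row of
  -- the diagonal block is `p_g q*`, since the last diagonal correction is `0`; this gives `q_j`.
  let p : ℤ → Fin (g + 1) → ℝ := fun j m => (entry T (N j + ((m : ℕ) : ℤ)) (N j - 1)).re
  let q : ℤ → Fin (g + 1) → ℝ := fun j m =>
    (entry T (N j + g) (N j + ((m : ℕ) : ℤ))).re / p j (Fin.last g)
  have hp : ∀ j, 0 < p j (Fin.last g) := fun j => by simpa [p] using h₃ j
  have hpe : ∀ (j : ℤ) (m : Fin (g + 1)),
      entry T (N j + ((m : ℕ) : ℤ)) (N j - 1) = (p j m : ℂ) := fun j m =>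
    (hT.entry_real _ _).symm
  have hqe : ∀ (j : ℤ) (m : Fin (g + 1)),
      entry T (N j + g) (N j + ((m : ℕ) : ℤ)) = (p j (Fin.last g) * q j m : ℝ) := fun j m => by
    rw [mul_div_cancel₀ _ (hp j).ne']; exact (hT.entry_real _ _).symm
  -- the block below the diagonal
  have hoff : ∀ (j : ℤ) (m n : Fin (g + 1)),
      entry T (N (j + 1) + ((m : ℕ) : ℤ)) (N j + ((n : ℕ) : ℤ)) =
        (blockA (p (j + 1)) n m : ℝ) := by
    intro j m n
    rw [blockA_apply]
    split_ifs with hn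
    · subst hn
      rw [← hpe, hNs, Fin.val_last]; congr 1; ring
    · have hn' : (n : ℕ) < g := by
        have := n.2
        have : (n : ℕ) ≠ g := fun h => hn (Fin.ext h)
        omega
      rw [entry_eq, Complex.ofReal_zero]
      refine mem_below.1 (h₁ (j + 1) (e (N j + ((n : ℕ) : ℤ))) (e_mem_below ?_)) _ ?_
      · change _ < N (j + 1) - 1
        rw [hNs]; omega
      · change N (j + 1) ≤ _
        omega
  have hfar : ∀ (j l : ℤ) (m n : Fin (g + 1)), l + 2 ≤ j →
      entry T (N j + ((m : ℕ) : ℤ)) (N l + ((n : ℕ) : ℤ)) = 0 := by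
    intro j l m n hjl
    have hn := n.2
    have h4 : N (l + 2) ≤ N j := by simp only [hN]; nlinarith
    have h5 : N (l + 2) = N l + g + 1 + g + 1 := by
      rw [show l + 2 = l + 1 + 1 by ring, hNs, hNs]
    rw [entry_eq]
    refine mem_below.1 (h₁ (l + 2) (e (N l + ((n : ℕ) : ℤ))) (e_mem_below ?_)) _ ?_
    · change _ < N (l + 2) - 1
      omega
    · change N (l + 2) ≤ _
      omega
  -- the diagonal block
  have hcol : ∀ (j : ℤ) (m : ℕ), m ≤ g → ∀ x ∈ below (N j + m), ∃ a : ℂ,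
      T x - a • T (e (N j - 1)) ∈ below (N j + m) := by
    intro j m
    induction m with
    | zero =>
      intro _ x hx
      refine ⟨x (N j - 1), ?_⟩
      rw [← map_smul, ← map_sub]
      simp only [Nat.cast_zero, add_zero] at hx ⊢
      exact h₁ j _ (sub_mem_below (n := N j - 1) (by rwa [sub_add_cancel]))
    | succ m ih =>
      intro hm x hx
      obtain ⟨y, hy, y', hy', hxy⟩ := h₂ j ⟨m, hm⟩ x (by
        convert hx using 2; simp only [hN]; push_cast; ring)
      obtain ⟨a, ha⟩ := ih (by omega) y' hy'
      refine ⟨a, ?_⟩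
      have : T x - a • T (e (N j - 1)) =
          (c ⟨m, hm⟩ : ℂ) • x + (y + (T y' - a • T (e (N j - 1)))) := by
        rw [sub_eq_iff_eq_add.1 hxy]; abel
      rw [this]
      refine add_mem (Submodule.smul_mem _ _ hx) (below_mono ?_ (add_mem hy ha))
      change N j + (m : ℤ) ≤ N j + ((m + 1 : ℕ) : ℤ)
      push_cast; omega
  have hdiag : ∀ (j : ℤ) (m n : Fin (g + 1)), n ≤ m →
      entry T (N j + ((m : ℕ) : ℤ)) (N j + ((n : ℕ) : ℤ)) = (blockB c (p j) (q j) m n : ℝ) := by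
    intro j m n hnm
    rw [blockB_apply, if_neg hnm.not_gt]
    induction n using Fin.lastCases with
    | last =>
      have hm : m = Fin.last g := le_antisymm (Fin.le_last m) hnm
      subst hm
      rw [if_pos rfl, Fin.snoc_last, add_zero, ← hqe]
      simp
    | cast n =>
      have hn := n.2
      obtain ⟨y, hy, y', hy', hxy⟩ := h₂ j n (e (N j + ((n : ℕ) : ℤ))) (e_mem_below (by
        change N j + _ < N j + _ + 1
        omega))
      obtain ⟨a, ha⟩ := hcol j n n.2.le y' hy'
      have hent : ∀ i : Fin (g + 1), n.castSucc ≤ i →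
          entry T (N j + ((i : ℕ) : ℤ)) (N j + ((n : ℕ) : ℤ)) =
            a * p j i + if i = n.castSucc then (c n : ℂ) else 0 := by
        intro i hi
        have hi' : (n : ℕ) ≤ (i : ℕ) := hi
        have h4 : T (e (N j + ((n : ℕ) : ℤ))) - (c n : ℂ) • e (N j + ((n : ℕ) : ℤ)) -
            a • T (e (N j - 1)) ∈ below (N j + ((n : ℕ) : ℤ)) := by
          rw [hxy, add_sub_assoc]; exact add_mem hy ha
        have h5 := mem_below.1 h4 (N j + ((i : ℕ) : ℤ)) (by omega)
        change T (e (N j + ((n : ℕ) : ℤ))) (N j + ((i : ℕ) : ℤ)) -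
          (c n : ℂ) * e (N j + ((n : ℕ) : ℤ)) (N j + ((i : ℕ) : ℤ)) -
          a * T (e (N j - 1)) (N j + ((i : ℕ) : ℤ)) = 0 at h5
        rw [← entry_eq, ← entry_eq, hpe, e_apply] at h5
        have h6 : (N j + ((i : ℕ) : ℤ) = N j + ((n : ℕ) : ℤ)) ↔ i = n.castSucc := by
          rw [Fin.ext_iff]; simp
        simp only [h6] at h5
        rw [sub_sub, sub_eq_zero] at h5
        rw [h5, add_comm]; split_ifs <;> simp
      -- The factor `a` is the same for all rows of the column, so the bottom row identifies it as
      -- `q`.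
      have h7 := hent (Fin.last g) (Fin.le_last _)
      rw [if_neg (Fin.castSucc_lt_last n).ne', add_zero, Fin.val_last] at h7
      have h8 := hqe j n.castSucc
      rw [Fin.val_castSucc, h7] at h8
      have h9 : a = (q j n.castSucc : ℂ) := by
        have h10 : ((p j (Fin.last g) : ℝ) : ℂ) ≠ 0 := by exact_mod_cast (hp j).ne'
        apply mul_right_cancel₀ h10
        rw [h8]; push_cast; ring
      rw [Fin.val_castSucc, hent m hnm, h9]
      split_ifs with hmn
      · subst hmn; rw [Fin.snoc_castSucc]; push_cast; ring
      · push_cast; ring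
  refine ⟨p, q, hp, fun j l m n => ?_⟩
  rw [hidx, hidx]
  obtain h | h | h | h | h : l = j ∨ l = j + 1 ∨ j = l + 1 ∨ j + 2 ≤ l ∨ l + 2 ≤ j := by omega
  · subst h
    rcases le_total n m with h | h
    · rw [block_self, hdiag _ _ _ h]
    · rw [block_symm, block_self, hT.entry_symm, hdiag _ _ _ h]
  · subst h; rw [block_succ_right, hT.entry_symm, hoff]
  · subst h; rw [block_succ_left, hoff]
  · rw [block_of_far _ _ _ (.inl h), hT.entry_symm, hfar _ _ _ _ h, Complex.ofReal_zero]
  · rw [block_of_far _ _ _ (.inr h), hfar _ _ _ _ h, Complex.ofReal_zero]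

end GMP

namespace GMP

open scoped ComplexConjugate

variable {g : ℕ}

/-! ### The periodic sequence of poles -/

/-- The pole attached to the index `n`: the points `c` in order, then the point at infinity,
periodically. -/
def pole (c : Fin g → ℝ) (n : ℤ) : Option ℝ :=
  if h : (n % ((g : ℤ) + 1)).toNat < g then some (c ⟨_, h⟩) else none

theorem pole_add_mul (c : Fin g → ℝ) (n j : ℤ) : pole c (n + j * ((g : ℤ) + 1)) = pole c n := by
  simp [pole]

theorem pole_add_period (c : Fin g → ℝ) (n : ℤ) : pole c (n + ((g : ℤ) + 1)) = pole c n := by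
  simpa using pole_add_mul c n 1

theorem pole_cast (c : Fin g → ℝ) (m : Fin g) : pole c ((m : ℕ) : ℤ) = some (c m) := by
  have hm := m.2
  have : (((m : ℕ) : ℤ) % ((g : ℤ) + 1)).toNat = m := by
    rw [Int.emod_eq_of_lt (by omega) (by omega)]; rfl
  simp [pole, this]

theorem pole_cast_last (c : Fin g → ℝ) : pole c (g : ℤ) = none := by
  simp [pole]

theorem pole_neg_one (c : Fin g → ℝ) : pole c (-1) = none := by
  rw [← pole_add_period, show (-1 : ℤ) + (g + 1) = g by ring, pole_cast_last]

theorem exists_pole_index (c : Fin g → ℝ) (n : ℤ) :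
    (∃ j : ℤ, n = j * ((g : ℤ) + 1) - 1 ∧ pole c n = none) ∨
      ∃ (j : ℤ) (m : Fin g), n = ((m : ℕ) : ℤ) + j * ((g : ℤ) + 1) ∧ pole c n = some (c m) := by
  obtain ⟨j, m, hn⟩ := exists_block_index (g := g) 0 n
  induction m using Fin.lastCases with
  | last =>
    left
    have h1 : n = -1 + (j + 1) * ((g : ℤ) + 1) := by rw [hn, Fin.val_last]; ring
    refine ⟨j + 1, by rw [h1]; ring, by rw [h1, pole_add_mul, pole_neg_one]⟩
  | cast m =>
    right
    have h1 : n = ((m : ℕ) : ℤ) + j * ((g : ℤ) + 1) := by rw [hn, Fin.val_castSucc]; ring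
    exact ⟨j, m, h1, by rw [h1, pole_add_mul, pole_cast]⟩

theorem dvd_sub_of_pole_eq {c : Fin g → ℝ} (hc : Function.Injective c) {m n : ℤ}
    (h : pole c m = pole c n) : ((g : ℤ) + 1) ∣ m - n := by
  obtain ⟨j, hj, hj'⟩ | ⟨j, a, hj, hj'⟩ := exists_pole_index c m <;>
  obtain ⟨l, hl, hl'⟩ | ⟨l, b, hl, hl'⟩ := exists_pole_index c n
  · exact ⟨j - l, by rw [hj, hl]; ring⟩
  · rw [hj', hl'] at h; cases h
  · rw [hj', hl'] at h; cases h
  · rw [hj', hl', Option.some_inj] at h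
    rw [hc h] at hj
    exact ⟨j - l, by rw [hj, hl]; ring⟩

theorem pole_ne {c : Fin g → ℝ} (hc : Function.Injective c) {m n : ℤ} (h : m < n)
    (h' : n < m + ((g : ℤ) + 1)) : pole c m ≠ pole c n := fun hp => by
  have h1 := dvd_sub_of_pole_eq hc hp.symm
  have h2 := Int.le_of_dvd (by omega) h1
  omega

/-! ### Resolvents at the poles -/

/-- `o - A`, and `1` for the point at infinity. -/
noncomputable def den (A : L2 →L[ℂ] L2) : Option ℝ → (L2 →L[ℂ] L2)
  | none => 1
  | some t => algebraMap ℂ (L2 →L[ℂ] L2) (t : ℂ) - A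

/-- The resolvent `(o - A)⁻¹`, and `A` for the point at infinity. -/
noncomputable def res (A : L2 →L[ℂ] L2) : Option ℝ → (L2 →L[ℂ] L2)
  | none => A
  | some t => Ring.inverse (algebraMap ℂ (L2 →L[ℂ] L2) (t : ℂ) - A)

/-- The image of the second pole under the Möbius transformation that sends the first one to
infinity. -/
noncomputable def moebius : Option ℝ → Option ℝ → ℝ
  | none, none => 0
  | none, some t => t
  | some _, none => 0
  | some t, some s => (t - s)⁻¹

theorem moebius_injective {o o₁ o₂ : Option ℝ} (h₁ : o ≠ o₁) (h₂ : o ≠ o₂)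
    (h : moebius o o₁ = moebius o o₂) : o₁ = o₂ := by
  have hne : ∀ {t s : ℝ}, some t ≠ some s → t - s ≠ 0 := fun h h0 =>
    h (congrArg some (sub_eq_zero.1 h0))
  rcases o with _ | t <;> rcases o₁ with _ | t₁ <;> rcases o₂ with _ | t₂ <;>
    simp only [moebius] at h
  · exact absurd rfl h₁
  · exact absurd rfl h₁
  · exact absurd rfl h₂
  · rw [h]
  · rfl
  · exact absurd h.symm (inv_ne_zero (hne h₂))
  · exact absurd h (inv_ne_zero (hne h₁))
  · rw [sub_right_injective (inv_injective h)]

variable {A : L2 →L[ℂ] L2}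

theorem isUnit_den_some {t : ℝ} (h : IsUnit (algebraMap ℂ (L2 →L[ℂ] L2) (t : ℂ) - A)) :
    IsUnit (den A (some t)) := h

theorem isUnit_den_pole {c : Fin g → ℝ}
    (h : ∀ k, IsUnit (algebraMap ℂ (L2 →L[ℂ] L2) (c k : ℂ) - A)) (n : ℤ) :
    IsUnit (den A (pole c n)) := by
  unfold pole
  split_ifs with hn
  · exact h _
  · exact isUnit_one

theorem IsRealSymm.den (hA : IsRealSymm A) (o : Option ℝ) : IsRealSymm (den A o) := by
  cases o with
  | none => exact isRealSymm_one
  | some t => exact hA.algebraMap_sub t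

theorem IsRealSymm.res (hA : IsRealSymm A) {o : Option ℝ} (ho : IsUnit (GMP.den A o)) :
    IsRealSymm (res A o) := by
  cases o with
  | none => exact hA
  | some t => exact (hA.algebraMap_sub t).inverse ho

theorem res_some_apply_sub {t : ℝ} (ht : IsUnit (den A (some t))) (x : L2) :
    res A (some t) (A x) = (t : ℂ) • res A (some t) x - x := by
  have h1 : res A (some t) ((t : ℂ) • x - A x) = x := inverse_apply_self ht x
  rw [map_sub, map_smul] at h1
  rw [eq_sub_iff_add_eq, ← eq_sub_iff_add_eq', h1]

theorem apply_res_some {t : ℝ} (ht : IsUnit (den A (some t))) (x : L2) :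
    A (res A (some t) x) = (t : ℂ) • res A (some t) x - x := by
  have h1 : (t : ℂ) • res A (some t) x - A (res A (some t) x) = x := self_apply_inverse ht x
  rw [eq_sub_iff_add_eq, ← eq_sub_iff_add_eq', h1]

/-- Partial fractions: `moebius o o'` is the value at `o'` of the function `1/(o - λ)` (or `λ` if `o
= ∞`). Subtracting it cancels the simple pole at `o'`, and what is left has at most a simple pole at
`o`, hence is affine in the resolvent at `o`. -/
theorem res_sub_moebius {o o' : Option ℝ} (ho : IsUnit (den A o)) (ho' : IsUnit (den A o'))
    (h : o ≠ o') : ∃ a b : ℂ, ∀ x,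
      res A o (res A o' x) - (moebius o o' : ℂ) • res A o' x = a • x + b • res A o x := by
  rcases o with _ | t <;> rcases o' with _ | s
  · exact absurd rfl h
  · exact ⟨-1, 0, fun x => by
      change A (res A (some s) x) - (s : ℂ) • res A (some s) x = _
      rw [apply_res_some ho']; simp⟩
  · exact ⟨-1, t, fun x => by
      change res A (some t) (A x) - ((0 : ℝ) : ℂ) • A x = _
      rw [res_some_apply_sub ho]; simp [sub_eq_neg_add]⟩
  · have hts : (t : ℂ) - s ≠ 0 := fun h0 =>
      h (congrArg some (by exact_mod_cast sub_eq_zero.1 h0))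
    refine ⟨0, -((t : ℂ) - s)⁻¹, fun x => ?_⟩
    have h1 : (s : ℂ) • res A (some s) x - A (res A (some s) x) = x := self_apply_inverse ho' x
    have h2 : res A (some t) x = (s : ℂ) • res A (some t) (res A (some s) x) -
        ((t : ℂ) • res A (some t) (res A (some s) x) - res A (some s) x) := by
      rw [← res_some_apply_sub ho, ← map_smul, ← map_sub, h1]
    have h3 : res A (some t) (res A (some s) x) =
        ((t : ℂ) - s)⁻¹ • (((t : ℂ) - s) • res A (some t) (res A (some s) x)) := by
      rw [smul_smul, inv_mul_cancel₀ hts, one_smul]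
    have h4 : ((t : ℂ) - s) • res A (some t) (res A (some s) x) =
        res A (some s) x - res A (some t) x := by
      rw [h2, sub_smul]; abel
    rw [h3, h4]
    simp only [moebius]
    push_cast
    rw [smul_sub, neg_smul, zero_smul]
    abel

/-- A closed subspace that is invariant under a symmetric operator is invariant under its
resolvents. -/
theorem res_mem_of_invariant (hA : IsRealSymm A) {o : Option ℝ} (ho : IsUnit (den A o))
    {Z : Submodule ℂ L2} (hZ : IsClosed (Z : Set L2)) (hinv : ∀ x ∈ Z, A x ∈ Z) {x : L2}
    (hx : x ∈ Z) : res A o x ∈ Z := by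
  have : CompleteSpace Z := hZ.completeSpace_coe
  cases o with
  | none => exact hinv x hx
  | some t =>
    obtain ⟨u, hu, v, hv, huv⟩ := Z.exists_add_mem_mem_orthogonal (res A (some t) x)
    have h1 : den A (some t) u + den A (some t) v = x := by
      rw [← map_add, ← huv]; exact self_apply_inverse ho x
    have hZd : ∀ y ∈ Z, den A (some t) y ∈ Z := fun y hy =>
      sub_mem (Z.smul_mem _ hy) (hinv y hy)
    -- The component of the resolvent orthogonal to `Z` is sent by `t - A` into both `Z` and its
    -- orthogonal complement, so it vanishes.
    have h2 : den A (some t) v ∈ Z := by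
      rw [eq_sub_of_add_eq' h1]; exact sub_mem hx (hZd u hu)
    have h3 : den A (some t) v ∈ Zᗮ := (Submodule.mem_orthogonal _ _).2 fun y hy => by
      rw [← (hA.den _).symm]
      exact (Submodule.mem_orthogonal _ _).1 hv _ (hZd y hy)
    have h4 : den A (some t) v = 0 := by
      have := (Submodule.mem_orthogonal _ _).1 h3 _ h2
      exact inner_self_eq_zero.1 this
    have h5 : v = 0 := injective_of_isUnit ho (by rw [h4, map_zero])
    rw [huv, h5, add_zero]; exact hu

/-! ### The coordinate flag of a GMP matrix -/

namespace GMPMatrix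

variable {c : Fin g → ℝ} (A : GMPMatrix c)

/-- The operator whose matrix is of the class `𝔸` in the block decomposition that starts right
after the index `n`. -/
noncomputable def stepOp (n : ℤ) : L2 →L[ℂ] L2 := res A.op (pole c n)

theorem isUnit_den (n : ℤ) : IsUnit (den A.op (pole c n)) := isUnit_den_pole A.isUnit n

theorem isClassAt : IsClassAt 0 c A.p A.q A.op := isClassA_iff.1 A.isClassA

theorem isRealSymm : IsRealSymm A.op := A.isClassAt.isRealSymm

theorem isRealSymm_stepOp (n : ℤ) : IsRealSymm (A.stepOp n) := A.isRealSymm.res (A.isUnit_den n)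

theorem stepOp_isClassAt (n : ℤ) : ∃ (k j : ℤ) (c' : Fin g → ℝ) (p q : ℤ → Fin (g + 1) → ℝ),
    n = k + j * ((g : ℤ) + 1) - 1 ∧ IsClassAt k c' p q (A.stepOp n) := by
  obtain ⟨j, hj, hn⟩ | ⟨j, m, hj, hn⟩ := exists_pole_index c n
  · refine ⟨0, j, c, A.p, A.q, by rw [hj]; ring, ?_⟩
    rw [stepOp, hn]; exact A.isClassAt
  · obtain ⟨c', p, q, -, h⟩ := A.inv_isClassA m
    refine ⟨((m : ℕ) + 1 : ℕ), j, c', p, q, by rw [hj]; push_cast; ring, ?_⟩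
    rw [stepOp, hn]; exact isClassA_shiftConj_iff.1 h

theorem stepOp_entry_eq_zero {n i l : ℤ} (hl : l < n) (hi : n < i) :
    entry (A.stepOp n) i l = 0 := by
  obtain ⟨k, j, c', p, q, hn, h⟩ := A.stepOp_isClassAt n
  exact h.entry_eq_zero j (by omega) (by omega)

theorem stepOp_entry_pos (n : ℤ) :
    ∃ r : ℝ, 0 < r ∧ entry (A.stepOp n) (n + ((g : ℤ) + 1)) n = r := by
  obtain ⟨k, j, c', p, q, hn, h⟩ := A.stepOp_isClassAt n
  refine ⟨_, h.1 j, ?_⟩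
  rw [← h.entry_column j (Fin.last g), ← hn, Fin.val_last]
  congr 1; omega

theorem stepOp_below {n : ℤ} {x : L2} (hx : x ∈ below n) : A.stepOp n x ∈ below (n + 1) := by
  have : below n ≤ (below (n + 1)).comap (A.stepOp n).toLinearMap :=
    below_le ((isClosed_below _).preimage (A.stepOp n).continuous) fun l hl =>
      mem_below.2 fun i hi => by
        have := A.stepOp_entry_eq_zero hl (show n < i by omega)
        rwa [entry_eq] at this
  exact this hx

theorem stepOp_above {n : ℤ} {x : L2} (hx : x ∈ above (n + 1)) : A.stepOp n x ∈ above n :=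
  mem_above_of_orthogonal fun y hy => by
    rw [← (A.isRealSymm_stepOp n).symm]
    exact inner_eq_zero_of_below_above (A.stepOp_below hy) hx

/-- The entry of `stepOp n` in row `n` and column `n - (g+1)` is an outermost, positive one. So a
multiple of the image of that basis vector cancels the top coordinate of `x`. -/
theorem exists_below_succ {n : ℤ} {x : L2} (hx : x ∈ below (n + 1)) :
    ∃ y ∈ below n, ∃ y' ∈ below n, x = y + A.stepOp n y' := by
  obtain ⟨r, hr, hr'⟩ := A.stepOp_entry_pos (n - ((g : ℤ) + 1))
  rw [stepOp, sub_add_cancel, ← pole_add_period, sub_add_cancel, ← stepOp] at hr'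
  have hrc : (r : ℂ) ≠ 0 := by exact_mod_cast hr.ne'
  set u := A.stepOp n (e (n - ((g : ℤ) + 1)))
  have hu : u ∈ below (n + 1) := A.stepOp_below (e_mem_below (by omega))
  have hun : u n = r := by rw [← hr', entry_eq]
  refine ⟨x - (x n / r) • u, ?_, (x n / r) • e (n - ((g : ℤ) + 1)),
    Submodule.smul_mem _ _ (e_mem_below (by omega)), by rw [map_smul]; simp [u]⟩
  have h1 := sub_mem_below (sub_mem hx (Submodule.smul_mem _ (x n / r) hu))
  have h2 : (x - (x n / r) • u) n = 0 := by
    change x n - x n / r * u n = 0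
    rw [hun]; field_simp; simp
  rwa [h2, zero_smul, sub_zero] at h1

theorem exists_above_pred {n : ℤ} {x : L2} (hx : x ∈ above n) :
    ∃ y ∈ above (n + 1), ∃ y' ∈ above (n + 1), x = y + A.stepOp n y' := by
  obtain ⟨r, hr, hr'⟩ := A.stepOp_entry_pos n
  have hrc : (r : ℂ) ≠ 0 := by exact_mod_cast hr.ne'
  set u := A.stepOp n (e (n + ((g : ℤ) + 1)))
  have hu : u ∈ above n := A.stepOp_above (e_mem_above (by omega))
  have hun : u n = r := by rw [← hr', (A.isRealSymm_stepOp n).entry_symm, entry_eq]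
  refine ⟨x - (x n / r) • u, ?_, (x n / r) • e (n + ((g : ℤ) + 1)),
    Submodule.smul_mem _ _ (e_mem_above (by omega)), by rw [map_smul]; simp [u]⟩
  have h1 := sub_mem_above (sub_mem hx (Submodule.smul_mem _ (x n / r) hu))
  have h2 : (x - (x n / r) • u) n = 0 := by
    change x n - x n / r * u n = 0
    rw [hun]; field_simp; simp
  rwa [h2, zero_smul, sub_zero] at h1

end GMPMatrix

end GMP

namespace GMP

open scoped ComplexConjugate InnerProductSpace

/-! ### Moments of self-adjoint operators -/

section Moments

variable {H : Type*} [NormedAddCommGroup H] [InnerProductSpace ℂ H]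

theorem isUnit_sub_algebraMap [CompleteSpace H] {X : H →L[ℂ] H} (hX : IsSelfAdjoint X) {z : ℂ}
    (hz : z.im ≠ 0) : IsUnit (X - algebraMap ℂ (H →L[ℂ] H) z) := by
  by_contra h
  refine hz (hX.im_eq_zero_of_mem_spectrum (z := z) ?_)
  rw [spectrum.mem_iff, IsUnit.sub_iff]; exact h

theorem apply_inverse_sub {X : H →L[ℂ] H} {z : ℂ}
    (h : IsUnit (X - algebraMap ℂ (H →L[ℂ] H) z)) (x : H) :
    X (Ring.inverse (X - algebraMap ℂ (H →L[ℂ] H) z) x) =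
      x + z • Ring.inverse (X - algebraMap ℂ (H →L[ℂ] H) z) x := by
  have h1 : (X - algebraMap ℂ (H →L[ℂ] H) z)
      (Ring.inverse (X - algebraMap ℂ (H →L[ℂ] H) z) x) = x := by
    rw [← mul_apply_eq_comp, Ring.mul_inverse_cancel _ h]; rfl
  exact sub_eq_iff_eq_add.1 h1

theorem tendsto_inner_pow_inverse [CompleteSpace H] {X : H →L[ℂ] H} (hX : IsSelfAdjoint X)
    (x : H) (n : ℕ) : Filter.Tendsto (fun t : ℝ =>
      inner ℂ x ((X ^ n) (Ring.inverse (X - algebraMap ℂ (H →L[ℂ] H) (t * Complex.I)) x)))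
      Filter.atTop (nhds 0) := by
  have hlim : Filter.Tendsto (fun t : ℝ => ‖x‖ * ‖X ^ n‖ * ‖x‖ / (t - ‖X‖))
      Filter.atTop (nhds 0) :=
    Filter.Tendsto.const_div_atTop (Filter.tendsto_atTop_add_const_right _ _ Filter.tendsto_id) _
  refine squeeze_zero_norm' ?_ hlim
  filter_upwards [Filter.eventually_gt_atTop (0 : ℝ), Filter.eventually_gt_atTop ‖X‖] with t ht htX
  have hu := isUnit_sub_algebraMap hX (z := t * Complex.I) (by simpa using ht.ne')
  set y := Ring.inverse (X - algebraMap ℂ (H →L[ℂ] H) (t * Complex.I)) x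
  have h1 : X y = x + ((t : ℂ) * Complex.I) • y := apply_inverse_sub hu x
  have h2 : t * ‖y‖ ≤ ‖X‖ * ‖y‖ + ‖x‖ := by
    have h3 : ‖((t : ℂ) * Complex.I) • y‖ = t * ‖y‖ := by
      rw [norm_smul]; simp [abs_of_pos ht]
    rw [← h3, eq_sub_of_add_eq' h1.symm]
    exact (norm_sub_le _ _).trans (add_le_add_left (X.le_opNorm y) _)
  have h4 : ‖y‖ ≤ ‖x‖ / (t - ‖X‖) := by
    rw [le_div_iff₀ (by linarith)]; linarith
  calc ‖inner ℂ x ((X ^ n) y)‖ ≤ ‖x‖ * ‖(X ^ n) y‖ := norm_inner_le_norm _ _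
    _ ≤ ‖x‖ * (‖X ^ n‖ * (‖x‖ / (t - ‖X‖))) := by
        gcongr
        exact ((X ^ n).le_opNorm y).trans (by gcongr)
    _ = _ := by ring

/-- This is the expansion of the resolvent at infinity. From `Xⁿ⁺¹ (X - z)⁻¹ = Xⁿ + z Xⁿ (X - z)⁻¹`,
equality of the functions for `Xⁿ (X - z)⁻¹` gives that of the `n`-th moments upon letting `z = it`
tend to infinity, and then equality of the functions for `n + 1`. -/
theorem inner_pow_eq_of_resolvent_eq [CompleteSpace H] {X X' : H →L[ℂ] H} (hX : IsSelfAdjoint X)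
    (hX' : IsSelfAdjoint X') {x : H}
    (h : ∀ z : ℂ, z.im ≠ 0 → inner ℂ x (Ring.inverse (X - algebraMap ℂ (H →L[ℂ] H) z) x) =
      inner ℂ x (Ring.inverse (X' - algebraMap ℂ (H →L[ℂ] H) z) x)) (n : ℕ) :
    inner ℂ x ((X ^ n) x) = inner ℂ x ((X' ^ n) x) := by
  have hrec : ∀ {Y : H →L[ℂ] H}, IsSelfAdjoint Y → ∀ (n : ℕ) (z : ℂ), z.im ≠ 0 →
      inner ℂ x ((Y ^ (n + 1)) (Ring.inverse (Y - algebraMap ℂ (H →L[ℂ] H) z) x)) =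
        inner ℂ x ((Y ^ n) x) +
          z * inner ℂ x ((Y ^ n) (Ring.inverse (Y - algebraMap ℂ (H →L[ℂ] H) z) x)) := by
    intro Y hY n z hz
    rw [pow_succ, mul_apply_eq_comp, apply_inverse_sub (isUnit_sub_algebraMap hY hz),
      map_add, map_smul, inner_add_right, inner_smul_right]
  have hstep : ∀ n : ℕ, (∀ z : ℂ, z.im ≠ 0 →
      inner ℂ x ((X ^ n) (Ring.inverse (X - algebraMap ℂ (H →L[ℂ] H) z) x)) =
      inner ℂ x ((X' ^ n) (Ring.inverse (X' - algebraMap ℂ (H →L[ℂ] H) z) x))) →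
      inner ℂ x ((X ^ n) x) = inner ℂ x ((X' ^ n) x) := by
    intro n hn
    rw [← sub_eq_zero]
    refine tendsto_nhds_unique (f := fun _ : ℝ => inner ℂ x ((X ^ n) x) - inner ℂ x ((X' ^ n) x))
      (l := Filter.atTop) tendsto_const_nhds ?_
    have hlim := (tendsto_inner_pow_inverse hX x (n + 1)).sub
      (tendsto_inner_pow_inverse hX' x (n + 1))
    rw [sub_zero] at hlim
    refine hlim.congr' ?_
    filter_upwards [Filter.eventually_gt_atTop (0 : ℝ)] with t ht
    have hz : ((t : ℂ) * Complex.I).im ≠ 0 := by simpa using ht.ne'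
    rw [hrec hX n _ hz, hrec hX' n _ hz, hn _ hz, add_sub_add_right_eq_sub]
  have hall : ∀ (n : ℕ) (z : ℂ), z.im ≠ 0 →
      inner ℂ x ((X ^ n) (Ring.inverse (X - algebraMap ℂ (H →L[ℂ] H) z) x)) =
      inner ℂ x ((X' ^ n) (Ring.inverse (X' - algebraMap ℂ (H →L[ℂ] H) z) x)) := by
    intro n
    induction n with
    | zero => simpa using h
    | succ n ih =>
      intro z hz
      rw [hrec hX n z hz, hrec hX' n z hz, hstep n ih, ih z hz]
  exact hstep n (hall n)

open Polynomial in
theorem inner_aeval_eq {X X' : H →L[ℂ] H} [CompleteSpace H] (hX : IsSelfAdjoint X)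
    (hX' : IsSelfAdjoint X') {x : H}
    (h : ∀ n : ℕ, inner ℂ x ((X ^ n) x) = inner ℂ x ((X' ^ n) x)) (P Q : ℂ[X]) :
    inner ℂ (aeval X P x) (aeval X Q x) = inner ℂ (aeval X' P x) (aeval X' Q x) := by
  have hpow : ∀ {Y : H →L[ℂ] H}, IsSelfAdjoint Y → ∀ i j : ℕ,
      inner ℂ ((Y ^ i) x) ((Y ^ j) x) = inner ℂ x ((Y ^ (i + j)) x) := by
    intro Y hY i j
    rw [pow_add, mul_apply_eq_comp]
    have := (hY.pow i)
    rw [ContinuousLinearMap.isSelfAdjoint_iff_isSymmetric] at this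
    exact this _ _
  induction P using Polynomial.induction_on' with
  | add p q hp hq => simp only [map_add, add_apply, inner_add_left, hp, hq]
  | monomial i a =>
    induction Q using Polynomial.induction_on' with
    | add p q hp hq => simp only [map_add, add_apply, inner_add_right, hp, hq]
    | monomial j b =>
      simp only [aeval_monomial, mul_apply_eq_comp, Algebra.algebraMap_eq_smul_one, smul_apply,
        one_apply_eq_self, inner_smul_left, inner_smul_right, hpow hX, hpow hX', h]

open Polynomial in
theorem aeval_C_mul_apply (Y : H →L[ℂ] H) (a : ℂ) (P : ℂ[X]) (x : H) :
    aeval Y (C a * P) x = a • aeval Y P x := by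
  rw [map_mul, aeval_C, mul_apply_eq_comp, Algebra.algebraMap_eq_smul_one]; rfl

open Polynomial in
/-- The coefficients of a one-sided Jacobi matrix are determined by its moments. -/
theorem jacobi_coeff_eq [CompleteSpace H] {X X' : H →L[ℂ] H} (hX : IsSelfAdjoint X)
    (hX' : IsSelfAdjoint X') {v : ℕ → H} (hv : Orthonormal ℂ v)
    (h : ∀ n : ℕ, inner ℂ (v 0) ((X ^ n) (v 0)) = inner ℂ (v 0) ((X' ^ n) (v 0)))
    {α β α' β' : ℕ → ℝ} (hα : ∀ n, 0 < α n) (hα' : ∀ n, 0 < α' n)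
    (hX0 : X (v 0) = (β 0 : ℂ) • v 0 + (α 0 : ℂ) • v 1)
    (hX0' : X' (v 0) = (β' 0 : ℂ) • v 0 + (α' 0 : ℂ) • v 1)
    (hXs : ∀ n, X (v (n + 1)) =
      (α n : ℂ) • v n + (β (n + 1) : ℂ) • v (n + 1) + (α (n + 1) : ℂ) • v (n + 2))
    (hXs' : ∀ n, X' (v (n + 1)) =
      (α' n : ℂ) • v n + (β' (n + 1) : ℂ) • v (n + 1) + (α' (n + 1) : ℂ) • v (n + 2)) (n : ℕ) :
    α n = α' n ∧ β n = β' n := by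
  have hgram := inner_aeval_eq hX hX' h
  -- One polynomial produces `v n` from `v 0` under both operators, and the moments fix all inner
  -- products of such vectors. So `β n` comes from `⟨v n, X (v n)⟩`, and `α n > 0` from the norm of
  -- the remaining term, which yields the polynomial for `v (n + 1)`.
  have hstep : ∀ (n : ℕ) (u : H) (P Q : ℂ[X]), aeval X P (v 0) = v n → aeval X' P (v 0) = v n →
      aeval X Q (v 0) = u → aeval X' Q (v 0) = u → inner ℂ (v n) u = 0 →
      X (v n) = u + (β n : ℂ) • v n + (α n : ℂ) • v (n + 1) →
      X' (v n) = u + (β' n : ℂ) • v n + (α' n : ℂ) • v (n + 1) →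
      (α n = α' n ∧ β n = β' n) ∧
        ∃ R : ℂ[X], aeval X R (v 0) = v (n + 1) ∧ aeval X' R (v 0) = v (n + 1) := by
    intro n u P Q hP hP' hQ hQ' hu hn hn'
    have hself : inner ℂ (v n) (v n) = 1 := by
      rw [inner_self_eq_norm_sq_to_K, hv.1]; simp
    have hself' : inner ℂ (v (n + 1)) (v (n + 1)) = 1 := by
      rw [inner_self_eq_norm_sq_to_K, hv.1]; simp
    have hoff : inner ℂ (v n) (v (n + 1)) = 0 := hv.2 (Nat.ne_of_lt (Nat.lt_succ_self n))
    have e1 : aeval X (Polynomial.X * P) (v 0) = X (v n) := by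
      rw [map_mul, aeval_X, mul_apply_eq_comp, hP]
    have e1' : aeval X' (Polynomial.X * P) (v 0) = X' (v n) := by
      rw [map_mul, aeval_X, mul_apply_eq_comp, hP']
    have hβ : β n = β' n := by
      have h1 := hgram P (Polynomial.X * P)
      rw [e1, e1', hP, hP', hn, hn'] at h1
      simp only [inner_add_right, inner_smul_right, hu, hself, hoff] at h1
      have h2 : (β n : ℂ) = β' n := by simpa using h1
      exact_mod_cast h2
    let R : ℂ[X] := Polynomial.X * P - Q - C (β n : ℂ) * P
    have hR : aeval X R (v 0) = (α n : ℂ) • v (n + 1) := by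
      simp only [R, map_sub, sub_apply, e1, hQ, hn, aeval_C_mul_apply, hP]
      abel
    have hR' : aeval X' R (v 0) = (α' n : ℂ) • v (n + 1) := by
      simp only [R, map_sub, sub_apply, e1', hQ', hn', aeval_C_mul_apply, hP', hβ]
      abel
    have hαe : α n = α' n := by
      have h1 := hgram R R
      rw [hR, hR', inner_smul_left, inner_smul_right, inner_smul_left, inner_smul_right, hself',
        Complex.conj_ofReal, Complex.conj_ofReal] at h1
      have h2 : α n * α n = α' n * α' n := by
        have h3 : (α n : ℂ) * α n = α' n * α' n := by simpa using h1
        exact_mod_cast h3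
      exact (mul_self_inj (hα n).le (hα' n).le).1 h2
    have hne : (α n : ℂ) ≠ 0 := by exact_mod_cast (hα n).ne'
    refine ⟨⟨hαe, hβ⟩, C ((α n : ℂ)⁻¹) * R, ?_, ?_⟩
    · rw [aeval_C_mul_apply, hR, smul_smul, inv_mul_cancel₀ hne, one_smul]
    · rw [aeval_C_mul_apply, hR', ← hαe, smul_smul, inv_mul_cancel₀ hne, one_smul]
  have hall : ∀ n, (α n = α' n ∧ β n = β' n) ∧
      (∃ P : ℂ[X], aeval X P (v 0) = v n ∧ aeval X' P (v 0) = v n) ∧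
      ∃ R : ℂ[X], aeval X R (v 0) = v (n + 1) ∧ aeval X' R (v 0) = v (n + 1) := by
    intro n
    induction n with
    | zero =>
      have h1 := hstep 0 0 1 0 (by simp) (by simp) (by simp) (by simp) (by simp)
        (by simpa using hX0) (by simpa using hX0')
      exact ⟨h1.1, ⟨1, by simp, by simp⟩, h1.2⟩
    | succ n ih =>
      obtain ⟨⟨h1, -⟩, ⟨P, hP, hP'⟩, R, hR, hR'⟩ := ih
      have hQ : ∀ {Y : H →L[ℂ] H}, aeval Y P (v 0) = v n →
          aeval Y (C (α n : ℂ) * P) (v 0) = (α n : ℂ) • v n := fun {Y} hY => by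
        rw [aeval_C_mul_apply, hY]
      have h2 := hstep (n + 1) ((α n : ℂ) • v n) R (C (α n : ℂ) * P) hR hR' (hQ hP) (hQ hP')
        (by rw [inner_smul_right, hv.2 (Nat.succ_ne_self n), mul_zero]) (hXs n)
        (by rw [h1]; exact hXs' n)
      exact ⟨h2.1, ⟨R, hR, hR'⟩, h2.2⟩
  exact (hall n).1

/-- Orthonormalizing the powers of an operator that raises an orthonormal system by one step. -/
theorem gramSchmidtNormed_pow {X : H →L[ℂ] H} {v : ℕ → H} (hv : Orthonormal ℂ v)
    {α : ℕ → ℝ} (hα : ∀ n, 0 < α n)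
    (hX : ∀ n, X (v n) - (α n : ℂ) • v (n + 1) ∈ Submodule.span ℂ (v '' Set.Iic n)) (n : ℕ) :
    InnerProductSpace.gramSchmidtNormed ℂ (fun i : ℕ => (X ^ i) (v 0)) n = v n := by
  have hmap : ∀ n, ∀ u ∈ Submodule.span ℂ (v '' Set.Iio n),
      X u ∈ Submodule.span ℂ (v '' Set.Iic n) := by
    intro n u hu
    induction hu using Submodule.span_induction with
    | mem u hu =>
      obtain ⟨i, hi, rfl⟩ := hu
      have hi' : i < n := hi
      rw [← sub_add_cancel (X (v i)) ((α i : ℂ) • v (i + 1))]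
      refine add_mem (Submodule.span_mono (Set.image_mono (Set.Iic_subset_Iic.2 hi'.le)) (hX i))
        (Submodule.smul_mem _ _ (Submodule.subset_span ⟨i + 1, hi', rfl⟩))
    | zero => simp
    | add a b _ _ ha hb => rw [map_add]; exact add_mem ha hb
    | smul a b _ hb => rw [map_smul]; exact Submodule.smul_mem _ _ hb
  -- The leading coefficients are products of the `α`, hence positive; this removes the phase
  -- ambiguity in the orthonormalization.
  have hlead : ∀ n, ∃ r : ℝ, 0 < r ∧
      (X ^ n) (v 0) - (r : ℂ) • v n ∈ Submodule.span ℂ (v '' Set.Iio n) := by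
    intro n
    induction n with
    | zero => exact ⟨1, one_pos, by simp⟩
    | succ n ih =>
      obtain ⟨r, hr, hu⟩ := ih
      refine ⟨r * α n, mul_pos hr (hα n), ?_⟩
      have hI : Set.Iio (n + 1) = Set.Iic n := by ext; simp
      have h1 := add_mem (hmap n _ hu) (Submodule.smul_mem _ (r : ℂ) (hX n))
      rw [hI]
      convert h1 using 1
      rw [pow_succ', mul_apply_eq_comp, map_sub, map_smul, smul_sub, smul_smul]
      push_cast; abel
  choose r hr hlead using hlead
  have hmain : ∀ n, InnerProductSpace.gramSchmidt ℂ (fun i : ℕ => (X ^ i) (v 0)) n =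
      (r n : ℂ) • v n := by
    intro n
    induction n using Nat.strong_induction_on with
    | _ n ih =>
      set f := fun i : ℕ => (X ^ i) (v 0)
      set w := InnerProductSpace.gramSchmidt ℂ f n - (r n : ℂ) • v n with hw
      have h1 : w ∈ Submodule.span ℂ (v '' Set.Iio n) := by
        have h2 := InnerProductSpace.gramSchmidt_def'' ℂ f n
        have h3 : w = (f n - (r n : ℂ) • v n) - ∑ i ∈ Finset.Iio n,
            (⟪InnerProductSpace.gramSchmidt ℂ f i, f n⟫_ℂ /
              (‖InnerProductSpace.gramSchmidt ℂ f i‖ : ℂ) ^ 2) •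
              InnerProductSpace.gramSchmidt ℂ f i := by
          rw [hw, eq_sub_of_add_eq h2.symm]; simp only [RCLike.ofReal_eq_complex_ofReal]; abel
        rw [h3]
        refine sub_mem (hlead n) (Submodule.sum_mem _ fun i hi => Submodule.smul_mem _ _ ?_)
        rw [ih i (Finset.mem_Iio.1 hi)]
        exact Submodule.smul_mem _ _ (Submodule.subset_span ⟨i, Finset.mem_Iio.1 hi, rfl⟩)
      have h4 : ∀ i < n, inner ℂ (v i) w = 0 := by
        intro i hi
        have h5 := InnerProductSpace.gramSchmidt_orthogonal ℂ f hi.ne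
        rw [ih i hi, inner_smul_left, mul_eq_zero] at h5
        have h6 : inner ℂ (v i) (InnerProductSpace.gramSchmidt ℂ f n) = 0 :=
          h5.resolve_left (by simpa using (hr i).ne')
        rw [hw, inner_sub_right, h6, inner_smul_right, hv.2 hi.ne]; simp
      have h7 : ∀ y ∈ Submodule.span ℂ (v '' Set.Iio n), inner ℂ y w = 0 := by
        intro y hy
        induction hy using Submodule.span_induction with
        | mem y hy => obtain ⟨i, hi, rfl⟩ := hy; exact h4 i hi
        | zero => simp
        | add a b _ _ ha hb => rw [inner_add_left, ha, hb, add_zero]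
        | smul a b _ hb => rw [inner_smul_left, hb, mul_zero]
      -- The difference lies in the span of the earlier vectors and is orthogonal to it.
      exact sub_eq_zero.1 (inner_self_eq_zero.1 (h7 w h1))
  have hn : ‖(r n : ℂ) • v n‖ = r n := by
    rw [norm_smul, hv.1]; simp [abs_of_pos (hr n)]
  rw [InnerProductSpace.gramSchmidtNormed, hmain, hn, smul_smul]
  have : (r n : ℂ) ≠ 0 := by exact_mod_cast (hr n).ne'
  simp [this]

end Moments

end GMP

namespace GMP

open scoped ComplexConjugate

/-! ### Compressions -/

theorem starProjection_apply_coord (s : Set ℤ) [DecidablePred (· ∈ s)] (x : L2) (i : ℤ) :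
    (l2On s).starProjection x i = if i ∈ s then x i else 0 := by
  split_ifs with hi
  · have h1 := (l2On s).sub_starProjection_mem_orthogonal x
    have h2 := (Submodule.mem_orthogonal _ _).1 h1 _ (e_mem_l2On hi)
    rw [inner_sub_right, inner_e, inner_e, sub_eq_zero] at h2
    exact h2.symm
  · exact mem_l2On.1 ((l2On s).starProjection_apply_mem x) i hi

theorem starProjection_e_of_mem {s : Set ℤ} {n : ℤ} (hn : n ∈ s) :
    (l2On s).starProjection (e n) = e n :=
  Submodule.starProjection_eq_self_iff.2 (e_mem_l2On hn)

theorem starProjection_e_of_notMem {s : Set ℤ} {n : ℤ} (hn : n ∉ s) :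
    (l2On s).starProjection (e n) = 0 := by
  classical
  ext i
  rw [starProjection_apply_coord, e_apply]
  split_ifs with h1 h2
  · exact absurd (h2 ▸ h1) hn
  · rfl
  · rfl

/-- The restriction of a unitary operator to an invariant subspace. -/
noncomputable def restrictIsometry {K : Submodule ℂ L2} (U : L2 ≃ₗᵢ[ℂ] L2) (hU : ∀ x ∈ K, U x ∈ K) : K →ₗᵢ[ℂ] K where
  toLinearMap := U.toLinearEquiv.toLinearMap.restrict hU
  norm_map' x := U.norm_map x

theorem coe_restrictIsometry {K : Submodule ℂ L2} (U : L2 ≃ₗᵢ[ℂ] L2) (hU : ∀ x ∈ K, U x ∈ K) (x : K) :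
    (restrictIsometry U hU x : L2) = U x := rfl

section Compress

variable {K : Submodule ℂ L2} [K.HasOrthogonalProjection] {T T' : L2 →L[ℂ] L2}

theorem coe_compress (x : K) : (compress K T x : L2) = K.starProjection (T x) := rfl

theorem isSelfAdjoint_compress [CompleteSpace K] (hT : IsRealSymm T) :
    IsSelfAdjoint (compress K T) := by
  rw [ContinuousLinearMap.isSelfAdjoint_iff_isSymmetric]
  intro x y
  change inner ℂ (K.starProjection (T x)) (y : L2) = inner ℂ (x : L2) (K.starProjection (T y))
  have h1 := (Submodule.mem_orthogonal' _ _).1 (K.sub_starProjection_mem_orthogonal (T x)) y y.2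
  have h2 := (Submodule.mem_orthogonal _ _).1 (K.sub_starProjection_mem_orthogonal (T y)) x x.2
  rw [inner_sub_left, sub_eq_zero] at h1
  rw [inner_sub_right, sub_eq_zero] at h2
  rw [← h1, ← h2, hT.symm]

variable {U : L2 ≃ₗᵢ[ℂ] L2}

theorem starProjection_unitary (hU : ∀ x, U x ∈ K ↔ x ∈ K) (x : L2) : K.starProjection (U x) = U (K.starProjection x) := by
  refine Submodule.eq_starProjection_of_mem_of_inner_eq_zero
    ((hU _).2 (K.starProjection_apply_mem x)) fun w hw => ?_
  have h1 : U (U.symm w) = w := U.apply_symm_apply w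
  rw [← map_sub, ← h1, U.inner_map_map]
  exact K.starProjection_inner_eq_zero x _ ((hU _).1 (by rwa [h1]))

theorem compress_restrictIsometry (hU : ∀ x, U x ∈ K ↔ x ∈ K)
    (hT : ∀ x, U (T x) = T' (U x)) (x : K) :
    compress K T' (restrictIsometry U (fun y hy => (hU y).2 hy) x) =
      restrictIsometry U (fun y hy => (hU y).2 hy) (compress K T x) := by
  apply Subtype.ext
  rw [coe_compress, coe_restrictIsometry, coe_restrictIsometry, coe_compress, ← hT,
    starProjection_unitary hU]

theorem weyl_restrictIsometry [CompleteSpace K] (hU : ∀ x, U x ∈ K ↔ x ∈ K)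
    (hT : ∀ x, U (T x) = T' (U x)) (hS : IsRealSymm T)
    (hS' : IsRealSymm T') (x : K) {z : ℂ} (hz : z.im ≠ 0) :
    weyl K T' (restrictIsometry U (fun y hy => (hU y).2 hy) x) z = weyl K T x z := by
  set V := restrictIsometry U (fun y hy => (hU y).2 hy)
  have hu := isUnit_sub_algebraMap (isSelfAdjoint_compress (K := K) hS) hz
  have hu' := isUnit_sub_algebraMap (isSelfAdjoint_compress (K := K) hS') hz
  set y := Ring.inverse (compress K T - algebraMap ℂ (K →L[ℂ] K) z) x with hy
  have h1 : compress K T y = x + z • y := apply_inverse_sub hu x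
  have h2 : Ring.inverse (compress K T' - algebraMap ℂ (K →L[ℂ] K) z) (V x) = V y := by
    have h3 : V x = (compress K T' - algebraMap ℂ (K →L[ℂ] K) z) (V y) := by
      change V x = compress K T' (V y) - z • V y
      rw [compress_restrictIsometry hU hT, h1, map_add, map_smul, add_sub_cancel_right]
    rw [h3, ← mul_apply_eq_comp, Ring.inverse_mul_cancel _ hu']; rfl
  rw [weyl, weyl, h2, V.inner_map_map]

end Compress

/-! ### One-sided Jacobi matrices -/

/-- `e_0, e_1, …` as elements of `ℓ²₊`. -/
noncomputable def basisPos (n : ℕ) : l2Pos := ⟨e n, e_mem_l2On (by simp)⟩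

/-- `e_{-1}, e_{-2}, …` as elements of `ℓ²₋`. -/
noncomputable def basisNeg (n : ℕ) : l2Neg := ⟨e (-1 - n), e_mem_l2On (by simp; omega)⟩

theorem orthonormal_basisPos : Orthonormal ℂ basisPos := by
  have h : Orthonormal ℂ fun n : ℕ => e (n : ℤ) := orthonormal_e.comp _ Nat.cast_injective
  exact (l2Pos.subtypeₗᵢ.orthonormal_comp_iff).1 h

theorem orthonormal_basisNeg : Orthonormal ℂ basisNeg := by
  have h : Orthonormal ℂ fun n : ℕ => e (-1 - (n : ℤ)) :=
    orthonormal_e.comp (fun n : ℕ => -1 - (n : ℤ)) fun a b h => by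
      simpa using h
  exact (l2Neg.subtypeₗᵢ.orthonormal_comp_iff).1 h

theorem basisNeg_zero : basisNeg 0 = eNeg := Subtype.ext (congrArg e (by norm_num))

namespace JacobiMatrix

variable (J : JacobiMatrix)

theorem entry_op (i l : ℤ) : entry J.op i l =
    (J.a l : ℂ) * (if i = l - 1 then 1 else 0) + (J.b l : ℂ) * (if i = l then 1 else 0) +
      (J.a (l + 1) : ℂ) * (if i = l + 1 then 1 else 0) := by
  rw [entry, J.op_e]
  simp only [inner_add_right, inner_smul_right, inner_e, e_apply]

theorem isRealSymm : IsRealSymm J.op := by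
  refine isRealSymm_of_entry (fun i l => ?_) fun i l => ?_
  · rw [entry_op, entry_op]
    obtain h | h | h | h : i = l ∨ i = l - 1 ∨ i = l + 1 ∨
      (i ≠ l ∧ i ≠ l - 1 ∧ i ≠ l + 1) := by omega
    · subst h; rfl
    · subst h
      simp [show l ≠ l - 1 - 1 by omega, show l - 1 ≠ l + 1 by omega, show l ≠ l - 1 by omega]
    · subst h
      simp [show l ≠ l + 1 + 1 by omega, show l + 1 ≠ l - 1 by omega]
    · simp [h.1, h.2.1, h.2.2, show l ≠ i - 1 by omega, show l ≠ i by omega,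
        show l ≠ i + 1 by omega]
  · rw [entry_op]
    simp only [map_add, map_mul, Complex.conj_ofReal, apply_ite conj, map_one, map_zero]

theorem ext_coeff {J J' : JacobiMatrix} (ha : J.a = J'.a) (hb : J.b = J'.b) : J = J' := by
  have hop : J.op = J'.op := clm_ext_e fun n => by rw [J.op_e, J'.op_e, ha, hb]
  cases J; cases J'; simp_all

theorem compress_basisPos_zero : compress l2Pos J.op (basisPos 0) =
    (J.b 0 : ℂ) • basisPos 0 + (J.a 1 : ℂ) • basisPos 1 := by
  apply Subtype.ext
  change l2Pos.starProjection (J.op (e 0)) = (J.b 0 : ℂ) • e 0 + (J.a 1 : ℂ) • e 1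
  rw [J.op_e, map_add, map_add, map_smul, map_smul, map_smul, starProjection_e_of_notMem (by simp),
    starProjection_e_of_mem (by simp), starProjection_e_of_mem (by simp)]
  simp

theorem compress_basisPos_succ (n : ℕ) : compress l2Pos J.op (basisPos (n + 1)) =
    (J.a (n + 1) : ℂ) • basisPos n + (J.b ((n + 1 : ℕ) : ℤ) : ℂ) • basisPos (n + 1) +
      (J.a ((n + 1 : ℕ) + 1) : ℂ) • basisPos (n + 2) := by
  apply Subtype.ext
  change l2Pos.starProjection (J.op (e ((n + 1 : ℕ) : ℤ))) = (J.a (n + 1) : ℂ) • e (n : ℤ) +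
    (J.b ((n + 1 : ℕ) : ℤ) : ℂ) • e ((n + 1 : ℕ) : ℤ) +
      (J.a ((n + 1 : ℕ) + 1) : ℂ) • e ((n + 2 : ℕ) : ℤ)
  rw [J.op_e, map_add, map_add, map_smul, map_smul, map_smul,
    starProjection_e_of_mem (by simp), starProjection_e_of_mem (by simp; omega),
    starProjection_e_of_mem (by simp; omega)]
  push_cast
  rw [add_sub_cancel_right, show (n : ℤ) + 1 + 1 = n + 2 by ring]

theorem compress_basisNeg_zero : compress l2Neg J.op (basisNeg 0) =
    (J.b (-1) : ℂ) • basisNeg 0 + (J.a (-1) : ℂ) • basisNeg 1 := by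
  apply Subtype.ext
  change l2Neg.starProjection (J.op (e (-1 - ((0 : ℕ) : ℤ)))) =
    (J.b (-1) : ℂ) • e (-1 - ((0 : ℕ) : ℤ)) + (J.a (-1) : ℂ) • e (-1 - ((1 : ℕ) : ℤ))
  rw [J.op_e, map_add, map_add, map_smul, map_smul, map_smul, starProjection_e_of_mem (by simp),
    starProjection_e_of_mem (by simp), starProjection_e_of_notMem (by simp)]
  simp [add_comm]

theorem compress_basisNeg_succ (n : ℕ) : compress l2Neg J.op (basisNeg (n + 1)) =
    (J.a (-1 - n) : ℂ) • basisNeg n + (J.b (-1 - (n + 1 : ℕ)) : ℂ) • basisNeg (n + 1) +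
      (J.a (-1 - (n + 1 : ℕ)) : ℂ) • basisNeg (n + 2) := by
  apply Subtype.ext
  change l2Neg.starProjection (J.op (e (-1 - ((n + 1 : ℕ) : ℤ)))) =
    (J.a (-1 - n) : ℂ) • e (-1 - (n : ℤ)) +
      (J.b (-1 - (n + 1 : ℕ)) : ℂ) • e (-1 - ((n + 1 : ℕ) : ℤ)) +
      (J.a (-1 - (n + 1 : ℕ)) : ℂ) • e (-1 - ((n + 2 : ℕ) : ℤ))
  rw [J.op_e, map_add, map_add, map_smul, map_smul, map_smul,
    starProjection_e_of_mem (by simp only [Set.mem_Iio]; omega),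
    starProjection_e_of_mem (by simp only [Set.mem_Iio]; omega),
    starProjection_e_of_mem (by simp only [Set.mem_Iio]; omega)]
  push_cast
  rw [show (-1 : ℤ) - (n + 1) + 1 = -1 - n by ring,
    show (-1 : ℤ) - (n + 1) - 1 = -1 - (n + 2) by ring]
  abel

/-- The half-line `ℓ²₊` gives `b(n)` for `n ≥ 0` and `a(n)` for `n ≥ 1`; `ℓ²₋` gives both for `n ≤
-1`. Only `a(0)`, which couples the halves, is seen by neither. -/
theorem eq_of_weyl_eq {J J' : JacobiMatrix} (h0 : J.a 0 = J'.a 0)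
    (hpos : ∀ z : ℂ, z.im ≠ 0 → weyl l2Pos J.op ePos z = weyl l2Pos J'.op ePos z)
    (hneg : ∀ z : ℂ, z.im ≠ 0 → weyl l2Neg J.op eNeg z = weyl l2Neg J'.op eNeg z) : J = J' := by
  have sa : ∀ (s : Set ℤ) (J : JacobiMatrix), IsSelfAdjoint (compress (l2On s) J.op) :=
    fun s J => isSelfAdjoint_compress J.isRealSymm
  have h1 := jacobi_coeff_eq (sa _ J) (sa _ J') orthonormal_basisPos
    (inner_pow_eq_of_resolvent_eq (sa _ J) (sa _ J') (x := ePos) hpos)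
    (α := fun n => J.a (n + 1)) (α' := fun n => J'.a (n + 1)) (β := fun n => J.b n)
    (β' := fun n => J'.b n) (fun _ => J.a_pos _) (fun _ => J'.a_pos _)
    (by simpa using J.compress_basisPos_zero) (by simpa using J'.compress_basisPos_zero)
    J.compress_basisPos_succ J'.compress_basisPos_succ
  rw [← basisNeg_zero] at hneg
  have h2 := jacobi_coeff_eq (sa _ J) (sa _ J') orthonormal_basisNeg
    (inner_pow_eq_of_resolvent_eq (sa _ J) (sa _ J') (x := basisNeg 0) hneg)
    (α := fun n => J.a (-1 - n)) (α' := fun n => J'.a (-1 - n)) (β := fun n => J.b (-1 - n))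
    (β' := fun n => J'.b (-1 - n)) (fun _ => J.a_pos _) (fun _ => J'.a_pos _)
    (by simpa using J.compress_basisNeg_zero) (by simpa using J'.compress_basisNeg_zero)
    J.compress_basisNeg_succ J'.compress_basisNeg_succ
  refine ext_coeff (funext fun n => ?_) (funext fun n => ?_)
  · obtain h | h | h : n = 0 ∨ 0 < n ∨ n < 0 := by omega
    · rw [h, h0]
    · have := (h1 (n - 1).toNat).1
      rwa [show (((n - 1).toNat : ℕ) : ℤ) + 1 = n by omega] at this
    · have := (h2 (-1 - n).toNat).1
      rwa [show -1 - (((-1 - n).toNat : ℕ) : ℤ) = n by omega] at this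
  · obtain h | h : 0 ≤ n ∨ n < 0 := by omega
    · have := (h1 n.toNat).2
      rwa [show ((n.toNat : ℕ) : ℤ) = n by omega] at this
    · have := (h2 (-1 - n).toNat).2
      rwa [show -1 - (((-1 - n).toNat : ℕ) : ℤ) = n by omega] at this

end JacobiMatrix

end GMP

namespace GMP

open scoped ComplexConjugate

variable {g : ℕ} {c : Fin g → ℝ}

/-! ### Intertwining unitary operators -/

/-- `U` is a unitary equivalence of `T` and `T'` that fixes `e_{-1}` and preserves the
decomposition of `ℓ²` into `ℓ²₋` and `ℓ²₊`. -/
structure IsIntertwiner (U : L2 ≃ₗᵢ[ℂ] L2) (T T' : L2 →L[ℂ] L2) : Prop where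
  map : ∀ x, U (T x) = T' (U x)
  neg_one : U (e (-1)) = e (-1)
  mem_neg : ∀ x, U x ∈ l2Neg ↔ x ∈ l2Neg

namespace IsIntertwiner

variable {U V : L2 ≃ₗᵢ[ℂ] L2} {T T' T'' : L2 →L[ℂ] L2}

theorem symm (h : IsIntertwiner U T T') : IsIntertwiner U.symm T' T where
  map x := by
    apply U.injective
    rw [U.apply_symm_apply, h.map, U.apply_symm_apply]
  neg_one := by
    apply U.injective
    rw [U.apply_symm_apply, h.neg_one]
  mem_neg x := by rw [← h.mem_neg, U.apply_symm_apply]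

theorem trans (h : IsIntertwiner U T T') (h' : IsIntertwiner V T' T'') :
    IsIntertwiner (U.trans V) T T'' where
  map x := by simp only [LinearIsometryEquiv.trans_apply, h.map, h'.map]
  neg_one := by simp only [LinearIsometryEquiv.trans_apply, h.neg_one, h'.neg_one]
  mem_neg x := by simp only [LinearIsometryEquiv.trans_apply, h.mem_neg, h'.mem_neg]

theorem mem_pos_of_mem (h : IsIntertwiner U T T') {x : L2} (hx : x ∈ l2Pos) : U x ∈ l2Pos :=
  mem_above_of_orthogonal (n := 0) fun y hy => by
    rw [← U.apply_symm_apply y, U.inner_map_map]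
    exact inner_eq_zero_of_below_above (n := 0) ((h.symm.mem_neg y).2 hy) hx

theorem mem_pos (h : IsIntertwiner U T T') (x : L2) : U x ∈ l2Pos ↔ x ∈ l2Pos :=
  ⟨fun hx => by simpa using h.symm.mem_pos_of_mem hx, h.mem_pos_of_mem⟩

theorem isUnit_den (h : IsIntertwiner U T T') {o : Option ℝ} (ho : IsUnit (den T o)) :
    IsUnit (den T' o) := by
  cases o with
  | none => exact isUnit_one
  | some t =>
    have hd : ∀ x, U (den T (some t) x) = den T' (some t) (U x) := fun x => by
      change U ((t : ℂ) • x - T x) = (t : ℂ) • U x - T' (U x)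
      rw [map_sub, map_smul, h.map]
    let R : L2 →L[ℂ] L2 := U.toContinuousLinearEquiv.toContinuousLinearMap ∘L
      Ring.inverse (den T (some t)) ∘L U.symm.toContinuousLinearEquiv.toContinuousLinearMap
    refine ⟨⟨den T' (some t), R, ?_, ?_⟩, rfl⟩
    · ext1 x
      change den T' (some t) (U (Ring.inverse (den T (some t)) (U.symm x))) = x
      rw [← hd, self_apply_inverse ho, U.apply_symm_apply]
    · ext1 x
      change U (Ring.inverse (den T (some t)) (U.symm (den T' (some t) x))) = x
      rw [← U.apply_symm_apply x, ← hd, U.symm_apply_apply, inverse_apply_self ho]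

theorem map_res (h : IsIntertwiner U T T') {o : Option ℝ} (ho : IsUnit (den T o)) (x : L2) :
    U (res T o x) = res T' o (U x) := by
  cases o with
  | none => exact h.map x
  | some t =>
    apply injective_of_isUnit (h.isUnit_den ho)
    have h1 : den T' (some t) (res T' (some t) (U x)) = U x :=
      self_apply_inverse (h.isUnit_den ho) _
    have h2 : den T (some t) (res T (some t) x) = x := self_apply_inverse ho _
    rw [h1]
    nth_rewrite 2 [← h2]
    change (t : ℂ) • U (res T (some t) x) - T' (U (res T (some t) x)) =
      U ((t : ℂ) • res T (some t) x - T (res T (some t) x))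
    rw [map_sub, map_smul, h.map]

end IsIntertwiner

/-! ### From unitary equivalence to the transform -/

/-- Column `-1` is the last column of its block, and its part in `ℓ²₊` is `∑ p_m e_m` with the
coefficients of block `0`. -/
theorem GMPMatrix.normP_sq (A : GMPMatrix c) :
    ‖l2Pos.starProjection (A.op (e (-1)))‖ ^ 2 = A.normP ^ 2 := by
  classical
  have h1 : l2Pos.starProjection (A.op (e (-1))) =
      ∑ m : Fin (g + 1), (A.p 0 m : ℂ) • e ((m : ℕ) : ℤ) := by
    ext i
    have hsum : (∑ m : Fin (g + 1), (A.p 0 m : ℂ) • e ((m : ℕ) : ℤ)) i =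
        ∑ m : Fin (g + 1), (A.p 0 m : ℂ) * if i = ((m : ℕ) : ℤ) then 1 else 0 := by
      rw [← inner_e, inner_sum]
      simp only [inner_smul_right, inner_e, e_apply]
    rw [starProjection_apply_coord, hsum]
    split_ifs with hi
    · have hi : 0 ≤ i := hi
      by_cases hig : i < (g : ℤ) + 1
      · obtain ⟨m, rfl⟩ : ∃ m : Fin (g + 1), i = ((m : ℕ) : ℤ) :=
          ⟨⟨i.toNat, by omega⟩, by simp [hi]⟩
        rw [Finset.sum_eq_single m]
        · have := A.isClassAt.entry_column 0 m
          rw [entry_eq] at this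
          simpa using this
        · intro b _ hb
          have : ((m : ℕ) : ℤ) ≠ ((b : ℕ) : ℤ) := fun h => hb (Fin.ext (by exact_mod_cast h.symm))
          rw [if_neg this, mul_zero]
        · simp
      · have h2 := A.isClassAt.entry_column_eq_zero 0 (i := i) (by linarith)
        rw [entry_eq] at h2
        rw [Finset.sum_eq_zero]
        · simpa using h2
        · intro m _
          have := m.2
          rw [if_neg (by omega), mul_zero]
    · have hi : ¬ 0 ≤ i := hi
      refine (Finset.sum_eq_zero fun m _ => ?_).symm
      rw [if_neg (by omega), mul_zero]
  have horth : Orthonormal ℂ fun m : Fin (g + 1) => e ((m : ℕ) : ℤ) :=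
    orthonormal_e.comp _ fun a b h => Fin.ext (by exact_mod_cast h)
  have h2 : ((‖l2Pos.starProjection (A.op (e (-1)))‖ ^ 2 : ℝ) : ℂ) =
      ((∑ m, A.p 0 m ^ 2 : ℝ) : ℂ) := by
    have h3 := inner_self_eq_norm_sq_to_K (𝕜 := ℂ) (l2Pos.starProjection (A.op (e (-1))))
    rw [Complex.ofReal_pow]
    refine h3.symm.trans ?_
    rw [h1, horth.inner_sum]
    push_cast
    exact Finset.sum_congr rfl fun m _ => by rw [Complex.conj_ofReal, sq]
  rw [GMPMatrix.normP, Real.sq_sqrt (Finset.sum_nonneg fun m _ => sq_nonneg _)]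
  exact_mod_cast h2

namespace IsIntertwiner

variable {A : GMPMatrix c} {J : JacobiMatrix} {U : L2 ≃ₗᵢ[ℂ] L2}

theorem starProjection_op (h : IsIntertwiner U J.op A.op) :
    l2Pos.starProjection (A.op (e (-1))) = (J.a 0 : ℂ) • U (e 0) := by
  have h1 : l2Pos.starProjection (J.op (e (-1))) = (J.a 0 : ℂ) • e 0 := by
    rw [J.op_e, map_add, map_add, map_smul, map_smul, map_smul,
      starProjection_e_of_notMem (by simp), starProjection_e_of_notMem (by simp),
      starProjection_e_of_mem (by simp)]
    simp
  rw [← h.neg_one, ← h.map, starProjection_unitary h.mem_pos, h1, map_smul]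

theorem normP_eq (h : IsIntertwiner U J.op A.op) : J.a 0 = A.normP := by
  have h1 := A.normP_sq
  rw [h.starProjection_op, norm_smul, U.norm_map, orthonormal_e.1, mul_one, Complex.norm_real,
    Real.norm_eq_abs, sq_abs] at h1
  exact (pow_left_inj₀ (J.a_pos 0).le (Real.sqrt_nonneg _) two_ne_zero).1 h1

theorem tildeZero_eq (h : IsIntertwiner U J.op A.op) :
    A.tildeZero = restrictIsometry U (fun y hy => (h.mem_pos y).2 hy) ePos := by
  apply Subtype.ext
  change ((A.normP⁻¹ : ℝ) : ℂ) • l2Pos.starProjection (A.op (e (-1))) = U (e 0)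
  have : ((J.a 0 : ℝ) : ℂ) ≠ 0 := by exact_mod_cast (J.a_pos 0).ne'
  rw [h.starProjection_op, ← h.normP_eq, smul_smul]
  push_cast
  rw [inv_mul_cancel₀ this, one_smul]

theorem eNeg_eq (h : IsIntertwiner U J.op A.op) :
    eNeg = restrictIsometry U (fun y hy => (h.mem_neg y).2 hy) eNeg :=
  Subtype.ext h.neg_one.symm

theorem isTransform (h : IsIntertwiner U J.op A.op) : IsTransform A J := by
  refine ⟨fun z hz => ⟨?_, ?_⟩, h.normP_eq⟩
  · rw [h.tildeZero_eq]
    exact (weyl_restrictIsometry h.mem_pos h.map J.isRealSymm A.isRealSymm _ hz).symm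
  · nth_rewrite 2 [h.eNeg_eq]
    exact (weyl_restrictIsometry h.mem_neg h.map J.isRealSymm A.isRealSymm _ hz).symm

/-- On each half-line the vectors `U (e n)` are orthonormal, start at the prescribed vector, and see
the compression of `A` as a Jacobi matrix with positive off-diagonal entries. Gram–Schmidt therefore
returns them unchanged. -/
theorem tildeE_eq (h : IsIntertwiner U J.op A.op) (n : ℤ) : U (e n) = A.tildeE n := by
  match n with
  | Int.ofNat n =>
    set V := restrictIsometry U (fun y hy => (h.mem_pos y).2 hy) with hV
    have hlow : ∀ n, compress l2Pos A.op (V (basisPos n)) -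
        (J.a (n + 1) : ℂ) • V (basisPos (n + 1)) ∈
          Submodule.span ℂ ((fun i => V (basisPos i)) '' Set.Iic n) := by
      intro n
      rw [hV, compress_restrictIsometry h.mem_pos h.map, ← hV]
      cases n with
      | zero =>
        rw [J.compress_basisPos_zero, map_add, map_smul, map_smul]
        simp only [Nat.cast_zero, zero_add, add_sub_cancel_right]
        exact Submodule.smul_mem _ _ (Submodule.subset_span ⟨0, by simp, rfl⟩)
      | succ n =>
        rw [J.compress_basisPos_succ, map_add, map_add, map_smul, map_smul, map_smul]
        simp only [add_sub_cancel_right]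
        exact add_mem (Submodule.smul_mem _ _ (Submodule.subset_span ⟨n, by simp, rfl⟩))
          (Submodule.smul_mem _ _ (Submodule.subset_span ⟨n + 1, by simp, rfl⟩))
    have h1 := gramSchmidtNormed_pow (X := compress l2Pos A.op)
      (orthonormal_basisPos.comp_linearIsometry V) (α := fun n => J.a (n + 1))
      (fun _ => J.a_pos _) hlow n
    have h2 : A.tildeZero = V (basisPos 0) := h.tildeZero_eq
    change _ = krylov l2Pos A.op A.tildeZero n
    rw [krylov, h2]
    exact (congrArg Subtype.val h1).symm
  | Int.negSucc n =>
    set V := restrictIsometry U (fun y hy => (h.mem_neg y).2 hy) with hV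
    have hlow : ∀ n, compress l2Neg A.op (V (basisNeg n)) -
        (J.a (-1 - n) : ℂ) • V (basisNeg (n + 1)) ∈
          Submodule.span ℂ ((fun i => V (basisNeg i)) '' Set.Iic n) := by
      intro n
      rw [hV, compress_restrictIsometry h.mem_neg h.map, ← hV]
      cases n with
      | zero =>
        rw [J.compress_basisNeg_zero, map_add, map_smul, map_smul]
        simp only [Nat.cast_zero, zero_add, sub_zero, add_sub_cancel_right]
        exact Submodule.smul_mem _ _ (Submodule.subset_span ⟨0, by simp, rfl⟩)
      | succ n =>
        rw [J.compress_basisNeg_succ, map_add, map_add, map_smul, map_smul, map_smul]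
        simp only [add_sub_cancel_right]
        exact add_mem (Submodule.smul_mem _ _ (Submodule.subset_span ⟨n, by simp, rfl⟩))
          (Submodule.smul_mem _ _ (Submodule.subset_span ⟨n + 1, by simp, rfl⟩))
    have h1 := gramSchmidtNormed_pow (X := compress l2Neg A.op)
      (orthonormal_basisNeg.comp_linearIsometry V) (α := fun n => J.a (-1 - n))
      (fun _ => J.a_pos _) hlow n
    have h2 : eNeg = V (basisNeg 0) := by rw [basisNeg_zero]; exact h.eNeg_eq
    change _ = krylov l2Neg A.op eNeg n
    rw [krylov, h2]
    refine Eq.trans ?_ (congrArg Subtype.val h1).symm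
    change _ = U (e (-1 - (n : ℤ)))
    congr 2
    rw [Int.negSucc_eq]; ring

theorem isUnitaryConjugate (h : IsIntertwiner U J.op A.op) : IsUnitaryConjugate A J :=
  ⟨U, h.tildeE_eq, fun x => by rw [← h.map, U.symm_apply_apply]⟩

end IsIntertwiner

theorem IsTransform.unique {A : GMPMatrix c} {J J' : JacobiMatrix} (h : IsTransform A J)
    (h' : IsTransform A J') : J = J' :=
  JacobiMatrix.eq_of_weyl_eq (h.2.trans h'.2.symm)
    (fun z hz => (h.1 z hz).1.trans (h'.1 z hz).1.symm)
    (fun z hz => (h.1 z hz).2.trans (h'.1 z hz).2.symm)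

end GMP

namespace GMP

open scoped ComplexConjugate

variable {g : ℕ} {c : Fin g → ℝ}

/-! ### Sign equivalence -/

section SignEquiv

variable {A A' : GMPMatrix c} {G : L2 ≃ₗᵢ[ℂ] L2}

namespace IsIntertwiner

theorem map_stepOp (h : IsIntertwiner G A.op A'.op) (n : ℤ) (x : L2) :
    G (A.stepOp n x) = A'.stepOp n (G x) := h.map_res (A.isUnit_den n) x

/-- The flag above `ℓ²₋` is generated by the operators `stepOp n`, which `G` intertwines. The
members below `ℓ²₋` are reached through the complementary spaces `above`. -/
theorem map_below_nat (h : IsIntertwiner G A.op A'.op) (n : ℕ) :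
    ∀ x ∈ below n, G x ∈ below n := by
  induction n with
  | zero => exact fun x hx => (h.mem_neg x).2 hx
  | succ n ih =>
    intro x hx
    push_cast at hx ⊢
    obtain ⟨y, hy, y', hy', rfl⟩ := A.exists_below_succ hx
    rw [map_add, h.map_stepOp]
    exact add_mem (below_mono (by omega) (ih y hy)) (A'.stepOp_below (ih y' hy'))

theorem map_above_neg_nat (h : IsIntertwiner G A.op A'.op) (n : ℕ) :
    ∀ x ∈ above (-n), G x ∈ above (-n) := by
  induction n with
  | zero => simpa using fun x hx => (h.mem_pos x).2 hx
  | succ n ih =>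
    intro x hx
    have hn : -((n + 1 : ℕ) : ℤ) + 1 = -(n : ℤ) := by push_cast; ring
    obtain ⟨y, hy, y', hy', rfl⟩ := A.exists_above_pred hx
    rw [map_add, h.map_stepOp]
    refine add_mem (above_anti (by omega) (ih y (by rwa [hn] at hy))) (A'.stepOp_above ?_)
    rw [hn] at hy' ⊢
    exact ih y' hy'

theorem map_below (h : IsIntertwiner G A.op A'.op) (n : ℤ) :
    ∀ x ∈ below n, G x ∈ below n := by
  obtain ⟨n, rfl | rfl⟩ := n.eq_nat_or_neg
  · exact h.map_below_nat n
  · refine fun x hx => mem_below_of_orthogonal fun y hy => ?_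
    rw [← G.apply_symm_apply y, G.inner_map_map, ← inner_conj_symm,
      inner_eq_zero_of_below_above hx (h.symm.map_above_neg_nat n y hy), map_zero]

theorem map_above (h : IsIntertwiner G A.op A'.op) (n : ℤ) :
    ∀ x ∈ above n, G x ∈ above n := fun x hx => mem_above_of_orthogonal fun y hy => by
  rw [← G.apply_symm_apply y, G.inner_map_map,
    inner_eq_zero_of_below_above (h.symm.map_below n y hy) hx]

theorem map_e (h : IsIntertwiner G A.op A'.op) (n : ℤ) : G (e n) = G (e n) n • e n :=
  eq_smul_e (h.map_below _ _ (e_mem_below (by omega))) (h.map_above _ _ (e_mem_above le_rfl))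

theorem norm_coeff (h : IsIntertwiner G A.op A'.op) (n : ℤ) : ‖G (e n) n‖ = 1 := by
  have h1 := G.norm_map (e n)
  rwa [h.map_e, norm_smul, orthonormal_e.1, mul_one] at h1

theorem coeff_mul_entry {T T' : L2 →L[ℂ] L2} (h : IsIntertwiner G A.op A'.op)
    (hT : ∀ x, G (T x) = T' (G x)) (i l : ℤ) :
    G (e l) l * entry T' i l = G (e i) i * entry T i l := by
  have h1 : inner ℂ (e i) (T' (G (e l))) = inner ℂ (e i) (G (T (e l))) := by rw [hT]
  have h2 : G (e i) i • e i = G (e i) := (h.map_e i).symm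
  have h3 : inner ℂ (e i) (G (T (e l))) = G (e i) i * entry T i l := by
    have h4 : e i = conj (G (e i) i) • G (e i) := by
      rw [← h2, smul_smul]
      have h5 : (e i : L2) i = 1 := by simp [e_apply]
      have h6 : (G (e i) i • e i : L2) i = G (e i) i := by
        change G (e i) i * e i i = _
        rw [h5, mul_one]
      rw [h6, ← Complex.normSq_eq_conj_mul_self, Complex.normSq_eq_norm_sq, h.norm_coeff]
      simp
    nth_rewrite 1 [h4]
    rw [inner_smul_left, G.inner_map_map, Complex.conj_conj, entry]
  rw [← h3, ← h1, h.map_e l, map_smul, inner_smul_right, ← h.map_e l, entry]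

/-- Conjugation by the diagonal `G` multiplies the entry in row `n + g + 1` and column `n` of
`stepOp n` by the ratio of two coefficients. The ratio is unimodular and both entries are positive,
so it is `1`. -/
theorem coeff_periodic (h : IsIntertwiner G A.op A'.op) (n : ℤ) :
    G (e (n + ((g : ℤ) + 1))) (n + ((g : ℤ) + 1)) = G (e n) n := by
  obtain ⟨r, hr, hr'⟩ := A.stepOp_entry_pos n
  obtain ⟨s, hs, hs'⟩ := A'.stepOp_entry_pos n
  have h1 := h.coeff_mul_entry (h.map_stepOp n) (n + ((g : ℤ) + 1)) n
  rw [hr', hs'] at h1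
  have h2 := congrArg norm h1
  rw [norm_mul, norm_mul, h.norm_coeff, h.norm_coeff, one_mul, one_mul, Complex.norm_real,
    Complex.norm_real, Real.norm_of_nonneg hr.le, Real.norm_of_nonneg hs.le] at h2
  rw [h2] at h1
  exact (mul_right_cancel₀ (Complex.ofReal_ne_zero.2 hr.ne') h1).symm

theorem coeff_add_mul (h : IsIntertwiner G A.op A'.op) (n j : ℤ) :
    G (e (n + j * ((g : ℤ) + 1))) (n + j * ((g : ℤ) + 1)) = G (e n) n := by
  induction j using Int.induction_on with
  | zero => simp
  | succ i hi =>
    rw [show n + ((i : ℤ) + 1) * ((g : ℤ) + 1) = n + i * ((g : ℤ) + 1) + (g + 1) by ring,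
      h.coeff_periodic, hi]
  | pred i hi =>
    rw [← hi, ← h.coeff_periodic (n + (-(i : ℤ) - 1) * ((g : ℤ) + 1)),
      show n + (-(i : ℤ) - 1) * ((g : ℤ) + 1) + (g + 1) = n + -(i : ℤ) * ((g : ℤ) + 1) by ring]

theorem signEquiv (h : IsIntertwiner G A.op A'.op) : SignEquiv A A' := by
  let ε : Fin (g + 1) → ℂ := fun m => G (e ((m : ℕ) : ℤ)) ((m : ℕ) : ℤ)
  have hε : ∀ (j : ℤ) (m : Fin (g + 1)),
      G (e (0 + (j * ((g : ℤ) + 1) + ((m : ℕ) : ℤ)))) (0 + (j * ((g : ℤ) + 1) + ((m : ℕ) : ℤ))) =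
        ε m := fun j m => by
    rw [show (0 : ℤ) + (j * ((g : ℤ) + 1) + ((m : ℕ) : ℤ)) =
      ((m : ℕ) : ℤ) + j * ((g : ℤ) + 1) by ring, h.coeff_add_mul]
  have hnorm : ∀ m, ‖ε m‖ = 1 := fun m => h.norm_coeff _
  -- Index `-1` is the last position of its block, and `G` fixes `e_{-1}`.
  have hlast : ε (Fin.last g) = 1 := by
    rw [← hε (-1) (Fin.last g), Fin.val_last,
      show (0 : ℤ) + (-1 * ((g : ℤ) + 1) + g) = -1 by ring, h.neg_one, e_apply, if_pos rfl]
  have hp : ∀ j m, (A'.p j m : ℂ) = ε m * A.p j m := by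
    intro j m
    have h1 := h.coeff_mul_entry h.map (0 + (j * ((g : ℤ) + 1) + ((m : ℕ) : ℤ)))
      (0 + j * ((g : ℤ) + 1) - 1)
    have h2 : (0 : ℤ) + j * ((g : ℤ) + 1) - 1 = -1 + j * ((g : ℤ) + 1) := by ring
    have h3 : G (e (0 + j * ((g : ℤ) + 1) - 1)) (0 + j * ((g : ℤ) + 1) - 1) = 1 := by
      rw [h2, h.coeff_add_mul, h.neg_one, e_apply, if_pos rfl]
    rw [h3, A.isClassAt.entry_column, A'.isClassAt.entry_column, hε, one_mul] at h1
    exact h1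
  have hpl : ∀ j, A'.p j (Fin.last g) = A.p j (Fin.last g) := fun j => by
    have := hp j (Fin.last g)
    rw [hlast, one_mul] at this
    exact_mod_cast this
  have hq : ∀ j m, ε m * (A'.q j m : ℂ) = A.q j m := by
    intro j m
    have h1 := h.coeff_mul_entry h.map
      (0 + (j * ((g : ℤ) + 1) + ((Fin.last g : Fin (g + 1)) : ℕ)))
      (0 + (j * ((g : ℤ) + 1) + ((m : ℕ) : ℤ)))
    rw [A.isClassAt.2, A'.isClassAt.2, hε, hε, hlast, one_mul, block_self, block_self,
      blockB_apply, blockB_apply, if_neg (Fin.le_last m).not_gt, if_neg (Fin.le_last m).not_gt,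
      Fin.snoc_last, ite_self, add_zero, add_zero, hpl] at h1
    have h2 : ((A.p j (Fin.last g) : ℝ) : ℂ) ≠ 0 := by exact_mod_cast (A.isClassA.1 j).ne'
    push_cast at h1
    apply mul_left_cancel₀ h2
    rw [← h1]; ring
  have hreal : ∀ m, ∃ s : ℝ, (s = 1 ∨ s = -1) ∧
      ∀ j, A'.p j m = s * A.p j m ∧ A'.q j m = s * A.q j m := by
    intro m
    by_cases him : (ε m).im = 0
    · have hs : ((ε m).re : ℂ) = ε m := Complex.ext rfl (by simp [him])
      have hsq : (ε m).re * (ε m).re = 1 := by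
        have h1 := hnorm m
        rw [← hs, Complex.norm_real, Real.norm_eq_abs] at h1
        rw [← abs_mul_abs_self, h1, one_mul]
      refine ⟨(ε m).re, mul_self_eq_one_iff.1 hsq, fun j => ⟨?_, ?_⟩⟩
      · have h1 := hp j m
        rw [← hs] at h1
        exact_mod_cast h1
      · have h1 := hq j m
        rw [← hs] at h1
        have h2 : (ε m).re * A'.q j m = A.q j m := by exact_mod_cast h1
        rw [← h2, ← mul_assoc, hsq, one_mul]
    -- A coefficient that is not real forces the real numbers `p_m`, `q_m` of both matrices to
    -- vanish in every block, so either sign will do.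
    · refine ⟨1, .inl rfl, fun j => ?_⟩
      have hzero : ∀ x y : ℝ, (x : ℂ) = ε m * y → y = 0 ∧ x = 0 := by
        intro x y hxy
        have h1 := congrArg Complex.im hxy
        rw [Complex.im_mul_ofReal, Complex.ofReal_im] at h1
        have h2 : y = 0 := (mul_eq_zero.1 h1.symm).resolve_left him
        refine ⟨h2, ?_⟩
        rw [h2, Complex.ofReal_zero, mul_zero] at hxy
        exact_mod_cast hxy
      obtain ⟨h1, h2⟩ := hzero _ _ (hp j m)
      obtain ⟨h3, h4⟩ := hzero _ _ (hq j m).symm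
      rw [h1, h2, h3, h4]; simp
  choose s hs hs' using hreal
  exact ⟨s, hs, fun j m => hs' m j⟩

end IsIntertwiner

/-! ### Intertwiners from sign changes -/

theorem isFlagProduct_one : IsFlagProduct (fun _ => 1) (fun _ => 1) where
  zero := rfl
  succ _ := (one_mul _).symm
  isUnit _ := isUnit_one
  map_star _ _ := rfl
  factor_isUnit _ := isUnit_one
  factor_symm _ := isRealSymm_one
  factor_below _ x hx := below_mono (by omega) hx
  factor_neg_one := rfl

theorem isStep_one (n : ℤ) : IsStep (fun _ => 1) n (e n) where
  mem := e_mem_below (by omega)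
  orth x hx := inner_eq_zero_of_below_above (n := n) hx (e_mem_above le_rfl)
  norm := orthonormal_e.1 n
  star_eq := star_e n
  span x hx := ⟨x n, sub_mem_below (n := n) hx⟩

/-- Diagonal unitary operators with entries `± 1`. -/
theorem exists_diagonal (σ : ℤ → ℝ) (hσ : ∀ n, σ n = 1 ∨ σ n = -1) :
    ∃ D : L2 ≃ₗᵢ[ℂ] L2, (∀ n, D (e n) = (σ n : ℂ) • e n) ∧
      ∀ n x, D x ∈ below n ↔ x ∈ below n := by
  obtain ⟨D, h1, h2, -⟩ := isFlagProduct_one.exists_unitary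
    (fun x hx => by
      ext n
      rw [← inner_e]
      exact hx (n + 1) _ (e_mem_below (by omega)))
    (fun x hx => by
      ext n
      exact mem_below.1 (show x ∈ below n from hx n) n le_rfl)
    (fun n => (isStep_one n).smul_sign (hσ n))
  exact ⟨D, h1, h2⟩

/-- The diagonal operator repeating the signs `ε` in each block conjugates one block matrix into the
other. Positivity of `p_g` forces `ε_g = 1`, so `e_{-1}` is fixed. -/
theorem SignEquiv.exists_isIntertwiner (h : SignEquiv A A') :
    ∃ D : L2 ≃ₗᵢ[ℂ] L2, IsIntertwiner D A.op A'.op := by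
  obtain ⟨ε, hε, hpq⟩ := h
  have hlast : ε (Fin.last g) = 1 := by
    refine (hε _).resolve_right fun h1 => ?_
    have h2 := A'.isClassA.1 0
    rw [(hpq 0 _).1, h1] at h2
    linarith [A.isClassA.1 0]
  have hsq : ∀ m, ε m * ε m = 1 := fun m => by rcases hε m with h | h <;> simp [h]
  have hblock : ∀ j l m n, ε n * block c A'.p A'.q j l m n =
      ε m * block c A.p A.q j l m n := by
    intro j l m n
    obtain h | h | h | h | h : l = j ∨ l = j + 1 ∨ j = l + 1 ∨ j + 2 ≤ l ∨ l + 2 ≤ j := by omega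
    · subst h
      rw [block_self, block_self, blockB_apply, blockB_apply, (hpq _ _).1, (hpq _ _).1,
        (hpq _ _).2, (hpq _ _).2]
      split_ifs with h1 h2 h2
      · exact absurd h2 h1.ne
      · linear_combination ε m * A.q l m * A.p l n * hsq n
      · subst h2; linear_combination ε m * A.p l m * A.q l m * hsq m
      · linear_combination ε m * A.p l m * A.q l n * hsq n
    · subst h
      rw [block_succ_right, block_succ_right, blockA_apply, blockA_apply, (hpq _ _).1]
      split_ifs with h1
      · rw [h1, hlast]; linear_combination A.p (j + 1) n * hsq n
      · ring
    · subst h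
      rw [block_succ_left, block_succ_left, blockA_apply, blockA_apply, (hpq _ _).1]
      split_ifs with h1
      · rw [h1, hlast]; ring
      · ring
    · rw [block_of_far _ _ _ (.inl h), block_of_far _ _ _ (.inl h)]; ring
    · rw [block_of_far _ _ _ (.inr h), block_of_far _ _ _ (.inr h)]; ring
  have hpos : (0 : ℤ) < (g : ℤ) + 1 := by positivity
  let σ : ℤ → ℝ := fun n => ε ⟨(n % ((g : ℤ) + 1)).toNat, by
    have := Int.emod_nonneg n hpos.ne'
    have := Int.emod_lt_of_pos n hpos
    omega⟩
  have hσ : ∀ (j : ℤ) (m : Fin (g + 1)), σ (0 + (j * ((g : ℤ) + 1) + ((m : ℕ) : ℤ))) = ε m := by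
    intro j m
    have hm := m.2
    have : (0 + (j * ((g : ℤ) + 1) + ((m : ℕ) : ℤ))) % ((g : ℤ) + 1) = ((m : ℕ) : ℤ) := by
      rw [zero_add, add_comm, Int.add_mul_emod_self_right, Int.emod_eq_of_lt (by omega) (by omega)]
    simp only [σ, this]
    congr 1
  obtain ⟨D, hD1, hD2⟩ := exists_diagonal σ fun n => hε _
  have hDs : ∀ n x, D x n = σ n * x n := by
    intro n x
    have hs : σ n * σ n = 1 := hsq _
    have h1 : e n = (σ n : ℂ) • D (e n) := by
      rw [hD1, smul_smul, ← Complex.ofReal_mul, hs]; simp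
    rw [← inner_e, h1, inner_smul_left, D.inner_map_map, inner_e, Complex.conj_ofReal]
  refine ⟨D, fun x => ?_, ?_, hD2 0⟩
  · have : D.toContinuousLinearEquiv.toContinuousLinearMap ∘L A.op =
        A'.op ∘L D.toContinuousLinearEquiv.toContinuousLinearMap := by
      refine clm_ext_entry fun i l => ?_
      obtain ⟨j, m, rfl⟩ := exists_block_index (g := g) 0 i
      obtain ⟨j', m', rfl⟩ := exists_block_index (g := g) 0 l
      rw [entry_eq, entry_eq]
      change D (A.op (e _)) _ = A'.op (D (e _)) _
      rw [hDs, hD1, map_smul]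
      change _ = (σ _ : ℂ) * A'.op (e _) _
      rw [← entry_eq, ← entry_eq, A.isClassAt.2, A'.isClassAt.2, hσ, hσ]
      rw [← Complex.ofReal_mul, ← Complex.ofReal_mul, hblock]
    exact congrArg (fun T : L2 →L[ℂ] L2 => T x) this
  · have h1 := hσ (-1) (Fin.last g)
    rw [Fin.val_last, show (0 : ℤ) + (-1 * ((g : ℤ) + 1) + g) = -1 by ring, hlast] at h1
    rw [hD1, h1]; simp

end SignEquiv

end GMP

namespace GMP

open scoped ComplexConjugate

variable {g : ℕ} {c : Fin g → ℝ}

/-! ### Construction of flag products -/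

theorem int_induction_iff {P : ℤ → Prop} (h0 : P 0) (h : ∀ n, P n ↔ P (n + 1)) (n : ℤ) : P n := by
  induction n using Int.induction_on with
  | zero => exact h0
  | succ i hi => exact (h _).1 hi
  | pred i hi => exact (h _).2 (by rwa [sub_add_cancel])

/-- The products are formed in the group of units, so the recursion also runs backwards. Since each
`Y n` is injective, commutation properties pass between `n` and `n + 1` in both directions. -/
theorem exists_isFlagProduct {Y : ℤ → L2 →L[ℂ] L2} (hu : ∀ n, IsUnit (Y n))
    (hs : ∀ n, IsRealSymm (Y n)) (hb : ∀ n, ∀ x ∈ below n, Y n x ∈ below (n + 1))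
    (h1 : Y (-1) = 1) :
    ∃ v, IsFlagProduct Y v ∧ ∀ B : L2 →L[ℂ] L2, (∀ n x, B (Y n x) = Y n (B x)) →
      ∀ n x, B (v n x) = v n (B x) := by
  obtain ⟨r, hr0, hr⟩ := exists_int_recursion fun n => (hu n).unit
  have hsucc : ∀ n, ((r (n + 1) : (L2 →L[ℂ] L2)ˣ) : L2 →L[ℂ] L2) = Y n * r n := fun n => by
    rw [hr]; rfl
  have happly : ∀ n x, (r (n + 1) : L2 →L[ℂ] L2) x = Y n ((r n : L2 →L[ℂ] L2) x) := fun n x => by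
    rw [hsucc]; rfl
  refine ⟨fun n => r n, ⟨by simp only [hr0, Units.val_one], hsucc, fun n => (r n).isUnit, ?_, hu, hs,
    hb, h1⟩, fun B hB => ?_⟩
  · refine int_induction_iff (by simp [hr0]) fun n => forall_congr' fun x => ?_
    rw [happly, happly, ← (hs n).map_star]
    exact (injective_of_isUnit (hu n)).eq_iff.symm
  · refine int_induction_iff (by simp [hr0]) fun n => forall_congr' fun x => ?_
    rw [happly, happly, hB]
    exact (injective_of_isUnit (hu n)).eq_iff.symm

theorem commute_res {A B : L2 →L[ℂ] L2} {o : Option ℝ} (ho : IsUnit (den A o))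
    (h : ∀ x, B (A x) = A (B x)) (x : L2) : B (res A o x) = res A o (B x) := by
  cases o with
  | none => exact h x
  | some t =>
    apply injective_of_isUnit ho
    have h1 : den A (some t) (res A (some t) (B x)) = B x := self_apply_inverse ho _
    have h2 : den A (some t) (res A (some t) x) = x := self_apply_inverse ho _
    rw [h1]
    nth_rewrite 2 [← h2]
    change (t : ℂ) • B (res A (some t) x) - A (B (res A (some t) x)) =
      B ((t : ℂ) • res A (some t) x - A (res A (some t) x))
    rw [map_sub, map_smul, h]

theorem commute_den {A B : L2 →L[ℂ] L2} (o : Option ℝ)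
    (h : ∀ x, B (A x) = A (B x)) (x : L2) : B (den A o x) = den A o (B x) := by
  cases o with
  | none => rfl
  | some t =>
    change B ((t : ℂ) • x - A x) = (t : ℂ) • B x - A (B x)
    rw [map_sub, map_smul, h]

theorem commute_inverse {T B : L2 →L[ℂ] L2} (hT : IsUnit T) (h : ∀ x, B (T x) = T (B x)) (x : L2) :
    B (Ring.inverse T x) = Ring.inverse T (B x) := by
  apply injective_of_isUnit hT
  rw [← h, self_apply_inverse hT, self_apply_inverse hT]

/-- The conjugate `U⁻¹ T U`. -/
noncomputable def conjOp (U : L2 ≃ₗᵢ[ℂ] L2) (T : L2 →L[ℂ] L2) : L2 →L[ℂ] L2 :=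
  U.symm.toContinuousLinearEquiv.toContinuousLinearMap ∘L T ∘L
    U.toContinuousLinearEquiv.toContinuousLinearMap

theorem apply_conjOp (U : L2 ≃ₗᵢ[ℂ] L2) (T : L2 →L[ℂ] L2) (x : L2) : U (conjOp U T x) = T (U x) :=
  U.apply_symm_apply _

theorem entry_conjOp (U : L2 ≃ₗᵢ[ℂ] L2) (T : L2 →L[ℂ] L2) (i l : ℤ) :
    entry (conjOp U T) i l = inner ℂ (U (e i)) (T (U (e l))) := by
  rw [entry, ← U.inner_map_map, apply_conjOp]

theorem IsRealSymm.conjOp {U : L2 ≃ₗᵢ[ℂ] L2} {T : L2 →L[ℂ] L2} (hT : IsRealSymm T)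
    (hU : ∀ x, U (star x) = star (U x)) : IsRealSymm (conjOp U T) where
  symm x y := by rw [← U.inner_map_map, apply_conjOp, hT.symm, ← apply_conjOp, U.inner_map_map]
  map_star x := by
    apply U.injective
    rw [apply_conjOp, hU, hU, hT.map_star, apply_conjOp]

/-! ### The Jacobi matrix of a GMP matrix -/

namespace GMPMatrix

variable (A : GMPMatrix c)

theorem inverse_den_below {n : ℤ} {x : L2} (hx : x ∈ below n) :
    Ring.inverse (den A.op (pole c n)) x ∈ below (n + 1) := by
  have h1 := A.stepOp_below hx
  unfold stepOp at h1
  cases h : pole c n with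
  | none =>
    change Ring.inverse (1 : L2 →L[ℂ] L2) x ∈ _
    rw [Ring.inverse_one]; exact below_mono (by omega) hx
  | some t => rwa [h] at h1

theorem inverse_den_op_below {n : ℤ} {x : L2} (hx : x ∈ below n) :
    Ring.inverse (den A.op (pole c n)) (A.op x) ∈ below (n + 1) := by
  have h1 := A.stepOp_below hx
  have hu := A.isUnit_den n
  unfold stepOp at h1
  cases h : pole c n with
  | none =>
    change Ring.inverse (1 : L2 →L[ℂ] L2) _ ∈ _
    rw [Ring.inverse_one]; rwa [h] at h1
  | some t =>
    rw [h] at h1 hu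
    change res A.op (some t) (A.op x) ∈ _
    rw [res_some_apply_sub hu]
    exact sub_mem (Submodule.smul_mem _ _ h1) (below_mono (by omega) hx)

theorem not_stepOp_below (n : ℤ) : ¬ ∀ x ∈ below n, A.stepOp n x ∈ below n := by
  intro h
  obtain ⟨r, hr, hr'⟩ := A.stepOp_entry_pos (n - ((g : ℤ) + 1))
  rw [stepOp, ← pole_add_period, sub_add_cancel, ← stepOp, entry_eq,
    mem_below.1 (h _ (e_mem_below (by omega))) n le_rfl] at hr'
  exact hr.ne (by exact_mod_cast hr')

/-- With `v_n` the product of the inverses `(o_k - A)⁻¹`, the operator `A` raises `flag v` by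
exactly one step. In an adapted real basis it is thus symmetric and tridiagonal, and the choice of
signs makes the off-diagonal entries positive. -/
theorem exists_jacobi : ∃ (J : JacobiMatrix) (U : L2 ≃ₗᵢ[ℂ] L2), IsIntertwiner U J.op A.op := by
  obtain ⟨v, hv, hcomm⟩ := exists_isFlagProduct
    (Y := fun n => Ring.inverse (den A.op (pole c n)))
    (fun n => (A.isUnit_den n).ringInverse)
    (fun n => (A.isRealSymm.den _).inverse (A.isUnit_den n))
    (fun n x hx => A.inverse_den_below hx)
    (by rw [pole_neg_one]; exact Ring.inverse_one _)
  have hcA : ∀ B : L2 →L[ℂ] L2, (∀ x, B (A.op x) = A.op (B x)) → ∀ n x, B (v n x) = v n (B x) :=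
    fun B hB => hcomm B fun n => commute_inverse (A.isUnit_den n) (commute_den _ hB)
  have hstep : ∀ n, ∀ x ∈ flag v n, A.op x ∈ flag v (n + 1) := by
    intro n x hx
    rw [mem_flag, hv.succ]
    change Ring.inverse (den A.op (pole c n)) (v n (A.op x)) ∈ below (n + 1)
    rw [← hcA A.op (fun _ => rfl)]
    exact A.inverse_den_op_below hx
  -- An `A`-invariant `flag v n` would be invariant under `stepOp n`; as `v n` commutes with that
  -- operator, `below n` would be invariant too, which `not_stepOp_below` excludes.
  have hne : ∀ n, ∃ x ∈ flag v n, A.op x ∉ flag v n := by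
    intro n
    by_contra! hcon
    refine A.not_stepOp_below n fun y hy => ?_
    have hy' : v n (Ring.inverse (v n) y) = y := self_apply_inverse (hv.isUnit n) y
    have h1 : A.stepOp n (Ring.inverse (v n) y) ∈ flag v n :=
      res_mem_of_invariant A.isRealSymm (A.isUnit_den n) (isClosed_flag v n) hcon
        (by rwa [mem_flag, hy'])
    have h2 : ∀ x, A.stepOp n (A.op x) = A.op (A.stepOp n x) := fun x =>
      (commute_res (A.isUnit_den n) (fun _ => rfl) x).symm
    rwa [mem_flag, ← hcA _ h2, hy'] at h1
  -- The vectors orthogonal to the whole flag form an `A`-invariant, hence resolvent-invariant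
  -- space. It is orthogonal to `ℓ²₋`, and by induction to every `below k`, since these are
  -- generated from `ℓ²₋` by the resolvents.
  have hd : ∀ x, (∀ n, ∀ y ∈ flag v n, inner ℂ y x = 0) → x = 0 := by
    let Z : Submodule ℂ L2 := (⨆ n, flag v n)ᗮ
    have hZ : ∀ x, x ∈ Z ↔ ∀ n, ∀ y ∈ flag v n, inner ℂ y x = 0 := fun x => by
      simp only [Z, ← Submodule.iInf_orthogonal, Submodule.mem_iInf, Submodule.mem_orthogonal]
    have hZA : ∀ x ∈ Z, A.op x ∈ Z := fun x hx => (hZ _).2 fun n y hy => by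
      rw [← A.isRealSymm.symm]; exact (hZ x).1 hx _ _ (hstep n y hy)
    have hZb : ∀ (k : ℕ), ∀ z ∈ Z, ∀ y ∈ below k, inner ℂ y z = 0 := by
      intro k
      induction k with
      | zero => exact fun z hz y hy => (hZ z).1 hz 0 y (by rw [hv.flag_zero]; exact hy)
      | succ k ih =>
        intro z hz y hy
        push_cast at hy
        obtain ⟨u, hu, u', hu', rfl⟩ := A.exists_below_succ hy
        rw [inner_add_left, ih z hz u hu, (A.isRealSymm_stepOp _).symm, ih _ ?_ u' hu', add_zero]
        exact res_mem_of_invariant A.isRealSymm (A.isUnit_den _)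
          (Submodule.isClosed_orthogonal _) hZA hz
    intro x hx
    ext n
    rw [← inner_e]
    exact hZb (n + 1).toNat x ((hZ x).2 hx) _ (e_mem_below (by omega))
  -- The dual argument: the intersection of the flag is invariant and contained in `ℓ²₋`, and is
  -- orthogonal to every `above (-k)` by induction.
  have hi : ∀ x, (∀ n, x ∈ flag v n) → x = 0 := by
    let Z : Submodule ℂ L2 := ⨅ n, flag v n
    have hZ : ∀ x, x ∈ Z ↔ ∀ n, x ∈ flag v n := fun x => Submodule.mem_iInf _
    have hZc : IsClosed (Z : Set L2) := by
      simp only [Z, Submodule.coe_iInf]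
      exact isClosed_iInter fun n => isClosed_flag v n
    have hZA : ∀ x ∈ Z, A.op x ∈ Z := fun x hx => (hZ _).2 fun n => by
      have := hstep (n - 1) x ((hZ x).1 hx _)
      rwa [sub_add_cancel] at this
    have hZb : ∀ (k : ℕ), ∀ z ∈ Z, ∀ y ∈ above (-k), inner ℂ z y = 0 := by
      intro k
      induction k with
      | zero =>
        intro z hz y hy
        have := (hZ z).1 hz 0
        rw [hv.flag_zero] at this
        exact inner_eq_zero_of_below_above this (by simpa using hy)
      | succ k ih =>
        intro z hz y hy
        obtain ⟨u, hu, u', hu', rfl⟩ := A.exists_above_pred hy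
        rw [show -((k + 1 : ℕ) : ℤ) + 1 = -(k : ℤ) by push_cast; ring] at hu hu'
        rw [inner_add_right, ih z hz u hu, ← (A.isRealSymm_stepOp _).symm, ih _ ?_ u' hu',
          add_zero]
        exact res_mem_of_invariant A.isRealSymm (A.isUnit_den _) hZc hZA hz
    intro x hx
    ext n
    have h1 := hZb (-n).toNat x ((hZ x).2 hx) (e n) (e_mem_above (by omega))
    rw [inner_e_right] at h1
    simpa using h1
  obtain ⟨U, hU1, hU2, hU3, hU4⟩ := hv.exists_adapted_unitary hd hi (X := fun _ => A.op)
    one_pos (fun _ => A.isRealSymm) hstep (fun n => hstep (n + 1)) (fun n => hne (n + 1))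
  have hT : IsRealSymm (conjOp U A.op) := A.isRealSymm.conjOp hU3
  have hb : ∀ n, conjOp U A.op (e n) ∈ below (n + 1 + 1) := fun n => by
    rw [← hU2, apply_conjOp]
    exact hstep _ _ ((hU2 _ _).2 (e_mem_below (by omega)))
  have hzero : ∀ i l, l + 1 < i → entry (conjOp U A.op) i l = 0 := fun i l hil => by
    rw [entry_eq]; exact mem_below.1 (hb l) i (by omega)
  refine ⟨⟨conjOp U A.op, fun n => (entry (conjOp U A.op) n (n - 1)).re,
    fun n => (entry (conjOp U A.op) n n).re, fun n => ?_, fun n => ?_⟩, U, ?_, hU1, fun x => ?_⟩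
  · have := hU4 (n - 1)
    rwa [sub_add_cancel, ← entry_conjOp] at this
  · ext i
    rw [← entry_eq, add_sub_cancel_right, hT.entry_real, hT.entry_real, hT.entry_real]
    change _ = _ * e (n - 1) i + _ * e n i + _ * e (n + 1) i
    simp only [e_apply]
    obtain h | h | h | h | h : i = n ∨ i = n - 1 ∨ i = n + 1 ∨ n + 1 < i ∨ i + 1 < n := by omega
    · subst h; simp [show i ≠ i - 1 by omega]
    · subst h
      rw [hT.entry_symm]
      simp [show n - 1 ≠ n + 1 by omega]
    · subst h; simp [show n + 1 ≠ n - 1 by omega]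
    · rw [hzero _ _ h]
      simp [show i ≠ n - 1 by omega, show i ≠ n by omega, show i ≠ n + 1 by omega]
    · rw [hT.entry_symm, hzero _ _ h]
      simp [show i ≠ n - 1 by omega, show i ≠ n by omega, show i ≠ n + 1 by omega]
  · exact apply_conjOp U A.op
  · have := hU2 0 x
    rwa [hv.flag_zero] at this

end GMPMatrix

end GMP

namespace GMP

open scoped ComplexConjugate

variable {g : ℕ} {c : Fin g → ℝ}

/-! ### The GMP matrix of a Jacobi matrix -/

theorem exists_le_pole_none (c : Fin g → ℝ) (n : ℤ) : ∃ m, n ≤ m ∧ pole c m = none := by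
  refine ⟨-1 + (|n| + 1) * ((g : ℤ) + 1), ?_, by rw [pole_add_mul, pole_neg_one]⟩
  have h1 := le_abs_self n
  have h2 := abs_nonneg n
  have h3 : (0 : ℤ) ≤ g := by positivity
  nlinarith

theorem exists_ge_pole_none (c : Fin g → ℝ) (n : ℤ) : ∃ m, m ≤ n ∧ pole c m = none := by
  refine ⟨-1 + (-|n|) * ((g : ℤ) + 1), ?_, by rw [pole_add_mul, pole_neg_one]⟩
  have h1 := neg_abs_le n
  have h2 := abs_nonneg n
  have h3 : (0 : ℤ) ≤ g := by positivity
  nlinarith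

namespace JacobiMatrix

variable (J : JacobiMatrix)

theorem op_below {n : ℤ} {x : L2} (hx : x ∈ below n) : J.op x ∈ below (n + 1) := by
  have : below n ≤ (below (n + 1)).comap J.op.toLinearMap :=
    below_le ((isClosed_below _).preimage J.op.continuous) fun l hl =>
      mem_below.2 fun i hi => by
        change J.op (e l) i = 0
        rw [← entry_eq, entry_op]
        simp [show i ≠ l - 1 by omega, show i ≠ l by omega, show i ≠ l + 1 by omega]
  exact this hx

theorem exists_below_succ {n : ℤ} {x : L2} (hx : x ∈ below (n + 1)) :
    ∃ y ∈ below n, ∃ y' ∈ below n, x = y + J.op y' := by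
  have hc : (J.a n : ℂ) ≠ 0 := by exact_mod_cast (J.a_pos n).ne'
  refine ⟨x - (x n / J.a n) • J.op (e (n - 1)), ?_, (x n / J.a n) • e (n - 1),
    Submodule.smul_mem _ _ (e_mem_below (by omega)), by rw [map_smul]; simp⟩
  have h0 : J.op (e (n - 1)) ∈ below (n + 1) := J.op_below (e_mem_below (by omega))
  have h1 := sub_mem_below (sub_mem hx (Submodule.smul_mem _ (x n / J.a n) h0))
  have h2 : (x - (x n / J.a n) • J.op (e (n - 1))) n = 0 := by
    change x n - x n / J.a n * J.op (e (n - 1)) n = 0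
    rw [← entry_eq, entry_op]
    simp [hc, show n ≠ n - 1 - 1 by omega, show n ≠ n - 1 by omega]
  rwa [h2, zero_smul, sub_zero] at h1

theorem exists_above_pred {n : ℤ} {x : L2} (hx : x ∈ above n) :
    ∃ y ∈ above (n + 1), ∃ y' ∈ above (n + 1), x = y + J.op y' := by
  have hc : (J.a (n + 1) : ℂ) ≠ 0 := by exact_mod_cast (J.a_pos (n + 1)).ne'
  refine ⟨x - (x n / J.a (n + 1)) • J.op (e (n + 1)), ?_, (x n / J.a (n + 1)) • e (n + 1),
    Submodule.smul_mem _ _ (e_mem_above (by omega)), by rw [map_smul]; simp⟩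
  have h0 : J.op (e (n + 1)) ∈ above n := mem_above_of_orthogonal fun y hy => by
    rw [← J.isRealSymm.symm]
    exact inner_eq_zero_of_below_above (J.op_below hy) (e_mem_above le_rfl)
  have h1 := sub_mem_above (sub_mem hx (Submodule.smul_mem _ (x n / J.a (n + 1)) h0))
  have h2 : (x - (x n / J.a (n + 1)) • J.op (e (n + 1))) n = 0 := by
    change x n - x n / J.a (n + 1) * J.op (e (n + 1)) n = 0
    rw [← entry_eq, entry_op]
    simp [hc, show n ≠ n + 1 + 1 by omega]
  rwa [h2, zero_smul, sub_zero] at h1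

theorem den_below (n : ℤ) (o : Option ℝ) {x : L2} (hx : x ∈ below n) :
    den J.op o x ∈ below (n + 1) := by
  cases o with
  | none => exact below_mono (by omega) hx
  | some t =>
    exact sub_mem (Submodule.smul_mem _ _ (below_mono (by omega) hx)) (J.op_below hx)

theorem den_res_below (n : ℤ) {o : Option ℝ} (ho : IsUnit (den J.op o)) {x : L2}
    (hx : x ∈ below n) : den J.op o (res J.op o x) ∈ below (n + 1) := by
  cases o with
  | none => exact J.op_below hx
  | some t =>
    have : den J.op (some t) (res J.op (some t) x) = x := self_apply_inverse ho x
    rw [this]; exact below_mono (by omega) hx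

theorem exists_den_below_succ {n : ℤ} {o : Option ℝ} (ho : IsUnit (den J.op o)) {x : L2}
    (hx : x ∈ below (n + 1)) :
    ∃ y ∈ below n, ∃ y' ∈ below n, x = den J.op o (y + res J.op o y') := by
  obtain ⟨y, hy, y', hy', rfl⟩ := J.exists_below_succ hx
  cases o with
  | none => exact ⟨y, hy, y', hy', rfl⟩
  | some t =>
    -- From `J y' = t y' - (t - J) y'`.
    refine ⟨-y', neg_mem hy', y + (t : ℂ) • y', add_mem hy (Submodule.smul_mem _ _ hy'), ?_⟩
    have : den J.op (some t) (res J.op (some t) (y + (t : ℂ) • y')) = y + (t : ℂ) • y' :=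
      self_apply_inverse ho _
    rw [map_add, this, map_neg]
    change y + J.op y' = -((t : ℂ) • y' - J.op y') + (y + (t : ℂ) • y')
    abel

/-- The data of a GMP basis for `J`: a unitary operator that maps the coordinate flag to a flag
on which the resolvents of `J` act in the same way as for a GMP matrix. -/
theorem exists_gmp_basis (hc : Function.Injective c) (hu : ∀ n, IsUnit (den J.op (pole c n))) :
    ∃ (E : ℤ → Submodule ℂ L2) (U : L2 ≃ₗᵢ[ℂ] L2), E 0 = below 0 ∧ U (e (-1)) = e (-1) ∧
      (∀ n x, U x ∈ E n ↔ x ∈ below n) ∧ (∀ x, U (star x) = star (U x)) ∧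
      (∀ n, ∀ x ∈ E n, res J.op (pole c n) x ∈ E (n + 1)) ∧
      (∀ n, ∀ x ∈ E (n + 1), ∃ y ∈ E n, ∃ y' ∈ E n, x = y + res J.op (pole c n) y') ∧
      ∀ n, 0 < (inner ℂ (U (e (n + ((g : ℤ) + 1)))) (res J.op (pole c n) (U (e n)))).re := by
  obtain ⟨v, hv, hcomm⟩ := exists_isFlagProduct (Y := fun n => den J.op (pole c n)) hu
    (fun n => J.isRealSymm.den _) (fun n x hx => J.den_below n _ hx)
    (by rw [pole_neg_one]; rfl)
  have hcJ : ∀ n x, J.op (v n x) = v n (J.op x) :=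
    hcomm J.op fun n => commute_den _ fun _ => rfl
  have hcr : ∀ n m x, res J.op (pole c m) (v n x) = v n (res J.op (pole c m) x) := fun n m x =>
    (commute_res (hu m) (fun y => (hcJ n y).symm) x).symm
  have hstep : ∀ n, ∀ x ∈ flag v n, res J.op (pole c n) x ∈ flag v (n + 1) := by
    intro n x hx
    rw [mem_flag, hv.succ]
    change den J.op (pole c n) (v n (res J.op (pole c n) x)) ∈ below (n + 1)
    rw [← hcr]
    exact J.den_res_below n (hu n) hx
  have hspan : ∀ n, ∀ x ∈ flag v (n + 1),
      ∃ y ∈ flag v n, ∃ y' ∈ flag v n, x = y + res J.op (pole c n) y' := by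
    intro n x hx
    rw [mem_flag, hv.succ] at hx
    change den J.op (pole c n) (v n x) ∈ below (n + 1) at hx
    obtain ⟨y, hy, y', hy', hxy⟩ := J.exists_den_below_succ (hu n) hx
    have h1 : v n (Ring.inverse (v n) y) = y := self_apply_inverse (hv.isUnit n) y
    have h2 : v n (Ring.inverse (v n) y') = y' := self_apply_inverse (hv.isUnit n) y'
    refine ⟨Ring.inverse (v n) y, by rwa [mem_flag, h1], Ring.inverse (v n) y',
      by rwa [mem_flag, h2], injective_of_isUnit (hv.isUnit n) ?_⟩
    rw [map_add, ← hcr, h1, h2]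
    exact injective_of_isUnit (hu n) hxy
  have hstrict : ∀ n, ∃ x ∈ flag v (n + 1), x ∉ flag v n := fun n => by
    obtain ⟨f, hf⟩ := hv.exists_isStep n
    refine ⟨f, hf.mem, fun hfn => ?_⟩
    have h1 := hf.orth f hfn
    rw [inner_self_eq_zero] at h1
    have h2 := hf.norm
    rw [h1, norm_zero] at h2
    exact zero_ne_one h2
  have hstepJ : ∀ {m}, pole c m = none → ∀ x ∈ flag v m, J.op x ∈ flag v (m + 1) :=
    fun {m} hm x hx => by
      have := hstep m x hx
      rwa [hm] at this
  -- Infinity recurs among the poles, so after each period `J` itself is applied to the flag; this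
  -- is enough to absorb every `below k`.
  have hd : ∀ x, (∀ n, ∀ y ∈ flag v n, inner ℂ y x = 0) → x = 0 := by
    have hle : ∀ k : ℕ, ∃ m, below k ≤ flag v m := by
      intro k
      induction k with
      | zero => exact ⟨0, by rw [hv.flag_zero]; exact le_rfl⟩
      | succ k ih =>
        obtain ⟨m, hm⟩ := ih
        obtain ⟨m', hmm', hm'⟩ := exists_le_pole_none c m
        refine ⟨m' + 1, fun x hx => ?_⟩
        push_cast at hx
        obtain ⟨y, hy, y', hy', rfl⟩ := J.exists_below_succ hx
        exact add_mem (hv.mono (by omega) (hm hy)) (hstepJ hm' _ (hv.mono hmm' (hm hy')))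
    intro x hx
    ext n
    rw [← inner_e]
    obtain ⟨m, hm⟩ := hle (n + 1).toNat
    exact hx m _ (hm (e_mem_below (by omega)))
  have hi : ∀ x, (∀ n, x ∈ flag v n) → x = 0 := by
    have hle : ∀ k : ℕ, ∃ m, ∀ y ∈ above (-k), ∀ x ∈ flag v m, inner ℂ x y = 0 := by
      intro k
      induction k with
      | zero =>
        refine ⟨0, fun y hy x hx => ?_⟩
        rw [hv.flag_zero] at hx
        exact inner_eq_zero_of_below_above hx (by simpa using hy)
      | succ k ih =>
        obtain ⟨m, hm⟩ := ih
        obtain ⟨m', hmm', hm'⟩ := exists_ge_pole_none c (m - 1)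
        refine ⟨m', fun y hy x hx => ?_⟩
        obtain ⟨u, hu, u', hu', rfl⟩ := J.exists_above_pred hy
        rw [show -((k + 1 : ℕ) : ℤ) + 1 = -(k : ℤ) by push_cast; ring] at hu hu'
        rw [inner_add_right, hm u hu x (hv.mono (by omega) hx), ← J.isRealSymm.symm,
          hm u' hu' _ (hv.mono (by omega) (hstepJ hm' x hx)), add_zero]
    intro x hx
    ext n
    obtain ⟨m, hm⟩ := hle (-n).toNat
    have h1 := hm (e n) (e_mem_above (by omega)) x (hx m)
    rw [inner_e_right] at h1
    simpa using h1
  -- If the resolvent at pole `n` sent `flag v (n + 1)` into `flag v (n + g + 1)`, it would send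
  -- each of the next members there as well, up to `flag v (n + g + 1)` itself. The partial fraction
  -- identity applies since the `g` poles passed differ from pole `n`. But pole `n` returns at index
  -- `n + g + 1`, where its resolvent must enlarge the flag.
  have hnot : ∀ n, ∃ x ∈ flag v (n + 1),
      res J.op (pole c n) x ∉ flag v (n + ((g : ℤ) + 1)) := by
    intro n
    by_contra! hcon
    have hall : ∀ m : ℕ, m ≤ g → ∀ x ∈ flag v (n + 1 + m),
        res J.op (pole c n) x ∈ flag v (n + ((g : ℤ) + 1)) := by
      intro m
      induction m with
      | zero => intro _ x hx; exact hcon x (by simpa using hx)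
      | succ m ih =>
        intro hm x hx
        rw [show n + 1 + ((m + 1 : ℕ) : ℤ) = n + 1 + m + 1 by push_cast; ring] at hx
        obtain ⟨y, hy, y', hy', rfl⟩ := hspan _ x hx
        obtain ⟨a, b, hab⟩ := res_sub_moebius (hu n) (hu (n + 1 + m))
          (pole_ne hc (show n < n + 1 + (m : ℤ) by omega)
            (show n + 1 + (m : ℤ) < n + (g + 1) by omega))
        rw [map_add, sub_eq_iff_eq_add.1 (hab y')]
        refine add_mem (ih (by omega) y hy) (add_mem (add_mem (Submodule.smul_mem _ _ ?_)
          (Submodule.smul_mem _ _ (ih (by omega) y' hy'))) (Submodule.smul_mem _ _ ?_))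
        · exact hv.mono (by omega) hy'
        · exact hv.mono (by omega) (hstep _ y' hy')
    obtain ⟨x, hx, hx'⟩ := hstrict (n + ((g : ℤ) + 1))
    obtain ⟨y, hy, y', hy', rfl⟩ := hspan _ x hx
    rw [pole_add_period] at hx'
    refine hx' (add_mem hy (hall g le_rfl y' ?_))
    rwa [show n + 1 + (g : ℤ) = n + (g + 1) by ring]
  obtain ⟨U, hU1, hU2, hU3, hU4⟩ := hv.exists_adapted_unitary hd hi
    (X := fun n => res J.op (pole c n)) (d := (g : ℤ) + 1) (by positivity)
    (fun n => J.isRealSymm.res (hu n))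
    (fun n x hx => hv.mono (by omega) (hstep n x hx))
    (fun n x hx => by
      have := hstep (n + ((g : ℤ) + 1)) x (hv.mono (by omega) hx)
      rwa [pole_add_period] at this) hnot
  exact ⟨flag v, U, hv.flag_zero, hU1, hU2, hU3, hstep, hspan, hU4⟩

/-- In the adapted basis all `g + 1` operators `R_s(J)` are handled alike: each is of the class `𝔸`
for blocks starting right after `s`, with the Möbius images of the other poles as collection. The
index `s = -1` gives the matrix with collection `c`, and `s = k` its inverses; injectivity of the
Möbius map keeps the points distinct. -/
theorem exists_gmpMatrix (hc : Function.Injective c) (hJ : ∀ k, (c k : ℂ) ∉ spectrum ℂ J.op) :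
    ∃ (A : GMPMatrix c) (U : L2 ≃ₗᵢ[ℂ] L2), IsIntertwiner U J.op A.op := by
  have hJu : ∀ k, IsUnit (algebraMap ℂ (L2 →L[ℂ] L2) (c k : ℂ) - J.op) := fun k =>
    spectrum.notMem_iff.1 (hJ k)
  have hu := isUnit_den_pole hJu
  obtain ⟨E, U, hE0, hU1, hU2, hU3, hstep, hspan, hpos⟩ := J.exists_gmp_basis hc hu
  have hclass : ∀ s : ℤ, ∃ p q, IsClassAt (s + 1)
      (fun m : Fin g => moebius (pole c s) (pole c (s + 1 + ((m : ℕ) : ℤ)))) p q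
      (conjOp U (res J.op (pole c s))) := by
    intro s
    refine exists_isClassAt ((J.isRealSymm.res (hu s)).conjOp hU3) (s + 1) _
      (fun j x hx => ?_) (fun j m x hx => ?_) fun j => ?_
    · rw [← hU2, apply_conjOp]
      have h1 : U x ∈ E (s + j * ((g : ℤ) + 1)) := (hU2 _ _).2 (by
        rwa [show s + 1 + j * ((g : ℤ) + 1) - 1 = s + j * ((g : ℤ) + 1) by ring] at hx)
      have h2 := hstep _ _ h1
      rw [pole_add_mul] at h2
      rwa [show s + 1 + j * ((g : ℤ) + 1) = s + j * ((g : ℤ) + 1) + 1 by ring]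
    · have hm := m.2
      obtain ⟨y, hy, y', hy', hxy⟩ := hspan _ _ ((hU2 _ _).2 hx)
      have hp : pole c (s + 1 + j * ((g : ℤ) + 1) + ((m : ℕ) : ℤ)) =
          pole c (s + 1 + ((m : ℕ) : ℤ)) := by
        rw [add_right_comm, pole_add_mul]
      rw [hp] at hxy
      obtain ⟨a, b, hab⟩ := res_sub_moebius (hu s) (hu (s + 1 + ((m : ℕ) : ℤ)))
        (pole_ne hc (by omega) (by omega))
      set μ := moebius (pole c s) (pole c (s + 1 + ((m : ℕ) : ℤ)))
      -- If `U x = y + R' y'` and `(R - μ) R' y' = a y' + b R y'`, then `(R - μ) U x = (a y' - μ y)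
      -- + R (y + b y')`.
      refine ⟨U.symm (a • y' - (μ : ℂ) • y), ?_, U.symm (y + b • y'), ?_, ?_⟩
      · rw [← hU2, U.apply_symm_apply]
        exact sub_mem (Submodule.smul_mem _ _ hy') (Submodule.smul_mem _ _ hy)
      · rw [← hU2, U.apply_symm_apply]
        exact add_mem hy (Submodule.smul_mem _ _ hy')
      · apply U.injective
        rw [map_sub, map_smul, map_add, apply_conjOp, apply_conjOp, U.apply_symm_apply,
          U.apply_symm_apply, hxy, map_add, map_add, map_smul, sub_eq_iff_eq_add.1 (hab y'),
          smul_add]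
        abel
    · have h1 := hpos (s + j * ((g : ℤ) + 1))
      rw [pole_add_mul, ← entry_conjOp] at h1
      rwa [show s + 1 + j * ((g : ℤ) + 1) + g = s + j * ((g : ℤ) + 1) + (g + 1) by ring,
        show s + 1 + j * ((g : ℤ) + 1) - 1 = s + j * ((g : ℤ) + 1) by ring]
  have hint : IsIntertwiner U (conjOp U J.op) J.op :=
    ⟨apply_conjOp U J.op, hU1, fun x => by
      have := hU2 0 x
      rwa [hE0] at this⟩
  have hunit : ∀ k, IsUnit (algebraMap ℂ (L2 →L[ℂ] L2) (c k : ℂ) - conjOp U J.op) := fun k =>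
    hint.symm.isUnit_den (isUnit_den_some (hJu k))
  obtain ⟨p, q, hA⟩ := hclass (-1)
  refine ⟨⟨conjOp U J.op, p, q, isClassA_iff.2 ?_, hunit, fun k => ?_⟩, U.symm, hint.symm⟩
  · have h1 : (fun m : Fin g => moebius (pole c (-1)) (pole c (-1 + 1 + ((m : ℕ) : ℤ)))) = c := by
      funext m
      rw [neg_add_cancel, zero_add, pole_neg_one, pole_cast]; rfl
    rw [h1, pole_neg_one] at hA
    exact hA
  · obtain ⟨p', q', h1⟩ := hclass ((k : ℕ) : ℤ)
    refine ⟨fun m : Fin g => moebius (pole c ((k : ℕ) : ℤ))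
        (pole c (((k : ℕ) : ℤ) + 1 + ((m : ℕ) : ℤ))), p', q', fun m n hmn => ?_,
      isClassA_shiftConj_iff.2 ?_⟩
    · have hm := m.2
      have hn := n.2
      have h2 := moebius_injective (pole_ne hc (by omega) (by omega))
        (pole_ne hc (by omega) (by omega)) hmn
      rcases lt_trichotomy (m : ℕ) (n : ℕ) with h | h | h
      · exact absurd h2 (pole_ne hc (by omega) (by omega))
      · exact Fin.ext h
      · exact absurd h2.symm (pole_ne hc (by omega) (by omega))
    · have h2 : Ring.inverse (algebraMap ℂ (L2 →L[ℂ] L2) (c k : ℂ) - conjOp U J.op) =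
          conjOp U (res J.op (pole c ((k : ℕ) : ℤ))) := by
        ext1 x
        apply U.injective
        rw [apply_conjOp, pole_cast]
        exact hint.map_res (o := some (c k)) (hunit k) x
      rw [h2]
      push_cast
      exact h1

end JacobiMatrix

/-- The definition of the transform only compares scalar functions. But `A` has an intertwined
Jacobi matrix, which is also a transform of `A`, and transforms are unique. -/
theorem IsTransform.exists_isIntertwiner {A : GMPMatrix c} {J : JacobiMatrix}
    (h : IsTransform A J) : ∃ U : L2 ≃ₗᵢ[ℂ] L2, IsIntertwiner U J.op A.op := by
  obtain ⟨J', U, hU⟩ := A.exists_jacobi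
  rw [h.unique hU.isTransform]
  exact ⟨U, hU⟩

end GMP

/-! ### The correspondence between Jacobi and GMP matrices -/

theorem mainTheorem6 {g : ℕ} (hg : 1 ≤ g) (c : Fin g → ℝ) (hc : Function.Injective c) :
    (∀ J : GMP.JacobiMatrix, (∀ k, (c k : ℂ) ∉ spectrum ℂ J.op) →
      ∃ A : GMP.GMPMatrix c, GMP.IsTransform A J ∧ GMP.IsUnitaryConjugate A J ∧
        ∀ A' : GMP.GMPMatrix c, GMP.IsTransform A' J ↔ GMP.SignEquiv A A') ∧
    (∀ A : GMP.GMPMatrix c, ∃! J : GMP.JacobiMatrix, GMP.IsTransform A J) ∧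
    (∀ (A : GMP.GMPMatrix c) (J : GMP.JacobiMatrix), GMP.IsTransform A J →
      GMP.IsUnitaryConjugate A J ∧ ∀ k, (c k : ℂ) ∉ spectrum ℂ J.op) := by
  refine ⟨fun J hJ => ?_, fun A => ?_, fun A J h => ?_⟩
  · obtain ⟨A, U, hU⟩ := J.exists_gmpMatrix hc hJ
    refine ⟨A, hU.isTransform, hU.isUnitaryConjugate, fun A' => ⟨fun h => ?_, fun h => ?_⟩⟩
    · obtain ⟨V, hV⟩ := h.exists_isIntertwiner
      exact (hU.symm.trans hV).signEquiv
    · obtain ⟨D, hD⟩ := h.exists_isIntertwiner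
      exact (hU.trans hD).isTransform
  · obtain ⟨J, U, hU⟩ := A.exists_jacobi
    exact ⟨J, hU.isTransform, fun J' h => h.unique hU.isTransform⟩
  · obtain ⟨U, hU⟩ := h.exists_isIntertwiner
    refine ⟨hU.isUnitaryConjugate, fun k => spectrum.notMem_iff.2 ?_⟩
    exact hU.symm.isUnit_den (GMP.isUnit_den_some (A.isUnit k))
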